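/- Let $E,F\in\mathbb C$ with $\operatorname{Im}E>0$, $\operatorname{Im}F>0$, $\operatorname{Re}E<\operatorname{Re}F$, and write ${}^*$ for complex conjugation. Let $\Sigma_1,\Sigma_F,\Sigma_2$ be the oriented segments from $E$ to $F$, from $F$ to $F^*$ and from $F^*$ to $E^*$; the $+$ side of each is its left side. Let $r$ be analytic and non-vanishing in a neighbourhood of $\Sigma_1$, put $\bar r(k)=r(k^*)^*$, fix a continuous branch of $\log(2r)$ on $\Sigma_1$, and put $\log\frac1{2r}=-\log(2r)$ on $\Sigma_1$ and $\log(2\bar r(k))=\bigl(\log(2r(k^*))\bigr)^*$ on $\Sigma_2$. Let $R(k)=\sqrt{(k-E)(k-E^*)(k-F)(k-F^*)}$ be the branch with cuts $\Sigma_1\cup\Sigma_2$ and $R(k)\sim k^2$ at $\infty$. All integrals between points of $\{E,E^*,F,F^*\}$ below run along these segments, with the boundary value $R_+$ on $\Sigma_1\cup\Sigma_2$. Define $e_1=\tfrac12(E+F+E^*+F^*)$, $$c_1=-\frac{\int_F^{F^*}\frac{\zeta^2-e_1\zeta}{R(\zeta)}d\zeta}{\int_F^{F^*}\frac{d\zeta}{R(\zeta)}},\qquad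 \Omega=\Bigl(\int_E^F+\int_{E^*}^{F^*}\Bigr)\frac{\zeta^2-e_1\zeta+c_1}{R_+(\zeta)}d\zeta,$$ $$\Delta=i\Bigl[\int_{\Sigma_1}\frac{\log\frac1{2r(\zeta)}}{R_+(\zeta)}d\zeta+\int_{\Sigma_2}\frac{\log(2\bar r(\zeta))}{R_+(\zeta)}d\zeta\Bigr]\Bigl[\int_F^{F^*}\frac{d\zeta}{R(\zeta)}\Bigr]^{-1},$$ $$\hat\omega=\Bigl(2\int_{F^*}^{F}\frac{dk}{R(k)}\Bigr)^{-1}\frac{dk}{R(k)},\qquad \tau=\Bigl(\int_{F^*}^{F}\frac{dk}{R(k)}\Bigr)^{-1}\int_E^F\frac{dk}{R_+(k)},$$ $$\vartheta_3(z;\tau)=\sum_{n\in\mathbb Z}e^{2\pi inz+\pi in^2\tau},\qquad A(k)=\int_E^k\hat\omega,\qquad E_0=\frac{EF-E^*F^*}{E+F-E^*-F^*},$$ where $A$ is taken in $\mathbb C\setminus(\Sigma_1\cup\Sigma_2\cup\Sigma_F)$, and let $\gamma(k)=\Bigl(\frac{(k-E^*)(k-F^*)}{(k-E)(k-F)}\Bigr)^{1/4}$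 be the branch analytic off $\Sigma_1\cup\Sigma_2\cup\Sigma_F$ with $\gamma(\infty)=1$. **Theorem.** One has $\operatorname{Im}\tau>0$, $E_0\notin\Sigma_1\cup\Sigma_2\cup\Sigma_F$, the function $A$ is well defined, and the limit $A(\infty)=\lim_{k\to\infty}A(k)$ exists. For every $x\in\mathbb R$ the following Riemann–Hilbert problem has a solution: $S^\infty$ is a $2\times2$ matrix function analytic in $\mathbb C\setminus(\Sigma_1\cup\Sigma_2\cup\Sigma_F)$; on the three open segments it has boundary values from both sides with $$S^\infty_+=S^\infty_-\begin{pmatrix}0&i\\ i&0\end{pmatrix}\ \text{on }\Sigma_1\cup\Sigma_2,\qquad S^\infty_+=S^\infty_-\begin{pmatrix}e^{i(x\Omega+\Delta)}&0\\0&e^{-i(x\Omega+\Delta)}\end{pmatrix}\ \text{on }\Sigma_F;$$ and $S^\infty(k)=I+\mathcal O(1/k)$ as $k\to\infty$. With $s=\frac{x\Omega+\Delta}{2\pi}$ and $\vartheta_3(\cdot)=\vartheta_3(\cdot;\tau)$ a solution is $$S^\infty_{11}(k)=\tfrac12\Bigl(\gamma(k)+\tfrac1{\gamma(k)}\Bigr)\frac{\vartheta_3(A(k)-A(E_0)-\frac\tau2-s)}{\vartheta_3(A(k)-A(E_0)-\frac12-\frac\tau2)}\,\frac{\vartheta_3(A(\infty)-A(E_0)-\frac12-\frac\tau2)}{\vartheta_3(A(\infty)-A(E_0)-\frac\tau2-s)},$$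 $$S^\infty_{12}(k)=\tfrac12\Bigl(\gamma(k)-\tfrac1{\gamma(k)}\Bigr)\frac{\vartheta_3(A(k)+A(E_0)+\frac\tau2+s)}{\vartheta_3(A(k)+A(E_0)+\frac12+\frac\tau2)}\,\frac{\vartheta_3(A(\infty)-A(E_0)-\frac12-\frac\tau2)}{\vartheta_3(A(\infty)-A(E_0)-\frac\tau2-s)},$$ $$S^\infty_{21}(k)=\tfrac12\Bigl(\gamma(k)-\tfrac1{\gamma(k)}\Bigr)\frac{\vartheta_3(A(k)+A(E_0)+\frac\tau2-s)}{\vartheta_3(A(k)+A(E_0)+\frac12+\frac\tau2)}\,\frac{\vartheta_3(A(\infty)-A(E_0)-\frac12-\frac\tau2)}{\vartheta_3(A(\infty)-A(E_0)-\frac\tau2+s)},$$ $$S^\infty_{22}(k)=\tfrac12\Bigl(\gamma(k)+\tfrac1{\gamma(k)}\Bigr)\frac{\vartheta_3(A(k)-A(E_0)-\frac\tau2+s)}{\vartheta_3(A(k)-A(E_0)-\frac12-\frac\tau2)}\,\frac{\vartheta_3(A(\infty)-A(E_0)-\frac12-\frac\tau2)}{\vartheta_3(A(\infty)-A(E_0)-\frac\tau2+s)}.$$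 Here no denominator vanishes for $k\notin\Sigma_1\cup\Sigma_2\cup\Sigma_F$, except that of the $k$-dependent quotient in $S^\infty_{11},S^\infty_{22}$ at $k=E_0$, where the singularity of these entries is removable and is filled in by continuity. This solution satisfies $S^\infty(k)=\mathcal O(|k-p|^{-1/4})$ as $k\to p$ for $p\in\{E,E^*,F,F^*\}$, and it is the only solution of the problem that does. -/

import Mathlib

open Filter Topology ComplexConjugate

noncomputable section

namespace SolitonGas

/-! Throughout, `E` and `F` are the branch points in the upper half plane. The three oriented
contours are the segments from `E` to `F` (`Sigma1`), from `F` to `conj F` (`SigmaF`) and from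
`conj F` to `conj E` (`Sigma2`). -/

def Sigma1 (E F : ℂ) : Set ℂ := segment ℝ E F

def SigmaF (F : ℂ) : Set ℂ := segment ℝ F (conj F)

def Sigma2 (E F : ℂ) : Set ℂ := segment ℝ (conj F) (conj E)

/-- The full contour. -/
def contour (E F : ℂ) : Set ℂ := Sigma1 E F ∪ Sigma2 E F ∪ SigmaF F

/-- The integral of `f` along the segment from `a` to `b`. -/
def segInt (f : ℂ → ℂ) (a b : ℂ) : ℂ := (b - a) * ∫ t in (0 : ℝ)..1, f (a + t * (b - a))

/-- The branch of `√((k - E)(k - E*)(k - F)(k - F*))` with cuts `Sigma1` and `Sigma2` and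
`R k ~ k ^ 2` at infinity. A quotient `(k - b) / (k - a)` is a negative real exactly on the open
segment from `a` to `b`, and has positive imaginary part on the left of that segment; as the
principal power is continuous from above at the negative axis, the values of `R` on `Sigma1` and
`Sigma2` are the boundary values `R₊` from the left. -/
def R (E F k : ℂ) : ℂ :=
  ((k - E) * ((k - F) / (k - E)) ^ (1 / 2 : ℂ)) *
    ((k - conj F) * ((k - conj E) / (k - conj F)) ^ (1 / 2 : ℂ))

/-- The branch of `((k - E*)(k - F*) / ((k - E)(k - F))) ^ (1/4)` that is analytic off
`Sigma1 ∪ SigmaF ∪ Sigma2` and tends to `1` at infinity. -/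
def gam (E F k : ℂ) : ℂ :=
  ((k - F) / (k - E)) ^ (1 / 4 : ℂ) * ((k - conj F) / (k - F)) ^ (1 / 2 : ℂ) *
    ((k - conj E) / (k - conj F)) ^ (1 / 4 : ℂ)

def e1 (E F : ℂ) : ℂ := (E + F + conj E + conj F) / 2

def c1 (E F : ℂ) : ℂ :=
  -(segInt (fun z => (z ^ 2 - e1 E F * z) / R E F z) F (conj F)) /
    segInt (fun z => 1 / R E F z) F (conj F)

/-- The constant `Ω`. -/
def Omega (E F : ℂ) : ℂ :=
  segInt (fun z => (z ^ 2 - e1 E F * z + c1 E F) / R E F z) E F +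
    segInt (fun z => (z ^ 2 - e1 E F * z + c1 E F) / R E F z) (conj E) (conj F)

/-- The constant `Δ`; here `ℓ` is a branch of `log (2 r)` on `Sigma1`, so that `log (1 / (2 r))` is
`-ℓ` and `log (2 r̄)`, with `r̄ z = conj (r (conj z))`, is `conj (ℓ (conj z))` on `Sigma2`. -/
def Delta (E F : ℂ) (ℓ : ℂ → ℂ) : ℂ :=
  Complex.I *
    (segInt (fun z => -ℓ z / R E F z) E F +
      segInt (fun z => conj (ℓ (conj z)) / R E F z) (conj F) (conj E)) /
    segInt (fun z => 1 / R E F z) F (conj F)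

/-- The density of the normalized holomorphic differential `ω̂`. -/
def omegaHat (E F k : ℂ) : ℂ := (2 * segInt (fun z => 1 / R E F z) (conj F) F)⁻¹ * (1 / R E F k)

/-- The period `τ` of `ω̂`. -/
def tau (E F : ℂ) : ℂ :=
  (segInt (fun z => 1 / R E F z) (conj F) F)⁻¹ * segInt (fun z => 1 / R E F z) E F

/-- `A k` is the integral of `ω̂` from `E` to `k` in the complement of the contour: the primitive of
`ω̂` there that vanishes at `E`. -/
def IsAbelIntegral (E F : ℂ) (A : ℂ → ℂ) : Prop :=
  (∀ k ∉ contour E F, HasDerivAt A (omegaHat E F k) k) ∧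
    Tendsto A (𝓝[(contour E F)ᶜ] E) (𝓝 0)

def E0 (E F : ℂ) : ℂ := (E * F - conj E * conj F) / (E + F - conj E - conj F)

/-- Across the open segment from `a` to `b`, the function `S` has boundary values from the left and
from the right, and they satisfy `S₊ = S₋ J`. -/
def HasJump (S : ℂ → Matrix (Fin 2) (Fin 2) ℂ) (a b : ℂ) (J : Matrix (Fin 2) (Fin 2) ℂ) : Prop :=
  ∀ z ∈ openSegment ℝ a b, ∃ Sp Sm : Matrix (Fin 2) (Fin 2) ℂ,
    Tendsto S (𝓝[{k | 0 < ((k - z) / (b - a)).im}] z) (𝓝 Sp) ∧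
    Tendsto S (𝓝[{k | ((k - z) / (b - a)).im < 0}] z) (𝓝 Sm) ∧
    Sp = Sm * J

/-- The model Riemann-Hilbert problem with phase `φ` on `SigmaF`. -/
structure IsModelSolution (E F φ : ℂ) (S : ℂ → Matrix (Fin 2) (Fin 2) ℂ) : Prop where
  analytic : ∀ i j, DifferentiableOn ℂ (fun k => S k i j) (contour E F)ᶜ
  jump_Sigma1 : HasJump S E F !![0, Complex.I; Complex.I, 0]
  jump_Sigma2 : HasJump S (conj F) (conj E) !![0, Complex.I; Complex.I, 0]
  jump_SigmaF : HasJump S F (conj F)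
    !![Complex.exp (Complex.I * φ), 0; 0, Complex.exp (-(Complex.I * φ))]
  normalization : ∀ i j,
    (fun k => S k i j - (1 : Matrix (Fin 2) (Fin 2) ℂ) i j) =O[cocompact ℂ] (fun k : ℂ => k⁻¹)

/-- At most quarter-root singularities at the four endpoints. -/
def QuarterRootEndpoints (E F : ℂ) (S : ℂ → Matrix (Fin 2) (Fin 2) ℂ) : Prop :=
  ∀ p ∈ ({E, F, conj E, conj F} : Set ℂ), ∀ i j,
    (fun k => S k i j) =O[𝓝[(contour E F)ᶜ] p] (fun k => ‖k - p‖ ^ (-(1 / 4) : ℝ))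

/-- The Jacobi theta function `ϑ₃(z; τ) = ∑ exp (2 π i n z + π i n² τ)` at `τ = tau E F`. -/
def theta (E F z : ℂ) : ℂ := jacobiTheta₂ z (tau E F)

/-- The explicit matrix; `a` stands for `A k`, `a0` for `A E0`, `ainf` for `A ∞` and `s` for
`φ / (2 π)`. -/
def explicitMatrix (E F s ainf a0 a k : ℂ) : Matrix (Fin 2) (Fin 2) ℂ :=
  let t := tau E F
  let θ := theta E F
  let γ := gam E F k
  !![1 / 2 * (γ + 1 / γ) * (θ (a - a0 - t / 2 - s) / θ (a - a0 - 1 / 2 - t / 2)) *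
        (θ (ainf - a0 - 1 / 2 - t / 2) / θ (ainf - a0 - t / 2 - s)),
     1 / 2 * (γ - 1 / γ) * (θ (a + a0 + t / 2 + s) / θ (a + a0 + 1 / 2 + t / 2)) *
        (θ (ainf - a0 - 1 / 2 - t / 2) / θ (ainf - a0 - t / 2 - s));
     1 / 2 * (γ - 1 / γ) * (θ (a + a0 + t / 2 - s) / θ (a + a0 + 1 / 2 + t / 2)) *
        (θ (ainf - a0 - 1 / 2 - t / 2) / θ (ainf - a0 - t / 2 + s)),
     1 / 2 * (γ + 1 / γ) * (θ (a - a0 - t / 2 + s) / θ (a - a0 - 1 / 2 - t / 2)) *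
        (θ (ainf - a0 - 1 / 2 - t / 2) / θ (ainf - a0 - t / 2 + s))]

end SolitonGas

end

/-! The matrix is assembled from three functions whose behaviour across the contour is explicit: the
Abel integral `A`, the fourth root `gam` and the theta function. The differential `dk / R` has no
residue at infinity, so it has a primitive off the contour although that domain is not simply
connected. `R` changes sign across `Sigma1` and `Sigma2` and is analytic across `SigmaF`. Hence `A₊
+ A₋` is constant on each of the first two and `A₊ - A₋` is constant on the third, and following the
endpoint values along the contour gives the constants `0`, `-1` and `τ` (`abelJumps`). The fourth
root is multiplied by `i` across the first two segments and by `-1` across the third. Evenness, the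
period `1` and the quasi-period `τ` of theta turn these rules into the prescribed jump matrices
(`modelMatrix_neg`, `modelMatrix_sub_one`, `modelMatrix_add_tau`).

The harder half is that no denominator vanishes. This needs the exact zero set of theta, namely the
lattice translates of `1 / 2 + τ / 2`, all simple. It comes from comparing theta with the product of
the Jacobi triple product: their quotient is entire and doubly periodic, hence constant
(`IsThetaLike.eq_const_mul`). It also needs the location of the values of `A`. Conjugation symmetry
gives `conj (A (conj k)) = -1 / 2 - A k`, so `τ` is purely imaginary and `A` has real part `-1 / 4`
on the real axis. There the imaginary part of `A` is strictly decreasing, and the real axis together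
with infinity uses up exactly one period, so `A k` differs from `A E0` by a lattice element only at
`E0`. In the upper half plane a maximum principle for `cosh (2 π A / Im τ)`, whose values are
confined by an ellipse, gives `|Re A| < 1 / 4`; symmetry handles the lower half plane. In both, the
real part alone keeps the arguments of the denominators away from the zeros. At `E0` itself `gam ^ 2
= -1` (`gam_E0_sq`), so `gam + 1 / gam` cancels the simple zero of theta.

The phase is real because conjugation permutes the integrals that define `Ω` and `Δ`; therefore the
shift by `s` leaves imaginary parts alone and the normalizing denominators are nonzero as well.
Uniqueness is Liouville's theorem for `T * adjugate S`, which has no jump, removable singularities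
at the endpoints, and limit `1` at infinity. -/

namespace SolitonGas

/-! ### Zeros of the theta function through the Jacobi triple product -/

open Complex in
/-- One half of the product side of the Jacobi triple product identity. -/
noncomputable def halfProd (q x : ℂ) : ℂ := ∏' n : ℕ, (1 + q ^ (2 * n + 1) * x)

lemma summable_halfProd_norm {q : ℂ} (hq : ‖q‖ < 1) (x : ℂ) :
    Summable fun n : ℕ => ‖q ^ (2 * n + 1) * x‖ := by
  have h1 : ‖q‖ ^ 2 < 1 := by nlinarith [norm_nonneg q]
  have := ((summable_geometric_of_lt_one (by positivity) h1).mul_left (‖q‖)).mul_right ‖x‖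
  refine this.congr fun n => ?_
  rw [norm_mul, norm_pow]
  ring

lemma multipliable_halfProd {q : ℂ} (hq : ‖q‖ < 1) (x : ℂ) :
    Multipliable fun n : ℕ => 1 + q ^ (2 * n + 1) * x :=
  multipliable_one_add_of_summable (summable_halfProd_norm hq x)

lemma differentiable_halfProd {q : ℂ} (hq : ‖q‖ < 1) : Differentiable ℂ (halfProd q) := by
  have key : ∀ ρ : ℝ, DifferentiableOn ℂ (halfProd q) (Metric.ball 0 ρ) := by
    intro ρ
    have h := Summable.hasProdLocallyUniformlyOn_nat_one_add (K := Metric.ball (0 : ℂ) ρ)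
      (f := fun (n : ℕ) x => q ^ (2 * n + 1) * x) Metric.isOpen_ball
      (summable_halfProd_norm hq (ρ : ℂ))
      (.of_forall fun n x hx => by
        simp only [Metric.mem_ball, dist_zero_right] at hx
        rw [norm_mul, norm_mul]
        gcongr
        exact hx.le.trans (by simpa using le_abs_self ρ)) (fun n => by fun_prop)
    exact h.differentiableOn (.of_forall fun _ => by
      simpa [Finset.prod_fn] using DifferentiableOn.finsetProd (fun _ _ => by fun_prop))
      Metric.isOpen_ball
  intro x
  exact (key (‖x‖ + 1)).differentiableAt (Metric.isOpen_ball.mem_nhds (by simp))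

/-- Splitting off the factor `n = 0` leaves the same product with `x` scaled by `q ^ 2`. This is the
source of the quasi-periodicity under `z ↦ z + t`. -/
lemma halfProd_eq_mul {q : ℂ} (hq : ‖q‖ < 1) (x : ℂ) :
    halfProd q x = (1 + q * x) * halfProd q (q ^ 2 * x) := by
  have := (multipliable_halfProd hq (q ^ 2 * x))
  have h2 : (fun n : ℕ => 1 + q ^ (2 * n + 1) * (q ^ 2 * x)) =
      fun n : ℕ => 1 + q ^ (2 * (n + 1) + 1) * x := by
    funext n; ring
  rw [halfProd, halfProd, h2]
  rw [tprod_eq_zero_mul' (f := fun n : ℕ => 1 + q ^ (2 * n + 1) * x) (by rw [← h2]; exact this)]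
  simp

lemma halfProd_ne_zero {q x : ℂ} (hq : ‖q‖ < 1) (h : ∀ n : ℕ, 1 + q ^ (2 * n + 1) * x ≠ 0) :
    halfProd q x ≠ 0 :=
  tprod_one_add_ne_zero_of_summable (f := fun n : ℕ => q ^ (2 * n + 1) * x) h
    (summable_halfProd_norm hq x)

/-- The product side of the Jacobi triple product identity, up to a constant. -/
noncomputable def thetaProd (t z : ℂ) : ℂ :=
  halfProd (Complex.exp (Real.pi * Complex.I * t)) (Complex.exp (2 * Real.pi * Complex.I * z)) *
    halfProd (Complex.exp (Real.pi * Complex.I * t)) (Complex.exp (-(2 * Real.pi * Complex.I * z)))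

lemma norm_nome_lt_one {t : ℂ} (ht : 0 < t.im) : ‖Complex.exp (Real.pi * Complex.I * t)‖ < 1 := by
  rw [Complex.norm_exp, Real.exp_lt_one_iff]
  simp
  positivity

lemma differentiable_thetaProd {t : ℂ} (ht : 0 < t.im) : Differentiable ℂ (thetaProd t) := by
  have h := differentiable_halfProd (norm_nome_lt_one ht)
  unfold thetaProd
  exact (h.comp (by fun_prop)).mul (h.comp (by fun_prop))

/-- Equivalences are required because the induction over the integers also runs downwards. -/
lemma lattice_induction {p : ℂ → Prop} {t z : ℂ} (h1 : ∀ z, p z ↔ p (z + 1))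
    (ht : ∀ z, p z ↔ p (z + t)) (hz : p z) (n m : ℤ) : p (z + n + m * t) := by
  have hn : p (z + n) := by
    induction n using Int.induction_on with
    | zero => simpa using hz
    | succ i ih => simpa [add_assoc] using (h1 _).1 ih
    | pred i ih =>
      refine (h1 _).2 ?_
      convert ih using 1
      push_cast; ring
  induction m using Int.induction_on with
  | zero => simpa using hn
  | succ i ih =>
    convert (ht _).1 ih using 1
    push_cast; ring
  | pred i ih =>
    refine (ht _).2 ?_
    convert ih using 1
    push_cast; ring

/-- Entire functions with the quasi-periodicity of `ϑ₃`. -/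
structure IsThetaLike (t : ℂ) (f : ℂ → ℂ) : Prop where
  diff : Differentiable ℂ f
  add_one : ∀ z, f (z + 1) = f z
  add_period : ∀ z, f (z + t) = Complex.exp (-Real.pi * Complex.I * (t + 2 * z)) * f z

lemma isThetaLike_jacobiTheta {t : ℂ} (ht : 0 < t.im) : IsThetaLike t (jacobiTheta₂ · t) :=
  ⟨fun z => differentiableAt_jacobiTheta₂_fst z ht, fun z => jacobiTheta₂_add_left z t,
    fun z => jacobiTheta₂_add_left' z t⟩

lemma isThetaLike_thetaProd {t : ℂ} (ht : 0 < t.im) : IsThetaLike t (thetaProd t) := by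
  refine ⟨differentiable_thetaProd ht, fun z => ?_, fun z => ?_⟩
  · have h1 : Complex.exp (2 * Real.pi * Complex.I * (z + 1)) =
        Complex.exp (2 * Real.pi * Complex.I * z) := by
      rw [mul_add, mul_one, Complex.exp_add, Complex.exp_two_pi_mul_I, mul_one]
    rw [thetaProd, thetaProd, Complex.exp_neg, Complex.exp_neg, h1]
  · set q := Complex.exp (Real.pi * Complex.I * t) with hq
    set u := Complex.exp (2 * Real.pi * Complex.I * z) with hu
    have hq0 : q ≠ 0 := Complex.exp_ne_zero _
    have hu0 : u ≠ 0 := Complex.exp_ne_zero _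
    have hq1 : ‖q‖ < 1 := norm_nome_lt_one ht
    have h1 : Complex.exp (2 * Real.pi * Complex.I * (z + t)) = q ^ 2 * u := by
      rw [hq, hu, ← Complex.exp_nat_mul, ← Complex.exp_add]; congr 1; push_cast; ring
    have h2 : Complex.exp (-(2 * Real.pi * Complex.I * (z + t))) = (q ^ 2 * u)⁻¹ := by
      rw [Complex.exp_neg, h1]
    have h3 : Complex.exp (-(2 * Real.pi * Complex.I * z)) = u⁻¹ := by
      rw [Complex.exp_neg]
    have h4 : Complex.exp (-Real.pi * Complex.I * (t + 2 * z)) = (q * u)⁻¹ := by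
      rw [hq, hu, ← Complex.exp_add, ← Complex.exp_neg]; congr 1; ring
    rw [thetaProd, thetaProd, h1, h2, h3, h4, ← hq, ← hu]
    rw [halfProd_eq_mul hq1 u, halfProd_eq_mul hq1 (q ^ 2 * u)⁻¹]
    have h5 : q ^ 2 * (q ^ 2 * u)⁻¹ = u⁻¹ := by field_simp
    rw [h5]
    field_simp
    ring

namespace IsThetaLike

variable {t : ℂ} {f : ℂ → ℂ}

lemma deriv_add_one (h : IsThetaLike t f) (z : ℂ) : deriv f (z + 1) = deriv f z := by
  rw [← deriv_comp_add_const]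
  exact congrArg (deriv · z) (funext h.add_one)

/-- The derivative of the exponential multiplier comes with the factor `f z`, so it drops out at a
zero. -/
lemma deriv_add_period (h : IsThetaLike t f) {z : ℂ} (hz : f z = 0) :
    deriv f (z + t) = Complex.exp (-Real.pi * Complex.I * (t + 2 * z)) * deriv f z := by
  rw [← deriv_comp_add_const]
  have h1 : (fun x => f (x + t)) =
      fun z => Complex.exp (-Real.pi * Complex.I * (t + 2 * z)) * f z := funext h.add_period
  rw [h1, deriv_fun_mul (by fun_prop) (h.diff z), hz]
  ring

lemma eq_zero_add_one (h : IsThetaLike t f) (z : ℂ) : f z = 0 ↔ f (z + 1) = 0 := by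
  rw [h.add_one]

lemma eq_zero_add_period (h : IsThetaLike t f) (z : ℂ) : f z = 0 ↔ f (z + t) = 0 := by
  rw [h.add_period, mul_eq_zero, or_iff_right (Complex.exp_ne_zero _)]

lemma zero_add_lattice (h : IsThetaLike t f) {z : ℂ} (hz : f z = 0) (n m : ℤ) :
    f (z + n + m * t) = 0 :=
  lattice_induction (p := fun z => f z = 0) h.eq_zero_add_one h.eq_zero_add_period hz n m

/-- Vanishing to order exactly one is invariant under the lattice. -/
lemma simpleZero_add_lattice (h : IsThetaLike t f) {z : ℂ} (hz : f z = 0) (hd : deriv f z ≠ 0)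
    (n m : ℤ) : f (z + n + m * t) = 0 ∧ deriv f (z + n + m * t) ≠ 0 := by
  refine lattice_induction (p := fun z => f z = 0 ∧ deriv f z ≠ 0) (fun z => ?_) (fun z => ?_)
    ⟨hz, hd⟩ n m
  · rw [h.add_one, h.deriv_add_one]
  · rw [← h.eq_zero_add_period]
    refine and_congr_right fun h0 => ?_
    rw [h.deriv_add_period h0]
    simp

end IsThetaLike

/-- A convergent product vanishes only if a factor does, and `q ^ (2 n + 1) * exp w = -1` is solved
by comparing exponents with `exp (π i)`. -/
lemma thetaProd_eq_zero {t z : ℂ} (ht : 0 < t.im) (hz : thetaProd t z = 0) :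
    ∃ n m : ℤ, z = (1 / 2 + t / 2) + n + m * t := by
  have hI : (2 * Real.pi * Complex.I : ℂ) ≠ 0 := Complex.two_pi_I_ne_zero
  have aux : ∀ w : ℂ, halfProd (Complex.exp (Real.pi * Complex.I * t)) (Complex.exp w) = 0 →
      ∃ n m : ℤ, w = 2 * Real.pi * Complex.I * ((1 / 2 + t / 2) + n + m * t) := by
    intro w hw
    by_contra! hcon
    refine halfProd_ne_zero (norm_nome_lt_one ht) (fun n h0 => ?_) hw
    rw [← Complex.exp_nat_mul, ← Complex.exp_add] at h0
    have h1 : Complex.exp (((2 * n + 1 : ℕ) : ℂ) * (Real.pi * Complex.I * t) + w) =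
        Complex.exp (Real.pi * Complex.I) := by
      rw [Complex.exp_pi_mul_I]; linear_combination h0
    obtain ⟨j, hj⟩ := Complex.exp_eq_exp_iff_exists_int.mp h1
    refine hcon j (-n - 1) ?_
    push_cast at hj ⊢
    linear_combination hj
  rcases mul_eq_zero.mp hz with h | h
  · obtain ⟨n, m, e⟩ := aux _ h
    exact ⟨n, m, mul_left_cancel₀ hI e⟩
  · obtain ⟨n, m, e⟩ := aux _ h
    -- The second product has the reflected zeros, and `-(1 / 2 + t / 2)` equals `(1 / 2 + t / 2) -
    -- 1 - t`.
    refine ⟨-n - 1, -m - 1, mul_left_cancel₀ hI ?_⟩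
    push_cast
    linear_combination -e

/-- At the half period exactly one factor vanishes, the first one of the second product. All the
others equal `1 - q ^ (2 n + 2)`, which is nonzero since `‖q‖ < 1`, so the order of vanishing is
read off that single factor, whose derivative is `2 π i`. -/
lemma thetaProd_simpleZero {t : ℂ} (ht : 0 < t.im) :
    thetaProd t (1 / 2 + t / 2) = 0 ∧ deriv (thetaProd t) (1 / 2 + t / 2) ≠ 0 := by
  set q := Complex.exp (Real.pi * Complex.I * t) with hq
  have hq1 := norm_nome_lt_one ht
  have hq0 : q ≠ 0 := Complex.exp_ne_zero _
  have hd := differentiable_halfProd hq1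
  set g : ℂ → ℂ := fun z => halfProd q (Complex.exp (2 * Real.pi * Complex.I * z)) *
    halfProd q (q ^ 2 * Complex.exp (-(2 * Real.pi * Complex.I * z))) with hg
  have hgd : Differentiable ℂ g :=
    (hd.comp (by fun_prop)).mul (hd.comp (by fun_prop))
  have hfac : thetaProd t =
      fun z => (1 + q * Complex.exp (-(2 * Real.pi * Complex.I * z))) * g z := by
    funext z
    rw [thetaProd, ← hq, halfProd_eq_mul hq1 (Complex.exp (-(2 * Real.pi * Complex.I * z))), hg]
    ring
  have hexp : Complex.exp (2 * Real.pi * Complex.I * (1 / 2 + t / 2)) = -q := by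
    rw [show (2 * Real.pi * Complex.I * (1 / 2 + t / 2) : ℂ) =
      Real.pi * Complex.I + Real.pi * Complex.I * t by ring, Complex.exp_add,
      Complex.exp_pi_mul_I]
    ring
  have hexp' : Complex.exp (-(2 * Real.pi * Complex.I * (1 / 2 + t / 2))) = -q⁻¹ := by
    rw [Complex.exp_neg, hexp, inv_neg]
  have hpow : ∀ n : ℕ, 1 - q ^ (n + 1) ≠ 0 := by
    intro n h
    have h1 : ‖q ^ (n + 1)‖ = 1 := by rw [← sub_eq_zero.mp h, norm_one]
    rw [norm_pow] at h1
    exact absurd h1 (pow_lt_one₀ (norm_nonneg _) hq1 (by simp)).ne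
  have hg0 : g (1 / 2 + t / 2) ≠ 0 := by
    simp only [hg, hexp, hexp']
    refine mul_ne_zero (halfProd_ne_zero hq1 fun n => ?_) (halfProd_ne_zero hq1 fun n => ?_)
    · have := hpow (2 * n + 1)
      convert this using 1; ring
    · have := hpow (2 * n + 1)
      convert this using 1
      field_simp
      ring
  have hz : 1 + q * Complex.exp (-(2 * Real.pi * Complex.I * (1 / 2 + t / 2))) = 0 := by
    rw [hexp']; field_simp; ring
  refine ⟨by rw [hfac]; simp only [hz, zero_mul], ?_⟩
  have hde : HasDerivAt (fun z : ℂ => 1 + q * Complex.exp (-(2 * Real.pi * Complex.I * z)))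
      (2 * Real.pi * Complex.I) (1 / 2 + t / 2) := by
    have h1 : HasDerivAt (fun z : ℂ => -(2 * Real.pi * Complex.I * z))
      (-(2 * Real.pi * Complex.I * 1)) (1 / 2 + t / 2) :=
      ((hasDerivAt_id _).const_mul _).neg
    have h2 := (h1.cexp.const_mul q).const_add 1
    rw [hexp'] at h2
    refine h2.congr_deriv ?_
    linear_combination (2 * Real.pi * Complex.I : ℂ) * mul_inv_cancel₀ hq0
  rw [hfac, (hde.fun_mul (hgd _).hasDerivAt).deriv, hz, zero_mul, add_zero]
  exact mul_ne_zero Complex.two_pi_I_ne_zero hg0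

/-- Evenness and the period `1` identify the values at `1 / 2 - t / 2` and `1 / 2 + t / 2`, while
the shift by `t` between them carries the multiplier `exp (-π i) = -1`. The value equals its own
negative. -/
lemma jacobiTheta_half_period {t : ℂ} : jacobiTheta₂ (1 / 2 + t / 2) t = 0 := by
  have h1 := jacobiTheta₂_add_left' (1 / 2 - t / 2) t
  have h2 : jacobiTheta₂ (1 / 2 - t / 2) t = jacobiTheta₂ (1 / 2 + t / 2) t := by
    rw [← jacobiTheta₂_neg_left, ← jacobiTheta₂_add_left]
    congr 1; ring
  rw [show (1 / 2 - t / 2 + t : ℂ) = 1 / 2 + t / 2 by ring, h2,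
    show (-Real.pi * Complex.I * (t + 2 * (1 / 2 - t / 2)) : ℂ) = -(Real.pi * Complex.I) by ring,
    Complex.exp_neg, Complex.exp_pi_mul_I] at h1
  norm_num at h1
  have h3 : 2 * jacobiTheta₂ (1 / 2 + t / 2) t = 0 := by linear_combination h1
  simpa using h3

/-- A theta-like function that vanishes at the zeros of another one, which are simple, is a multiple
of it. -/
lemma IsThetaLike.eq_const_mul {t : ℂ} {f g : ℂ → ℂ} (ht : 0 < t.im) (hf : IsThetaLike t f)
    (hg : IsThetaLike t g) (hfg : ∀ z, g z = 0 → f z = 0) (hd : ∀ z, g z = 0 → deriv g z ≠ 0) :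
    ∃ c : ℂ, ∀ z, f z = c * g z := by
  classical
  -- The quotient `f / g`, with its removable singularities filled in by L'Hôpital's rule.
  set h : ℂ → ℂ := fun z => if g z = 0 then deriv f z / deriv g z else f z / g z with hh
  -- Near a zero the common factor `z - z₀` cancels; the remaining denominator has the value `deriv
  -- g z₀ ≠ 0` at `z₀`.
  have hloc : ∀ z₀, g z₀ = 0 → h =ᶠ[𝓝 z₀] fun z => dslope f z₀ z / dslope g z₀ z := by
    intro z₀ h0
    have hc : ContinuousAt (dslope g z₀) z₀ := continuousAt_dslope_same.2 (hg.diff z₀)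
    have hne : ∀ᶠ z in 𝓝 z₀, dslope g z₀ z ≠ 0 := hc.eventually_ne (by
      rw [dslope_same]; exact hd z₀ h0)
    filter_upwards [hne] with z hz
    rcases eq_or_ne z z₀ with rfl | hzz
    · simp [hh, h0]
    · have e1 := sub_smul_dslope f z₀ z
      have e2 := sub_smul_dslope g z₀ z
      rw [h0, sub_zero, smul_eq_mul] at e2
      rw [hfg z₀ h0, sub_zero, smul_eq_mul] at e1
      have hgz : g z ≠ 0 := by
        rw [← e2]; exact mul_ne_zero (sub_ne_zero.2 hzz) hz
      simp only [hh, hgz, if_false]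
      rw [← e1, ← e2, mul_div_mul_left _ _ (sub_ne_zero.2 hzz)]
  have hdiff : Differentiable ℂ h := by
    intro z₀
    by_cases h0 : g z₀ = 0
    · have hD : ∀ k : ℂ → ℂ, Differentiable ℂ k → DifferentiableAt ℂ (dslope k z₀) z₀ := by
        intro k hk
        exact ((Complex.differentiableOn_dslope univ_mem).2 hk.differentiableOn).differentiableAt
          univ_mem
      refine ((hD f hf.diff).div (hD g hg.diff) ?_).congr_of_eventuallyEq (hloc z₀ h0)
      rw [dslope_same]; exact hd z₀ h0
    · refine ((hf.diff z₀).div (hg.diff z₀) h0).congr_of_eventuallyEq ?_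
      filter_upwards [(hg.diff z₀).continuousAt.eventually_ne h0] with z hz
      simp [hh, hz]
  have hmul : ∀ z, f z = h z * g z := by
    intro z
    by_cases h0 : g z = 0
    · rw [h0, hfg z h0, mul_zero]
    · simp only [hh, h0, if_false]; field_simp
  have hdense : Dense {z | g z ≠ 0} := by
    intro z
    by_cases h0 : g z = 0
    · have h1 : ∀ᶠ y in 𝓝[≠] z, g y ≠ 0 := (hg.diff z).hasDerivAt.eventually_ne (hd z h0)
      exact mem_closure_iff_frequently.2 (h1.frequently.filter_mono nhdsWithin_le_nhds)
    · exact subset_closure h0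
  -- Periodicity is evident only where `g` is nonzero; that set is dense because simple zeros are
  -- isolated, and `h` is continuous.
  have hper : ∀ k : ℂ, (∀ z, g z ≠ 0 → h (z + k) = h z) → ∀ z, h (z + k) = h z := by
    intro k hk z
    exact congrFun (Continuous.ext_on hdense (hdiff.continuous.comp (by fun_prop))
      hdiff.continuous hk) z
  have hp1 : ∀ z, h (z + 1) = h z := hper 1 fun z hz => by
    simp only [hh, hg.add_one, hz, if_false, hf.add_one]
  have hpt : ∀ z, h (z + t) = h z := hper t fun z hz => by
    have := (hg.eq_zero_add_period z).not.1 hz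
    simp only [hh, hz, this, if_false]
    rw [hf.add_period, hg.add_period, mul_div_mul_left _ _ (Complex.exp_ne_zero _)]
  have hlat : ∀ (z : ℂ) (n m : ℤ), h (z + n + m * t) = h z := fun z n m =>
    lattice_induction (p := fun w => h w = h z) (fun w => by rw [hp1]) (fun w => by rw [hpt])
      rfl n m
  -- A bound on the closed period parallelogram is a bound everywhere, by reducing real coordinates
  -- in the basis `1, t` to their fractional parts; then Liouville applies.
  obtain ⟨M, hM⟩ := (((isCompact_Icc (a := (0 : ℝ)) (b := 1)).prod
    (isCompact_Icc (a := (0 : ℝ)) (b := 1))).image_of_continuousOn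
    (f := fun p : ℝ × ℝ => h (p.1 + p.2 * t))
    (hdiff.continuous.comp (by fun_prop)).continuousOn).isBounded.exists_norm_le
  have hbdd : ∀ z, ‖h z‖ ≤ M := by
    intro z
    set y : ℝ := z.im / t.im
    set x : ℝ := (z - y * t).re
    have hz : z = x + y * t := by
      apply Complex.ext
      · simp [x]
      · simp [y, ht.ne']
    have e : h z = h ((Int.fract x : ℝ) + (Int.fract y : ℝ) * t) := by
      rw [← hlat ((Int.fract x : ℝ) + (Int.fract y : ℝ) * t) ⌊x⌋ ⌊y⌋]
      congr 1
      rw [hz]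
      have hx : (x : ℂ) = ⌊x⌋ + (Int.fract x : ℝ) := by exact_mod_cast (Int.floor_add_fract x).symm
      have hy : (y : ℂ) = ⌊y⌋ + (Int.fract y : ℝ) := by exact_mod_cast (Int.floor_add_fract y).symm
      rw [hx, hy]
      ring_nf
    rw [e]
    exact hM _ ⟨(Int.fract x, Int.fract y),
      ⟨⟨Int.fract_nonneg _, (Int.fract_lt_one _).le⟩, Int.fract_nonneg _, (Int.fract_lt_one _).le⟩,
      rfl⟩
  refine ⟨h 0, fun z => ?_⟩
  rw [hmul z, hdiff.apply_eq_apply_of_bounded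
    (isBounded_iff_forall_norm_le.2 ⟨M, by rintro _ ⟨y, rfl⟩; exact hbdd y⟩) z 0]

/-- For imaginary period all terms of the series at `0` are positive reals, and the term `n = 0` is
`1`. -/
lemma jacobiTheta_zero_ne_zero {T : ℝ} (hT : 0 < T) : jacobiTheta₂ 0 (T * Complex.I) ≠ 0 := by
  have h := hasSum_jacobiTheta₂_term 0 (τ := T * Complex.I) (by simpa using hT)
  have hre : HasSum (fun n : ℤ => Real.exp (-Real.pi * n ^ 2 * T))
      (jacobiTheta₂ 0 (T * Complex.I)).re := by
    convert Complex.hasSum_re h using 2 with n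
    rw [jacobiTheta₂_term, show (2 * Real.pi * Complex.I * n * 0 +
      Real.pi * Complex.I * n ^ 2 * (T * Complex.I) : ℂ) = ((-Real.pi * n ^ 2 * T : ℝ) : ℂ) by
        push_cast; linear_combination (Real.pi * n ^ 2 * T : ℂ) * Complex.I_mul_I]
    rw [Complex.exp_ofReal_re]
  have h1 := hre.tsum_eq ▸ hre.summable.sum_le_tsum {0} (fun n _ => (Real.exp_pos _).le)
  intro h0
  rw [h0] at h1
  simp at h1
  linarith

/-- The triple product identity up to its constant. A purely imaginary period serves only to see
that the constant is not zero, by evaluating at `0`. -/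
lemma jacobiTheta_eq_const_mul_thetaProd {t : ℂ} (ht : 0 < t.im) (hre : t.re = 0) :
    ∃ c : ℂ, c ≠ 0 ∧ ∀ z, jacobiTheta₂ z t = c * thetaProd t z := by
  have hP := isThetaLike_thetaProd ht
  obtain ⟨c, hc⟩ := (isThetaLike_jacobiTheta ht).eq_const_mul ht hP
    (fun z hz => by
      obtain ⟨n, m, rfl⟩ := thetaProd_eq_zero ht hz
      exact (isThetaLike_jacobiTheta ht).zero_add_lattice jacobiTheta_half_period n m)
    (fun z hz => by
      obtain ⟨n, m, rfl⟩ := thetaProd_eq_zero ht hz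
      exact (hP.simpleZero_add_lattice (thetaProd_simpleZero ht).1
        (thetaProd_simpleZero ht).2 n m).2)
  refine ⟨c, fun h0 => ?_, hc⟩
  have ht' : t = t.im * Complex.I := by apply Complex.ext <;> simp [hre]
  have := hc 0
  rw [h0, zero_mul, ht'] at this
  exact jacobiTheta_zero_ne_zero ht this

/-- For a purely imaginary period, the zeros of `ϑ₃` are the translates of `1 / 2 + t / 2`. -/
lemma jacobiTheta_eq_zero {t z : ℂ} (ht : 0 < t.im) (hre : t.re = 0) (hz : jacobiTheta₂ z t = 0) :
    ∃ n m : ℤ, z = (1 / 2 + t / 2) + n + m * t := by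
  obtain ⟨c, hc0, hc⟩ := jacobiTheta_eq_const_mul_thetaProd ht hre
  rw [hc] at hz
  exact thetaProd_eq_zero ht ((mul_eq_zero.1 hz).resolve_left hc0)

lemma jacobiTheta_deriv_half_period {t : ℂ} (ht : 0 < t.im) (hre : t.re = 0) :
    deriv (jacobiTheta₂ · t) (1 / 2 + t / 2) ≠ 0 := by
  obtain ⟨c, hc0, hc⟩ := jacobiTheta_eq_const_mul_thetaProd ht hre
  rw [show (jacobiTheta₂ · t) = fun z => c * thetaProd t z from funext hc, deriv_const_mul_field]
  exact mul_ne_zero hc0 (thetaProd_simpleZero ht).2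

end SolitonGas

namespace SolitonGas

/-! ### Primitives -/

lemma exists_eq_add_const_of_hasDerivAt {U : Set ℂ} (hU : IsOpen U) (hc : IsPreconnected U)
    {f A B : ℂ → ℂ} (hA : ∀ k ∈ U, HasDerivAt A (f k) k) (hB : ∀ k ∈ U, HasDerivAt B (f k) k) :
    ∃ c, ∀ k ∈ U, A k = B k + c := by
  rcases U.eq_empty_or_nonempty with rfl | ⟨x, hx⟩
  · exact ⟨0, by simp⟩
  refine ⟨A x - B x, fun k hk => ?_⟩
  have h : ∀ k ∈ U, HasDerivAt (fun k => A k - B k) 0 k := fun k hk => by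
    simpa using (hA k hk).fun_sub (hB k hk)
  have := hU.is_const_of_deriv_eq_zero hc
    (fun k hk => (h k hk).differentiableAt.differentiableWithinAt) (fun k hk => (h k hk).deriv) hk hx
  linear_combination this

/-- On a connected overlap the two primitives differ by one constant, which is absorbed into the
second of them. -/
lemma IsExactOn.union {U V : Set ℂ} {f : ℂ → ℂ} (hU : IsOpen U) (hV : IsOpen V)
    (hUV : IsPreconnected (U ∩ V)) (hfU : Complex.IsExactOn f U) (hfV : Complex.IsExactOn f V) :
    Complex.IsExactOn f (U ∪ V) := by
  classical
  obtain ⟨A, hA⟩ := hfU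
  obtain ⟨B, hB⟩ := hfV
  obtain ⟨c, hc⟩ := exists_eq_add_const_of_hasDerivAt (hU.inter hV) hUV
    (fun k hk => hA k hk.1) (fun k hk => hB k hk.2)
  refine ⟨fun k => if k ∈ U then A k else B k + c, fun k hk => ?_⟩
  by_cases hkU : k ∈ U
  · refine (hA k hkU).congr_of_eventuallyEq ?_
    filter_upwards [hU.mem_nhds hkU] with y hy
    simp [hy]
  · have hkV : k ∈ V := hk.resolve_left hkU
    refine ((hB k hkV).add_const c).congr_of_eventuallyEq ?_
    filter_upwards [hV.mem_nhds hkV] with y hy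
    by_cases hyU : y ∈ U
    · simp [hyU, hc y ⟨hyU, hy⟩]
    · simp [hyU]

lemma IsExactOn.of_convex {U : Set ℂ} {f : ℂ → ℂ} (hU : IsOpen U) (hc : Convex ℝ U)
    (hf : DifferentiableOn ℂ f U) : Complex.IsExactOn f U := by
  obtain ⟨g, hg⟩ := hc.exists_forall_hasDerivWithinAt hf
  exact ⟨g, fun k hk => (hg k hk).hasDerivAt (hU.mem_nhds hk)⟩

lemma isCompact_segment (x y : ℂ) : IsCompact (segment ℝ x y) := by
  rw [segment_eq_image]
  exact isCompact_Icc.image (by fun_prop)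

/-- A primitive of a function with at most an inverse square root singularity at a boundary point
of a convex domain has a limit there. -/
lemma exists_tendsto_of_norm_deriv_le {C : Set ℂ} (hCo : IsOpen C) (hC : Convex ℝ C)
    {B f : ℂ → ℂ} (hB : ∀ k ∈ C, HasDerivAt B (f k) k) {p : ℂ} (hp : p ∈ closure C) (hpC : p ∉ C)
    {M : ℝ} (hM : ∀ᶠ k in 𝓝[C] p, ‖f k‖ ≤ M / √‖k - p‖) :
    ∃ l, Tendsto B (𝓝[C] p) (𝓝 l) := by
  obtain ⟨δ, hδ, hball⟩ := Metric.mem_nhdsWithin_iff.1 hM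
  have hM' : ∀ k ∈ C, ‖k - p‖ < δ → ‖f k‖ ≤ M / √‖k - p‖ := fun k hk hd =>
    hball ⟨by simpa [dist_eq_norm] using hd, hk⟩
  have hpos : ∀ k ∈ C, 0 < ‖k - p‖ := fun k hk =>
    norm_pos_iff.2 (sub_ne_zero.2 fun h => hpC (h ▸ hk))
  have hM0 : 0 ≤ M := by
    have := mem_closure_iff_nhdsWithin_neBot.1 hp
    obtain ⟨k, hk, hkC⟩ := (hM.and self_mem_nhdsWithin).exists
    by_contra! hneg
    have h1 := div_neg_of_neg_of_pos hneg (Real.sqrt_pos.2 (hpos k hkC))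
    linarith [norm_nonneg (f k)]
  -- Contraction towards `p` with ratio `s ^ 2`. The square is what desingularises: along `u ↦ p + u
  -- ^ 2 (x - p)` the velocity `2 u (x - p)` cancels the `1 / u` in the bound for `f`.
  have hscale : ∀ x ∈ C, ∀ s : ℝ, 0 < s → s ≤ 1 → p + (s ^ 2 : ℝ) * (x - p) ∈ C := by
    intro x hx s h0 h1
    have := hC.add_smul_sub_mem_interior' hp (hCo.interior_eq.symm ▸ hx)
      (t := s ^ 2) ⟨by positivity, by nlinarith⟩
    rwa [hCo.interior_eq, Complex.real_smul] at this
  -- The total variation of `B` along a radius is controlled uniformly in `s`, by a quantity that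
  -- tends to `0` as `x` tends to `p`.
  have hradial : ∀ x ∈ C, ‖x - p‖ < δ → ∀ s : ℝ, 0 < s → s ≤ 1 →
      ‖B x - B (p + (s ^ 2 : ℝ) * (x - p))‖ ≤ 2 * M * √‖x - p‖ := by
    intro x hx hxδ s h0 h1
    have hd : ∀ u ∈ Set.Icc s 1, HasDerivWithinAt (fun u : ℝ => B (p + (u ^ 2 : ℝ) * (x - p)))
        (f (p + (u ^ 2 : ℝ) * (x - p)) * (2 * u * (x - p))) (Set.Icc s 1) u := by
      intro u hu
      have hin : HasDerivAt (fun u : ℝ => p + ((u ^ 2 : ℝ) : ℂ) * (x - p)) (2 * u * (x - p)) u := by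
        have := (((hasDerivAt_pow 2 u).ofReal_comp).mul_const (x - p)).const_add p
        simpa using this
      have := (hB _ (hscale x hx u (h0.trans_le hu.1) hu.2)).comp u hin
      exact this.hasDerivWithinAt
    have hb : ∀ u ∈ Set.Ico s 1, ‖f (p + (u ^ 2 : ℝ) * (x - p)) * (2 * u * (x - p))‖ ≤
        2 * M * √‖x - p‖ := by
      intro u hu
      have hu0 : 0 < u := h0.trans_le hu.1
      have e : ‖p + ((u ^ 2 : ℝ) : ℂ) * (x - p) - p‖ = u ^ 2 * ‖x - p‖ := by
        rw [add_sub_cancel_left, norm_mul, Complex.norm_real, Real.norm_of_nonneg (by positivity)]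
      have h3 := hM' _ (hscale x hx u hu0 hu.2.le) (by
        rw [e]; exact (mul_le_of_le_one_left (norm_nonneg _) (by nlinarith [hu.2])).trans_lt hxδ)
      rw [e, Real.sqrt_mul (by positivity), Real.sqrt_sq hu0.le] at h3
      have hs := Real.sqrt_pos.2 (hpos x hx)
      calc _ = ‖f (p + (u ^ 2 : ℝ) * (x - p))‖ * (2 * u * ‖x - p‖) := by
              rw [norm_mul, norm_mul, norm_mul, Complex.norm_real, Real.norm_of_nonneg hu0.le]
              simp
        _ ≤ M / (u * √‖x - p‖) * (2 * u * ‖x - p‖) := by gcongr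
        _ = 2 * M * √‖x - p‖ := by
              nth_rewrite 2 [← Real.mul_self_sqrt (norm_nonneg (x - p))]
              field_simp
    have := norm_image_sub_le_of_norm_deriv_le_segment' hd hb 1 ⟨h1, le_rfl⟩
    simp only [one_pow, Complex.ofReal_one, one_mul, add_sub_cancel] at this
    refine this.trans ?_
    have h5 : 0 ≤ 2 * M * √‖x - p‖ := by positivity
    nlinarith
  have hpair : ∀ x ∈ C, ∀ y ∈ C, ‖x - p‖ < δ → ‖y - p‖ < δ →
      ‖B x - B y‖ ≤ 2 * M * √‖x - p‖ + 2 * M * √‖y - p‖ := by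
    intro x hx y hy hxδ hyδ
    obtain ⟨w, hw, hwmin⟩ := (isCompact_segment x y).exists_isMinOn ⟨x, left_mem_segment ℝ x y⟩
      (f := fun w => ‖w - p‖) (by fun_prop)
    set m := ‖w - p‖ with hm
    have hm0 : 0 < m := hpos w (hC.segment_subset hx hy hw)
    -- To compare `x` and `y`, both are moved in radially and joined at scale `s ^ 2`. The joining
    -- path has length `s ^ 2 ‖x - y‖` and the derivative there is at most `M / (s √m)`, where `m`
    -- is the least distance from `p` to the segment joining `x` and `y`. The cost is `O(s)` and
    -- disappears as `s → 0`.
    have hcross : ∀ s : ℝ, 0 < s → s ≤ 1 →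
        ‖B (p + (s ^ 2 : ℝ) * (x - p)) - B (p + (s ^ 2 : ℝ) * (y - p))‖ ≤
          s * (M / √m * ‖x - y‖) := by
      intro s h0 h1
      have hseg : ∀ v ∈ segment ℝ (p + (s ^ 2 : ℝ) * (y - p)) (p + (s ^ 2 : ℝ) * (x - p)),
          ∃ u ∈ segment ℝ x y, v = p + (s ^ 2 : ℝ) * (u - p) := by
        rintro v ⟨α, β, hα, hβ, hαβ, rfl⟩
        refine ⟨β • x + α • y, ⟨β, α, hβ, hα, by linarith, rfl⟩, ?_⟩
        have : (α : ℂ) + β = 1 := by exact_mod_cast hαβ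
        simp only [Complex.real_smul]
        linear_combination ((1 - (s ^ 2 : ℝ)) * p) * this
      have hbd := (convex_segment (p + (s ^ 2 : ℝ) * (y - p))
        (p + (s ^ 2 : ℝ) * (x - p))).norm_image_sub_le_of_norm_hasDerivWithin_le (𝕜 := ℂ)
        (f := B) (f' := f) (C := M / (s * √m)) (fun v hv => by
          obtain ⟨u, hu, rfl⟩ := hseg v hv
          exact (hB _ (hscale u (hC.segment_subset hx hy hu) s h0 h1)).hasDerivWithinAt)
        (fun v hv => by
          obtain ⟨u, hu, rfl⟩ := hseg v hv
          have huC := hC.segment_subset hx hy hu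
          have e : ‖p + ((s ^ 2 : ℝ) : ℂ) * (u - p) - p‖ = s ^ 2 * ‖u - p‖ := by
            rw [add_sub_cancel_left, norm_mul, Complex.norm_real,
              Real.norm_of_nonneg (by positivity)]
          have hud : ‖u - p‖ < δ := by
            have : u ∈ Metric.ball p δ := (convex_ball p δ).segment_subset
              (by simpa [dist_eq_norm] using hxδ) (by simpa [dist_eq_norm] using hyδ) hu
            simpa [dist_eq_norm] using this
          have h3 := hM' _ (hscale u huC s h0 h1) (by
            rw [e]; exact (mul_le_of_le_one_left (norm_nonneg _) (by nlinarith)).trans_lt hud)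
          refine h3.trans ?_
          rw [e, Real.sqrt_mul (by positivity), Real.sqrt_sq h0.le]
          gcongr
          exact hwmin hu)
        (left_mem_segment ℝ _ _) (right_mem_segment ℝ _ _)
      refine hbd.trans (le_of_eq ?_)
      rw [show p + ((s ^ 2 : ℝ) : ℂ) * (x - p) - (p + ((s ^ 2 : ℝ) : ℂ) * (y - p)) =
        ((s ^ 2 : ℝ) : ℂ) * (x - y) by ring, norm_mul, Complex.norm_real,
        Real.norm_of_nonneg (by positivity)]
      have := Real.sqrt_pos.2 hm0
      field_simp
    refine le_of_forall_pos_le_add fun ε hε => ?_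
    set K := M / √m * ‖x - y‖ with hK
    have hK0 : 0 ≤ K := by positivity
    set s : ℝ := min 1 (ε / (K + 1)) with hs
    have hs0 : 0 < s := lt_min one_pos (by positivity)
    have hsK : s * K ≤ ε := by
      have h1 : s ≤ ε / (K + 1) := min_le_right _ _
      have h2 : s * (K + 1) ≤ ε := (le_div_iff₀ (by positivity)).1 h1
      nlinarith
    have t1 := hradial x hx hxδ s hs0 (min_le_left _ _)
    have t2 := hradial y hy hyδ s hs0 (min_le_left _ _)
    have t3 := hcross s hs0 (min_le_left _ _)
    rw [norm_sub_rev] at t2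
    have := norm_add₃_le (a := B x - B (p + (s ^ 2 : ℝ) * (x - p)))
      (b := B (p + (s ^ 2 : ℝ) * (x - p)) - B (p + (s ^ 2 : ℝ) * (y - p)))
      (c := B (p + (s ^ 2 : ℝ) * (y - p)) - B y)
    rw [show B x - B (p + (s ^ 2 : ℝ) * (x - p)) +
      (B (p + (s ^ 2 : ℝ) * (x - p)) - B (p + (s ^ 2 : ℝ) * (y - p))) +
      (B (p + (s ^ 2 : ℝ) * (y - p)) - B y) = B x - B y by ring] at this
    linarith
  have hne := mem_closure_iff_nhdsWithin_neBot.1 hp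
  refine cauchy_map_iff_exists_tendsto.1 (Metric.cauchy_iff.2 ⟨hne.map _, fun ε hε => ?_⟩)
  have hcont : ContinuousAt (fun k : ℂ => 2 * M * √‖k - p‖) p := by fun_prop
  have hsmall : ∀ᶠ k in 𝓝 p, 2 * M * √‖k - p‖ < ε / 2 := by
    refine hcont.eventually_lt_const ?_
    simpa using hε
  refine ⟨B '' ({k | 2 * M * √‖k - p‖ < ε / 2} ∩ Metric.ball p δ ∩ C), image_mem_map ?_, ?_⟩
  · exact inter_mem (nhdsWithin_le_nhds (inter_mem hsmall (Metric.ball_mem_nhds p hδ)))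
      self_mem_nhdsWithin
  · rintro _ ⟨x, ⟨⟨hx1, hx2⟩, hx3⟩, rfl⟩ _ ⟨y, ⟨⟨hy1, hy2⟩, hy3⟩, rfl⟩
    rw [dist_eq_norm]
    have := hpair x hx3 y hy3 (by simpa [dist_eq_norm] using hx2)
      (by simpa [dist_eq_norm] using hy2)
    simp only [Set.mem_ofPred_eq] at hx1 hy1
    linarith

/-- If the derivative continues analytically across a boundary point of a convex domain, so does
the primitive. -/
lemma exists_eventually_eq_primitive {C : Set ℂ} (hCo : IsOpen C) (hC : Convex ℝ C)
    {B f ft : ℂ → ℂ} (hB : ∀ k ∈ C, HasDerivAt B (f k) k) {z₀ : ℂ}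
    (hft : ∀ᶠ k in 𝓝 z₀, DifferentiableAt ℂ ft k) (heq : ∀ᶠ k in 𝓝 z₀, k ∈ C → f k = ft k) :
    ∃ G : ℂ → ℂ, ∀ᶠ k in 𝓝 z₀, HasDerivAt G (ft k) k ∧ (k ∈ C → B k = G k) := by
  obtain ⟨r, hr, hball⟩ := Metric.eventually_nhds_iff_ball.1 (hft.and heq)
  obtain ⟨G, hG⟩ := (DifferentiableOn.isExactOn_ball (c := z₀) (r := r) (f := ft)
    fun k hk => (hball k hk).1.differentiableWithinAt)
  obtain ⟨c, hc⟩ := exists_eq_add_const_of_hasDerivAt (hCo.inter Metric.isOpen_ball)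
    (hC.inter (convex_ball z₀ r)).isPreconnected (f := ft) (A := B) (B := G)
    (fun k hk => (hball k hk.2).2 hk.1 ▸ hB k hk.1) (fun k hk => hG k hk.2)
  refine ⟨fun k => G k + c, ?_⟩
  filter_upwards [Metric.ball_mem_nhds z₀ hr] with k hk
  exact ⟨(hG k hk).add_const c, fun hkC => hc k ⟨hkC, hk⟩⟩

lemma exists_tendsto_of_continuation {C : Set ℂ} (hCo : IsOpen C) (hC : Convex ℝ C)
    {B f ft : ℂ → ℂ} (hB : ∀ k ∈ C, HasDerivAt B (f k) k) {z₀ : ℂ}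
    (hft : ∀ᶠ k in 𝓝 z₀, DifferentiableAt ℂ ft k) (heq : ∀ᶠ k in 𝓝 z₀, k ∈ C → f k = ft k) :
    ∃ l, Tendsto B (𝓝[C] z₀) (𝓝 l) := by
  obtain ⟨G, hG⟩ := exists_eventually_eq_primitive hCo hC hB hft heq
  refine ⟨G z₀, (hG.self_of_nhds.1.continuousAt.tendsto.mono_left nhdsWithin_le_nhds).congr' ?_⟩
  filter_upwards [nhdsWithin_le_nhds hG, self_mem_nhdsWithin] with k hk hkC
  exact (hk.2 hkC).symm

/-- This allows the fundamental theorem of calculus for boundary values along a side of `C`. Locally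
the boundary value is an analytic primitive of the continuation `ft`; the closure hypothesis makes
the limit defining `extendFrom` unambiguous at nearby points of the path. -/
lemma hasDerivAt_extendFrom {C : Set ℂ} (hCo : IsOpen C) (hC : Convex ℝ C)
    {B f ft : ℂ → ℂ} (hB : ∀ k ∈ C, HasDerivAt B (f k) k) {a b : ℂ} {t₀ : ℝ}
    (hft : ∀ᶠ k in 𝓝 (a + t₀ * (b - a)), DifferentiableAt ℂ ft k)
    (heq : ∀ᶠ k in 𝓝 (a + t₀ * (b - a)), k ∈ C → f k = ft k)
    (hcl : ∀ᶠ t : ℝ in 𝓝 t₀, a + t * (b - a) ∈ closure C) :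
    HasDerivAt (fun t : ℝ => extendFrom C B (a + t * (b - a)))
      ((b - a) * ft (a + t₀ * (b - a))) t₀ := by
  obtain ⟨G, hG⟩ := exists_eventually_eq_primitive hCo hC hB hft heq
  have hin : HasDerivAt (fun t : ℝ => a + (t : ℂ) * (b - a)) (b - a) t₀ := by
    simpa using (((hasDerivAt_id t₀).ofReal_comp).mul_const (b - a)).const_add a
  have h1 := hG.self_of_nhds.1.comp t₀ hin
  rw [mul_comm] at h1
  refine h1.congr_of_eventuallyEq ?_
  filter_upwards [hin.continuousAt.eventually hG.eventually_nhds, hcl] with t ht htc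
  refine extendFrom_eq htc ((ht.self_of_nhds.1.continuousAt.tendsto.mono_left
    nhdsWithin_le_nhds).congr' ?_)
  filter_upwards [nhdsWithin_le_nhds ht, self_mem_nhdsWithin] with k hk hkC
  exact (hk.2 hkC).symm

end SolitonGas

namespace SolitonGas

/-! ### Removable curves and points -/

/-- Morera's theorem: a rectangle that meets the real axis is cut along it, and the Cauchy–Goursat
theorem holds on each half, where the function is continuous up to the boundary and holomorphic
inside. -/
lemma differentiableOn_of_continuousOn_of_im_ne_zero {U : Set ℂ} (hU : IsOpen U) {f : ℂ → ℂ}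
    (hc : ContinuousOn f U) (hd : ∀ k ∈ U, k.im ≠ 0 → DifferentiableAt ℂ f k) :
    DifferentiableOn ℂ f U := by
  refine (Complex.isConservativeOn_and_continuousOn_iff_isDifferentiableOn hU).1 ⟨?_, hc⟩
  -- Rectangles with a horizontal side on the axis: their interior misses it.
  have hhalf : ∀ z w : ℂ, Complex.Rectangle z w ⊆ U → z.im = 0 ∨ w.im = 0 →
      Complex.wedgeIntegral z w f + Complex.wedgeIntegral w z f = 0 := by
    intro z w hzw h0
    rw [Complex.wedgeIntegral_add_wedgeIntegral_eq]
    refine Complex.integral_boundary_rect_eq_zero_of_continuousOn_of_differentiableOn f z w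
      (hc.mono hzw) fun k hk => ((hd k (hzw ?_)) ?_).differentiableWithinAt
    · exact ⟨⟨hk.1.1.le, hk.1.2.le⟩, ⟨hk.2.1.le, hk.2.2.le⟩⟩
    · intro hk0
      have h2 : k.im ∈ Set.Ioo _ _ := hk.2
      rw [hk0] at h2
      rcases h0 with h0 | h0 <;> rw [h0] at h2 <;> rcases le_total 0 w.im with h | h <;>
        rcases le_total 0 z.im with h' | h' <;> simp [*] at h2
  intro z w hzw
  rw [← add_eq_zero_iff_eq_neg]
  by_cases hsplit : (0 : ℝ) ∈ Set.uIcc z.im w.im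
  · have sub1 : Complex.Rectangle z (w.re : ℂ) ⊆ U := by
      refine Set.Subset.trans (Set.inter_subset_inter ?_ ?_) hzw
      · simp
      · refine Set.preimage_mono ?_
        simpa using Set.uIcc_subset_uIcc_left hsplit
    have sub2 : Complex.Rectangle (z.re : ℂ) w ⊆ U := by
      refine Set.Subset.trans (Set.inter_subset_inter ?_ ?_) hzw
      · simp
      · refine Set.preimage_mono ?_
        simpa using Set.uIcc_subset_uIcc_right hsplit
    have e1 := hhalf z (w.re : ℂ) sub1 (Or.inr (by simp))
    have e2 := hhalf (z.re : ℂ) w sub2 (Or.inl (by simp))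
    rw [Complex.wedgeIntegral_add_wedgeIntegral_eq] at e1 e2 ⊢
    have hint : ∀ x ∈ Set.uIcc z.re w.re, ∀ c ∈ Set.uIcc z.im w.im, ∀ d ∈ Set.uIcc z.im w.im,
        IntervalIntegrable (fun y : ℝ => f (x + y * Complex.I)) MeasureTheory.volume c d := by
      intro x hx c hcm d hdm
      refine ContinuousOn.intervalIntegrable (hc.comp (by fun_prop) fun y hy => hzw ⟨?_, ?_⟩)
      · simpa using hx
      · simpa using Set.uIcc_subset_uIcc hcm hdm hy
    have a1 := intervalIntegral.integral_add_adjacent_intervals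
      (hint w.re Set.right_mem_uIcc z.im Set.left_mem_uIcc 0 hsplit)
      (hint w.re Set.right_mem_uIcc 0 hsplit w.im Set.right_mem_uIcc)
    have a2 := intervalIntegral.integral_add_adjacent_intervals
      (hint z.re Set.left_mem_uIcc z.im Set.left_mem_uIcc 0 hsplit)
      (hint z.re Set.left_mem_uIcc 0 hsplit w.im Set.right_mem_uIcc)
    rw [← a1, ← a2]
    simp only [Complex.ofReal_re, Complex.ofReal_im, smul_eq_mul] at e1 e2 ⊢
    linear_combination e1 + e2
  · rw [Complex.wedgeIntegral_add_wedgeIntegral_eq]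
    refine Complex.integral_boundary_rect_eq_zero_of_continuousOn_of_differentiableOn f z w
      (hc.mono hzw) fun k hk => ((hd k (hzw ?_)) ?_).differentiableWithinAt
    · exact ⟨⟨hk.1.1.le, hk.1.2.le⟩, ⟨hk.2.1.le, hk.2.2.le⟩⟩
    · intro hk0
      have h2 : k.im ∈ Set.Ioo _ _ := hk.2
      rw [hk0] at h2
      exact hsplit ⟨h2.1.le, h2.2.le⟩

/-- The open left side of the line through `z` with direction `d`. -/
def leftSide (d z : ℂ) : Set ℂ := {k | 0 < ((k - z) / d).im}

/-- The open right side of the line through `z` with direction `d`. -/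
def rightSide (d z : ℂ) : Set ℂ := {k | ((k - z) / d).im < 0}

lemma nhdsWithin_leftSide_neBot {d : ℂ} (hd : d ≠ 0) (z : ℂ) : (𝓝[leftSide d z] z).NeBot := by
  rw [← mem_closure_iff_nhdsWithin_neBot]
  have h : Tendsto (fun t : ℝ => z + t * (Complex.I * d)) (𝓝[>] 0) (𝓝 z) := by
    have : ContinuousAt (fun t : ℝ => z + t * (Complex.I * d)) 0 := by fun_prop
    simpa [ContinuousAt] using this.tendsto.mono_left nhdsWithin_le_nhds
  refine mem_closure_of_tendsto h ?_
  filter_upwards [self_mem_nhdsWithin] with t ht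
  have : (z + t * (Complex.I * d) - z) / d = t * Complex.I := by field_simp; ring
  change 0 < ((z + t * (Complex.I * d) - z) / d).im
  rw [this]
  simpa using ht

/-- A differentiable function extends analytically across a set that is locally a line, up to
finitely many points, when the limits from both sides agree and it is small enough at these
points. -/
lemma exists_differentiableOn_extension {U K : Set ℂ} (hU : IsOpen U) (hK : IsClosed K)
    {f : ℂ → ℂ} (hf : DifferentiableOn ℂ f (U \ K)) {Q : Set ℂ} (hQ : Q.Finite)
    (hreg : ∀ z ∈ U ∩ K, z ∉ Q → ∃ d ≠ 0, (∀ᶠ k in 𝓝 z, (k ∈ K ↔ ((k - z) / d).im = 0)) ∧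
      ∃ l, Tendsto f (𝓝[leftSide d z] z) (𝓝 l) ∧ Tendsto f (𝓝[rightSide d z] z) (𝓝 l))
    (hend : ∀ p ∈ Q, p ∈ U → Tendsto (fun k => (k - p) * f k) (𝓝[Kᶜ] p) (𝓝 0)) :
    ∃ g : ℂ → ℂ, DifferentiableOn ℂ g U ∧ ∀ k ∈ U \ K, k ∉ Q → g k = f k := by
  classical
  have hUK : IsOpen (U \ K) := hU.sdiff hK
  -- Locally the complement of `K` is the union of the two sides of a line, so equal one-sided
  -- limits amount to one limit along `U \ K`. Thus `extendFrom` is continuous on `U \ Q`.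
  have hlim : ∀ z ∈ U \ Q, (𝓝[U \ K] z).NeBot ∧ ∃ l, Tendsto f (𝓝[U \ K] z) (𝓝 l) := by
    rintro z ⟨hzU, hzQ⟩
    by_cases hzK : z ∈ K
    · obtain ⟨d, hd, hline, l, hl, hr⟩ := hreg z ⟨hzU, hzK⟩ hzQ
      have e : 𝓝[U \ K] z = 𝓝[leftSide d z] z ⊔ 𝓝[rightSide d z] z := by
        rw [← nhdsWithin_union]
        refine nhdsWithin_eq_iff_eventuallyEq.2 ?_
        filter_upwards [hline, hU.mem_nhds hzU] with k hk hkU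
        refine propext ⟨fun h => ?_, fun h => ⟨hkU, fun hkK => ?_⟩⟩
        · exact (lt_or_gt_of_ne (fun h0 => h.2 (hk.2 h0))).symm
        · have := hk.1 hkK
          rcases h with h | h
          · exact (ne_of_gt h) this
          · exact (ne_of_lt h) this
      rw [e]
      have := nhdsWithin_leftSide_neBot hd z
      exact ⟨inferInstance, l, hl.sup hr⟩
    · have hz : z ∈ U \ K := ⟨hzU, hzK⟩
      have e := hUK.nhdsWithin_eq hz
      rw [e]
      exact ⟨inferInstance, f z, (hf.differentiableAt (hUK.mem_nhds hz)).continuousAt⟩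
  set g₁ := extendFrom (U \ K) f with hg₁
  have hcont : ContinuousOn g₁ (U \ Q) := continuousOn_extendFrom
    (fun z hz => mem_closure_iff_nhdsWithin_neBot.2 (hlim z hz).1) (fun z hz => (hlim z hz).2)
  have heq : ∀ k ∈ U \ K, g₁ k = f k := fun k hk =>
    extendFrom_eq (subset_closure hk)
      ((hf.differentiableAt (hUK.mem_nhds hk)).continuousAt.tendsto.mono_left nhdsWithin_le_nhds)
  have hdK : ∀ k ∈ U \ K, DifferentiableAt ℂ g₁ k := fun k hk =>
    (hf.differentiableAt (hUK.mem_nhds hk)).congr_of_eventuallyEq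
      (Filter.eventually_of_mem (hUK.mem_nhds hk) heq)
  have hUQ : IsOpen (U \ Q) := hU.sdiff hQ.isClosed
  have hd₁ : ∀ z ∈ U \ Q, DifferentiableAt ℂ g₁ z := by
    rintro z ⟨hzU, hzQ⟩
    by_cases hzK : z ∈ K
    · obtain ⟨d, hd, hline, -⟩ := hreg z ⟨hzU, hzK⟩ hzQ
      obtain ⟨r, hr, hball⟩ := Metric.eventually_nhds_iff_ball.1
        (hline.and (hUQ.mem_nhds ⟨hzU, hzQ⟩))
      -- The affine change of variable that carries the real axis to the line `K` near `z`.
      set V : Set ℂ := (fun w => z + d * w) ⁻¹' Metric.ball z r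
      have hV : IsOpen V := Metric.isOpen_ball.preimage (by fun_prop)
      have hdiff : DifferentiableOn ℂ (fun w => g₁ (z + d * w)) V := by
        refine differentiableOn_of_continuousOn_of_im_ne_zero hV ?_ fun w hw hw0 => ?_
        · exact hcont.comp (by fun_prop) fun w hw => (hball _ hw).2
        · have h1 : z + d * w ∈ U \ K := ⟨(hball _ hw).2.1, fun hk => hw0 (by
            have := (hball _ hw).1.1 hk
            rwa [add_sub_cancel_left, mul_div_cancel_left₀ _ hd] at this)⟩
          exact DifferentiableAt.comp (g := g₁) (f := fun w => z + d * w) w (hdK _ h1) (by fun_prop)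
      have h0 : (0 : ℂ) ∈ V := by simpa [V] using hr
      have h2 := hdiff.differentiableAt (hV.mem_nhds h0)
      have h3 : g₁ = (fun w => g₁ (z + d * w)) ∘ fun k => (k - z) / d := by
        funext k
        simp only [Function.comp]
        rw [mul_div_cancel₀ _ hd, add_sub_cancel]
      rw [h3]
      refine DifferentiableAt.comp z ?_ (by fun_prop)
      simpa using h2
    · exact hdK z ⟨hzU, hzK⟩
  refine ⟨fun k => if k ∈ Q then limUnder (𝓝[≠] k) g₁ else g₁ k, ?_, fun k hk hkQ => by
    simp [hkQ, heq k hk]⟩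
  intro p hpU
  refine DifferentiableAt.differentiableWithinAt ?_
  by_cases hpQ : p ∈ Q
  · have hQp : IsClosed (Q \ {p}) := (hQ.subset Set.sdiff_subset).isClosed
    have hs : U \ (Q \ {p}) ∈ 𝓝 p := (hU.sdiff hQp).mem_nhds ⟨hpU, by simp⟩
    have hd2 : DifferentiableOn ℂ g₁ ((U \ (Q \ {p})) \ {p}) := fun k hk =>
      (hd₁ k ⟨hk.1.1, fun h => hk.1.2 ⟨h, hk.2⟩⟩).differentiableWithinAt
    -- The smallness of `(k - p) * f k` is known off `K` only; it reaches the points of `K` near `p`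
    -- by passing to the limit, hence the `ε / 2`.
    have hsmall : Tendsto (fun k => (k - p) * g₁ k) (𝓝[≠] p) (𝓝 0) := by
      rw [Metric.tendsto_nhds]
      intro ε hε
      have h1 := (Metric.tendsto_nhds.1 (hend p hpQ hpU)) (ε / 2) (by positivity)
      obtain ⟨r, hr, hball⟩ := Metric.mem_nhdsWithin_iff.1 h1
      filter_upwards [nhdsWithin_le_nhds hs, self_mem_nhdsWithin,
        nhdsWithin_le_nhds (Metric.ball_mem_nhds p hr)] with k hk hkp hkr
      have hkUQ : k ∈ U \ Q := ⟨hk.1, fun h => hk.2 ⟨h, hkp⟩⟩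
      obtain ⟨hne, l, hl⟩ := hlim k hkUQ
      have hgk : Tendsto f (𝓝[U \ K] k) (𝓝 (g₁ k)) := tendsto_extendFrom ⟨l, hl⟩
      have hmul : Tendsto (fun y => dist ((y - p) * f y) 0) (𝓝[U \ K] k)
          (𝓝 (dist ((k - p) * g₁ k) 0)) := by
        refine Tendsto.dist (Tendsto.mul ?_ hgk) tendsto_const_nhds
        exact (tendsto_id.sub_const p).mono_left nhdsWithin_le_nhds
      refine lt_of_le_of_lt (le_of_tendsto hmul ?_) (half_lt_self hε)
      filter_upwards [self_mem_nhdsWithin,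
        nhdsWithin_le_nhds (Metric.isOpen_ball.mem_nhds hkr)] with y hy hyr
      exact (hball ⟨hyr, hy.2⟩).le
    have ho : (fun z => g₁ z - g₁ p) =o[𝓝[≠] p] fun z => (z - p)⁻¹ := by
      refine (Asymptotics.isLittleO_iff_tendsto' ?_).2 ?_
      · filter_upwards [self_mem_nhdsWithin] with k hk h0
        exact absurd (inv_eq_zero.1 h0) (sub_ne_zero.2 hk)
      · have h2 : Tendsto (fun k => (k - p) * g₁ k - (k - p) * g₁ p) (𝓝[≠] p) (𝓝 0) := by
          have : Tendsto (fun k : ℂ => (k - p) * g₁ p) (𝓝[≠] p) (𝓝 0) := by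
            have hc : ContinuousAt (fun k : ℂ => (k - p) * g₁ p) p := by fun_prop
            simpa [ContinuousAt] using hc.tendsto.mono_left (nhdsWithin_le_nhds (s := {p}ᶜ))
          simpa using hsmall.sub this
        refine h2.congr fun k => ?_
        rw [div_inv_eq_mul]; ring
    have h4 := (Complex.differentiableOn_update_limUnder_of_isLittleO hs hd2 ho).differentiableAt hs
    refine h4.congr_of_eventuallyEq ?_
    filter_upwards [hs] with k hk
    rcases eq_or_ne k p with rfl | hkp
    · simp [hpQ]
    · have : k ∉ Q := fun h => hk.2 ⟨h, hkp⟩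
      simp [this, Function.update_of_ne hkp]
  · refine (hd₁ p ⟨hpU, hpQ⟩).congr_of_eventuallyEq ?_
    filter_upwards [hQ.isClosed.isOpen_compl.mem_nhds hpQ] with k hk
    have : k ∉ Q := hk
    simp [this]

end SolitonGas

namespace SolitonGas

/-! ### The geometry of the contour -/

/-- The standing assumptions on the branch points. -/
structure Admissible (E F : ℂ) : Prop where
  imE : 0 < E.im
  imF : 0 < F.im
  re_lt : E.re < F.re

/-- A real affine form that vanishes on the line through `E` and `F` and is positive above it. -/
def lineForm (E F k : ℂ) : ℝ := (k.im - E.im) * (F.re - E.re) - (k.re - E.re) * (F.im - E.im)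

def regionTop (E F : ℂ) : Set ℂ := {k | 0 < lineForm E F k}

def regionBot (E F : ℂ) : Set ℂ := {k | 0 < lineForm E F (conj k)}

def regionRight (F : ℂ) : Set ℂ := {k | F.re < k.re}

def regionLeft (E : ℂ) : Set ℂ := {k | k.re < E.re}

/-- The convex region enclosed by the contour and the lines through its slanted sides. -/
def regionIn (E F : ℂ) : Set ℂ :=
  {k | lineForm E F k < 0} ∩ {k | lineForm E F (conj k) < 0} ∩ {k | k.re < F.re}

variable {E F k z : ℂ}

lemma continuous_lineForm : Continuous (lineForm E F) := by
  unfold lineForm; fun_prop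

lemma continuous_lineForm_conj : Continuous fun k => lineForm E F (conj k) :=
  continuous_lineForm.comp Complex.continuous_conj

lemma isOpen_regionTop : IsOpen (regionTop E F) := isOpen_lt continuous_const continuous_lineForm

lemma isOpen_regionBot : IsOpen (regionBot E F) :=
  isOpen_lt continuous_const continuous_lineForm_conj

lemma isOpen_regionRight : IsOpen (regionRight F) := isOpen_lt continuous_const Complex.continuous_re

lemma isOpen_regionLeft : IsOpen (regionLeft E) := isOpen_lt Complex.continuous_re continuous_const

lemma isOpen_regionIn : IsOpen (regionIn E F) :=
  ((isOpen_lt continuous_lineForm continuous_const).inter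
    (isOpen_lt continuous_lineForm_conj continuous_const)).inter
    (isOpen_lt Complex.continuous_re continuous_const)

lemma lineForm_combo {a b : ℝ} (hab : a + b = 1) (x y : ℂ) :
    lineForm E F (a • x + b • y) = a * lineForm E F x + b * lineForm E F y := by
  simp only [lineForm, Complex.real_smul, Complex.add_re, Complex.add_im, Complex.re_ofReal_mul,
    Complex.im_ofReal_mul]
  linear_combination (E.re * (F.im - E.im) - E.im * (F.re - E.re)) * (-hab)

lemma convex_of_combo {g : ℂ → ℝ}
    (hg : ∀ (a b : ℝ) (_ : a + b = 1) (x y : ℂ), g (a • x + b • y) = a * g x + b * g y) :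
    Convex ℝ {k | 0 < g k} := by
  intro x hx y hy a b ha hb hab
  change 0 < g (a • x + b • y)
  rw [hg a b hab]
  change 0 < g x at hx
  change 0 < g y at hy
  rcases ha.eq_or_lt with rfl | ha
  · have : b = 1 := by linarith
    subst this; simpa using hy
  · have := mul_pos ha hx
    have := mul_nonneg hb hy.le
    linarith

lemma convex_re_lt (c : ℝ) : Convex ℝ {k : ℂ | k.re < c} :=
  convex_halfSpace_lt (Complex.reLm.isLinear) c

lemma convex_lt_re (c : ℝ) : Convex ℝ {k : ℂ | c < k.re} :=
  convex_halfSpace_gt (Complex.reLm.isLinear) c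

lemma convex_im_lt (c : ℝ) : Convex ℝ {k : ℂ | k.im < c} :=
  convex_halfSpace_lt (Complex.imLm.isLinear) c

lemma convex_lt_im (c : ℝ) : Convex ℝ {k : ℂ | c < k.im} :=
  convex_halfSpace_gt (Complex.imLm.isLinear) c

lemma convex_regionTop : Convex ℝ (regionTop E F) :=
  convex_of_combo fun _ _ h x y => lineForm_combo h x y

lemma lineForm_conj_combo {a b : ℝ} (hab : a + b = 1) (x y : ℂ) :
    lineForm E F (conj (a • x + b • y)) =
      a * lineForm E F (conj x) + b * lineForm E F (conj y) := by
  rw [← lineForm_combo hab]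
  simp

lemma convex_regionBot : Convex ℝ (regionBot E F) :=
  convex_of_combo fun _ _ h x y => lineForm_conj_combo h x y

lemma convex_regionRight : Convex ℝ (regionRight F) := convex_lt_re _

lemma convex_regionLeft : Convex ℝ (regionLeft E) := convex_re_lt _

lemma convex_regionIn : Convex ℝ (regionIn E F) := by
  refine ((?_ : Convex ℝ _).inter (?_ : Convex ℝ _)).inter (convex_re_lt _)
  · have := convex_of_combo (g := fun k => -lineForm E F k) fun a b h x y => by
      simp only [lineForm_combo h]; ring
    simpa using this
  · have := convex_of_combo (g := fun k => -lineForm E F (conj k)) fun a b h x y => by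
      simp only [lineForm_conj_combo h]; ring
    simpa using this

lemma lineForm_conj (k : ℂ) :
    lineForm E F (conj k) = lineForm E F k - 2 * k.im * (F.re - E.re) := by
  simp [lineForm]; ring

lemma lineForm_segment (t : ℝ) : lineForm E F (E + t * (F - E)) = 0 := by
  simp [lineForm]; ring

lemma mem_Sigma1 (h : Admissible E F) :
    k ∈ Sigma1 E F ↔ lineForm E F k = 0 ∧ E.re ≤ k.re ∧ k.re ≤ F.re := by
  have hlt := h.re_lt
  rw [Sigma1, segment_eq_image']
  constructor
  · rintro ⟨t, ⟨h0, h1⟩, rfl⟩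
    refine ⟨by simpa using lineForm_segment t, ?_, ?_⟩ <;> simp <;> nlinarith
  · rintro ⟨h0, h1, h2⟩
    have hne : F.re - E.re ≠ 0 := by linarith
    refine ⟨(k.re - E.re) / (F.re - E.re), ⟨by apply div_nonneg <;> linarith,
      (div_le_one (by linarith)).2 (by linarith)⟩, ?_⟩
    apply Complex.ext
    · simp only [Complex.real_smul, Complex.add_re, Complex.re_ofReal_mul, Complex.sub_re]
      field_simp; ring
    · simp only [Complex.real_smul, Complex.add_im, Complex.im_ofReal_mul, Complex.sub_im]
      rw [lineForm] at h0
      field_simp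
      linarith

lemma mem_SigmaF (hF : 0 < F.im) : k ∈ SigmaF F ↔ k.re = F.re ∧ -F.im ≤ k.im ∧ k.im ≤ F.im := by
  rw [SigmaF, segment_eq_image']
  constructor
  · rintro ⟨t, ⟨h0, h1⟩, rfl⟩
    refine ⟨by simp, ?_, ?_⟩ <;> simp <;> nlinarith
  · rintro ⟨h0, h1, h2⟩
    refine ⟨(F.im - k.im) / (2 * F.im), ⟨by apply div_nonneg <;> linarith,
      (div_le_one (by linarith)).2 (by linarith)⟩, ?_⟩
    apply Complex.ext
    · simp only [Complex.real_smul, Complex.add_re, Complex.re_ofReal_mul, Complex.sub_re,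
        Complex.conj_re, h0]
      ring
    · simp only [Complex.real_smul, Complex.add_im, Complex.im_ofReal_mul, Complex.sub_im,
        Complex.conj_im]
      field_simp; ring

lemma conj_mem_segment {a b : ℂ} : conj k ∈ segment ℝ a b ↔ k ∈ segment ℝ (conj a) (conj b) := by
  have key : ∀ a b k : ℂ, k ∈ segment ℝ a b → conj k ∈ segment ℝ (conj a) (conj b) := by
    rintro a b k ⟨s, t, hs, ht, hst, rfl⟩
    exact ⟨s, t, hs, ht, hst, by simp⟩
  refine ⟨fun h => by simpa using key _ _ _ h, fun h => by simpa using key _ _ _ h⟩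

lemma conj_mem_openSegment {a b : ℂ} :
    conj k ∈ openSegment ℝ a b ↔ k ∈ openSegment ℝ (conj a) (conj b) := by
  have key : ∀ a b k : ℂ, k ∈ openSegment ℝ a b → conj k ∈ openSegment ℝ (conj a) (conj b) := by
    rintro a b k ⟨s, t, hs, ht, hst, rfl⟩
    exact ⟨s, t, hs, ht, hst, by simp⟩
  refine ⟨fun h => by simpa using key _ _ _ h, fun h => by simpa using key _ _ _ h⟩

lemma conj_mem_Sigma2 : conj k ∈ Sigma2 E F ↔ k ∈ Sigma1 E F := by
  rw [Sigma2, conj_mem_segment, Sigma1, segment_symm]; simp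

lemma conj_mem_Sigma1 : conj k ∈ Sigma1 E F ↔ k ∈ Sigma2 E F := by
  rw [← conj_mem_Sigma2]; simp

lemma conj_mem_contour : conj k ∈ contour E F ↔ k ∈ contour E F := by
  have h3 : conj k ∈ SigmaF F ↔ k ∈ SigmaF F := by
    rw [SigmaF, conj_mem_segment, segment_symm]; simp
  simp only [contour, Set.mem_union, conj_mem_Sigma1, conj_mem_Sigma2, h3]
  tauto

lemma isClosed_contour : IsClosed (contour E F) :=
  (((isCompact_segment _ _).isClosed.union (isCompact_segment _ _).isClosed)).union
    (isCompact_segment _ _).isClosed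

lemma isOpen_compl_contour : IsOpen (contour E F)ᶜ := isClosed_contour.isOpen_compl

namespace Admissible

lemma im_pos_of_mem_Sigma1 (h : Admissible E F) (hk : k ∈ Sigma1 E F) : 0 < k.im := by
  obtain ⟨h0, h1, h2⟩ := (mem_Sigma1 h).1 hk
  have := h.imE; have := h.imF; have := h.re_lt
  rw [lineForm] at h0
  by_contra! hcon
  have h3 := mul_nonneg (neg_nonneg.2 hcon) (sub_nonneg.2 this.le)
  rcases h2.eq_or_lt with h2 | h2
  · rw [h2] at h0
    nlinarith
  · nlinarith [mul_pos h.imE (sub_pos.2 h2), mul_nonneg h.imF.le (sub_nonneg.2 h1)]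

lemma lineForm_nonpos (h : Admissible E F) (hk : k ∈ contour E F) : lineForm E F k ≤ 0 := by
  have := h.imE; have := h.imF; have hlt := h.re_lt
  rcases hk with (hk | hk) | hk
  · exact ((mem_Sigma1 h).1 hk).1.le
  · rw [← conj_mem_Sigma1] at hk
    have h0 := ((mem_Sigma1 h).1 hk).1
    have h1 := h.im_pos_of_mem_Sigma1 hk
    rw [lineForm_conj] at h0
    simp only [Complex.conj_im] at h1
    nlinarith
  · obtain ⟨h0, h1, h2⟩ := (mem_SigmaF h.imF).1 hk
    rw [lineForm, h0]
    nlinarith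

lemma lineForm_conj_nonpos (h : Admissible E F) (hk : k ∈ contour E F) :
    lineForm E F (conj k) ≤ 0 :=
  h.lineForm_nonpos (conj_mem_contour.2 hk)

lemma re_mem (h : Admissible E F) (hk : k ∈ contour E F) : E.re ≤ k.re ∧ k.re ≤ F.re := by
  rcases hk with (hk | hk) | hk
  · exact ((mem_Sigma1 h).1 hk).2
  · rw [← conj_mem_Sigma1] at hk
    simpa using ((mem_Sigma1 h).1 hk).2
  · have := ((mem_SigmaF h.imF).1 hk).1
    exact ⟨this ▸ h.re_lt.le, this.le⟩

/-- This convex open cover organises the boundary analysis: all boundary values are taken from one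
region at a time. A point outside all five satisfies the reversed weak inequalities, and following
which of them are equalities puts it on one of the segments. -/
lemma notMem_contour_iff (h : Admissible E F) : k ∉ contour E F ↔
    k ∈ regionTop E F ∪ regionRight F ∪ regionBot E F ∪ regionLeft E ∪ regionIn E F := by
  have hlt := h.re_lt
  constructor
  · intro hk
    by_contra hcon
    simp only [Set.mem_union, not_or, regionTop, regionRight, regionBot, regionLeft, regionIn,
      Set.mem_inter_iff, Set.mem_ofPred_eq, not_lt, not_and] at hcon
    obtain ⟨⟨⟨⟨h1, h2⟩, h3⟩, h4⟩, h5⟩ := hcon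
    apply hk
    rcases h1.eq_or_lt with h1 | h1
    · exact Or.inl (Or.inl ((mem_Sigma1 h).2 ⟨h1, h4, h2⟩))
    rcases h3.eq_or_lt with h3 | h3
    · exact Or.inl (Or.inr (conj_mem_Sigma1.1 ((mem_Sigma1 h).2 ⟨h3, by simpa, by simpa⟩)))
    have h6 : k.re = F.re := le_antisymm h2 (h5 ⟨h1, h3⟩)
    refine Or.inr ((mem_SigmaF h.imF).2 ⟨h6, ?_, ?_⟩)
    · simp only [lineForm, Complex.conj_re, Complex.conj_im, h6] at h3
      nlinarith
    · simp only [lineForm, h6] at h1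
      nlinarith
  · intro hk hc
    have h1 := h.lineForm_nonpos hc
    have h2 := h.lineForm_conj_nonpos hc
    have h3 := h.re_mem hc
    rcases hk with (((hk | hk) | hk) | hk) | ⟨⟨hk1, hk2⟩, hk3⟩
    · exact absurd hk (not_lt.2 h1)
    · exact absurd hk (not_lt.2 h3.2)
    · exact absurd hk (not_lt.2 h2)
    · exact absurd hk (not_lt.2 h3.1)
    · change lineForm E F k < 0 at hk1
      change lineForm E F (conj k) < 0 at hk2
      change k.re < F.re at hk3
      rcases hc with (hc | hc) | hc
      · exact hk1.ne ((mem_Sigma1 h).1 hc).1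
      · exact hk2.ne ((mem_Sigma1 h).1 (conj_mem_Sigma1.2 hc)).1
      · exact hk3.ne ((mem_SigmaF h.imF).1 hc).1

lemma regionTop_subset (h : Admissible E F) : regionTop E F ⊆ (contour E F)ᶜ := fun _ hk =>
  h.notMem_contour_iff.2 (by simp [hk])

lemma regionBot_subset (h : Admissible E F) : regionBot E F ⊆ (contour E F)ᶜ := fun _ hk =>
  h.notMem_contour_iff.2 (by simp [hk])

lemma regionRight_subset (h : Admissible E F) : regionRight F ⊆ (contour E F)ᶜ := fun _ hk =>
  h.notMem_contour_iff.2 (by simp [hk])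

lemma regionLeft_subset (h : Admissible E F) : regionLeft E ⊆ (contour E F)ᶜ := fun _ hk =>
  h.notMem_contour_iff.2 (by simp [hk])

lemma regionIn_subset (h : Admissible E F) : regionIn E F ⊆ (contour E F)ᶜ := fun _ hk =>
  h.notMem_contour_iff.2 (by simp [hk])

lemma compl_contour_eq (h : Admissible E F) : (contour E F)ᶜ =
    regionTop E F ∪ regionRight F ∪ regionBot E F ∪ regionLeft E ∪ regionIn E F := by
  ext k; exact h.notMem_contour_iff

end Admissible

/-! #### Sides of the three segments -/

/-- Translates the sides used in `HasJump` into the sign of the real form that cuts out the regions.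
-/
lemma im_sub_div_Sigma1 (z k : ℂ) : ((k - z) / (F - E)).im =
    (lineForm E F k - lineForm E F z) / Complex.normSq (F - E) := by
  rw [Complex.div_im, lineForm, lineForm]
  simp only [Complex.sub_re, Complex.sub_im]
  ring

lemma im_sub_div_SigmaF (hF : 0 < F.im) (z k : ℂ) : ((k - z) / (conj F - F)).im =
    (k.re - z.re) / (2 * F.im) := by
  have e : conj F - F = ((-(2 * F.im) : ℝ) : ℂ) * Complex.I := by
    apply Complex.ext <;> simp; ring
  rw [e, Complex.div_im]
  simp
  field_simp

lemma im_sub_div_Sigma2 (z k : ℂ) : ((k - z) / (conj E - conj F)).im =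
    (lineForm E F (conj k) - lineForm E F (conj z)) / Complex.normSq (F - E) := by
  rw [← im_sub_div_Sigma1, ← map_sub, ← map_sub, ← neg_sub F E, map_neg, div_neg, Complex.neg_im,
    ← Complex.conj_im, map_div₀, Complex.conj_conj]

lemma mem_openSegment_Sigma1 (h : Admissible E F) (hz : z ∈ openSegment ℝ E F) :
    lineForm E F z = 0 ∧ E.re < z.re ∧ z.re < F.re ∧ 0 < z.im := by
  have h1 := (mem_Sigma1 h).1 (openSegment_subset_segment ℝ _ _ hz)
  have h2 := h.im_pos_of_mem_Sigma1 (openSegment_subset_segment ℝ _ _ hz)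
  rw [openSegment_eq_image'] at hz
  obtain ⟨t, ⟨ht0, ht1⟩, rfl⟩ := hz
  have := h.re_lt
  refine ⟨h1.1, ?_, ?_, h2⟩ <;> simp <;> nlinarith

lemma mem_openSegment_SigmaF (hF : 0 < F.im) :
    z ∈ openSegment ℝ F (conj F) ↔ z.re = F.re ∧ -F.im < z.im ∧ z.im < F.im := by
  rw [openSegment_eq_image']
  constructor
  · rintro ⟨t, ⟨ht0, ht1⟩, rfl⟩
    refine ⟨by simp, ?_, ?_⟩ <;> simp <;> nlinarith
  · rintro ⟨h0, h1, h2⟩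
    refine ⟨(F.im - z.im) / (2 * F.im), ⟨by apply div_pos <;> linarith,
      (div_lt_one (by linarith)).2 (by linarith)⟩, ?_⟩
    apply Complex.ext
    · simp only [Complex.real_smul, Complex.add_re, Complex.re_ofReal_mul, Complex.sub_re,
        Complex.conj_re, h0]
      ring
    · simp only [Complex.real_smul, Complex.add_im, Complex.im_ofReal_mul, Complex.sub_im,
        Complex.conj_im]
      field_simp; ring

lemma mem_openSegment_Sigma2 :
    z ∈ openSegment ℝ (conj F) (conj E) ↔ conj z ∈ openSegment ℝ E F := by
  rw [conj_mem_openSegment, openSegment_symm]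

namespace Admissible

lemma sub_ne_zero (h : Admissible E F) : F - E ≠ 0 := fun h0 => by
  have := congrArg Complex.re h0
  simp at this
  linarith [h.re_lt]

lemma normSq_pos (h : Admissible E F) : 0 < Complex.normSq (F - E) :=
  Complex.normSq_pos.2 h.sub_ne_zero

lemma leftSide_Sigma1 (h : Admissible E F) (hz : z ∈ openSegment ℝ E F) :
    leftSide (F - E) z = regionTop E F := by
  ext k
  rw [leftSide, Set.mem_ofPred_eq, im_sub_div_Sigma1, (mem_openSegment_Sigma1 h hz).1, sub_zero,
    div_pos_iff_of_pos_right h.normSq_pos, regionTop, Set.mem_ofPred_eq]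

lemma leftSide_SigmaF (h : Admissible E F) (hz : z ∈ openSegment ℝ F (conj F)) :
    leftSide (conj F - F) z = regionRight F := by
  ext k
  rw [leftSide, Set.mem_ofPred_eq, im_sub_div_SigmaF h.imF,
    div_pos_iff_of_pos_right (by linarith [h.imF]), ((mem_openSegment_SigmaF h.imF).1 hz).1,
    sub_pos, regionRight, Set.mem_ofPred_eq]

lemma leftSide_Sigma2 (h : Admissible E F) (hz : z ∈ openSegment ℝ (conj F) (conj E)) :
    leftSide (conj E - conj F) z = regionBot E F := by
  ext k
  rw [leftSide, Set.mem_ofPred_eq, im_sub_div_Sigma2,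
    (mem_openSegment_Sigma1 h (mem_openSegment_Sigma2.1 hz)).1, sub_zero,
    div_pos_iff_of_pos_right h.normSq_pos, regionBot, Set.mem_ofPred_eq]

/-- The left side is the whole half plane `regionTop`, but the right side agrees with `regionIn`
only as a germ at `z`: the two other inequalities of `regionIn` are strict at an interior point and
persist nearby. -/
lemma rightSide_Sigma1 (h : Admissible E F) (hz : z ∈ openSegment ℝ E F) :
    𝓝[rightSide (F - E) z] z = 𝓝[regionIn E F] z := by
  obtain ⟨h0, h1, h2, h3⟩ := mem_openSegment_Sigma1 h hz
  have hc : lineForm E F (conj z) < 0 := by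
    rw [lineForm_conj, h0]; nlinarith [h.re_lt]
  refine nhdsWithin_eq_iff_eventuallyEq.2 ?_
  filter_upwards [continuous_lineForm_conj.continuousAt.eventually_lt_const hc,
    Complex.continuous_re.continuousAt.eventually_lt_const h2] with k hk1 hk2
  refine propext ?_
  change ((k - z) / (F - E)).im < 0 ↔ k ∈ regionIn E F
  rw [im_sub_div_Sigma1, h0, sub_zero, div_lt_iff₀ h.normSq_pos, zero_mul]
  exact ⟨fun hk => ⟨⟨hk, hk1⟩, hk2⟩, fun hk => hk.1.1⟩

lemma rightSide_SigmaF (h : Admissible E F) (hz : z ∈ openSegment ℝ F (conj F)) :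
    𝓝[rightSide (conj F - F) z] z = 𝓝[regionIn E F] z := by
  obtain ⟨h0, h1, h2⟩ := (mem_openSegment_SigmaF h.imF).1 hz
  have := h.re_lt
  have hc1 : lineForm E F z < 0 := by
    rw [lineForm, h0]; nlinarith
  have hc2 : lineForm E F (conj z) < 0 := by
    rw [lineForm, Complex.conj_re, Complex.conj_im, h0]; nlinarith
  refine nhdsWithin_eq_iff_eventuallyEq.2 ?_
  filter_upwards [continuous_lineForm_conj.continuousAt.eventually_lt_const hc2,
    continuous_lineForm.continuousAt.eventually_lt_const hc1] with k hk1 hk2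
  refine propext ?_
  change ((k - z) / (conj F - F)).im < 0 ↔ k ∈ regionIn E F
  rw [im_sub_div_SigmaF h.imF, div_lt_iff₀ (by linarith [h.imF]), zero_mul, h0, sub_neg]
  exact ⟨fun hk => ⟨⟨hk2, hk1⟩, hk⟩, fun hk => hk.2⟩

lemma rightSide_Sigma2 (h : Admissible E F) (hz : z ∈ openSegment ℝ (conj F) (conj E)) :
    𝓝[rightSide (conj E - conj F) z] z = 𝓝[regionIn E F] z := by
  obtain ⟨h0, h1, h2, h3⟩ := mem_openSegment_Sigma1 h (mem_openSegment_Sigma2.1 hz)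
  have hc : lineForm E F z < 0 := by
    rw [lineForm_conj] at h0
    simp only [Complex.conj_im] at h3
    nlinarith [h.re_lt]
  refine nhdsWithin_eq_iff_eventuallyEq.2 ?_
  filter_upwards [continuous_lineForm.continuousAt.eventually_lt_const hc,
    Complex.continuous_re.continuousAt.eventually_lt_const (show z.re < F.re by simpa using h2)]
    with k hk1 hk2
  refine propext ?_
  change ((k - z) / (conj E - conj F)).im < 0 ↔ k ∈ regionIn E F
  rw [im_sub_div_Sigma2, h0, sub_zero, div_lt_iff₀ h.normSq_pos, zero_mul]
  exact ⟨fun hk => ⟨⟨hk1, hk⟩, hk2⟩, fun hk => hk.1.2⟩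

/-- The local straightness demanded by `exists_differentiableOn_extension`. -/
lemma eventually_mem_contour_Sigma1 (h : Admissible E F) (hz : z ∈ openSegment ℝ E F) :
    ∀ᶠ k in 𝓝 z, (k ∈ contour E F ↔ ((k - z) / (F - E)).im = 0) := by
  obtain ⟨h0, h1, h2, h3⟩ := mem_openSegment_Sigma1 h hz
  have hr := nhdsWithin_eq_iff_eventuallyEq.1 (h.rightSide_Sigma1 hz)
  filter_upwards [hr, Complex.continuous_re.continuousAt.eventually_lt_const h2,
    Complex.continuous_re.continuousAt.eventually_const_lt h1] with k hk hk1 hk2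
  constructor
  · intro hc
    have hl : ¬ k ∈ leftSide (F - E) z := fun hl =>
      h.regionTop_subset (h.leftSide_Sigma1 hz ▸ hl) hc
    have hr : ¬ k ∈ rightSide (F - E) z := fun hl => h.regionIn_subset (hk.mp hl) hc
    exact le_antisymm (not_lt.1 hl) (not_lt.1 hr)
  · intro hk0
    rw [im_sub_div_Sigma1, h0, sub_zero, div_eq_zero_iff, or_iff_left h.normSq_pos.ne'] at hk0
    exact Or.inl (Or.inl ((mem_Sigma1 h).2 ⟨hk0, hk2.le, hk1.le⟩))

lemma eventually_mem_contour_SigmaF (h : Admissible E F) (hz : z ∈ openSegment ℝ F (conj F)) :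
    ∀ᶠ k in 𝓝 z, (k ∈ contour E F ↔ ((k - z) / (conj F - F)).im = 0) := by
  obtain ⟨h0, h1, h2⟩ := (mem_openSegment_SigmaF h.imF).1 hz
  have hr := nhdsWithin_eq_iff_eventuallyEq.1 (h.rightSide_SigmaF hz)
  filter_upwards [hr, Complex.continuous_im.continuousAt.eventually_lt_const h2,
    Complex.continuous_im.continuousAt.eventually_const_lt h1] with k hk hk1 hk2
  constructor
  · intro hc
    have hl : ¬ k ∈ leftSide (conj F - F) z := fun hl =>
      h.regionRight_subset (h.leftSide_SigmaF hz ▸ hl) hc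
    have hr : ¬ k ∈ rightSide (conj F - F) z := fun hl => h.regionIn_subset (hk.mp hl) hc
    exact le_antisymm (not_lt.1 hl) (not_lt.1 hr)
  · intro hk0
    rw [im_sub_div_SigmaF h.imF, h0, div_eq_zero_iff, or_iff_left (by linarith [h.imF])] at hk0
    exact Or.inr ((mem_SigmaF h.imF).2 ⟨by linarith, hk2.le, hk1.le⟩)

lemma eventually_mem_contour_Sigma2 (h : Admissible E F)
    (hz : z ∈ openSegment ℝ (conj F) (conj E)) :
    ∀ᶠ k in 𝓝 z, (k ∈ contour E F ↔ ((k - z) / (conj E - conj F)).im = 0) := by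
  have h1 := h.eventually_mem_contour_Sigma1 (mem_openSegment_Sigma2.1 hz)
  filter_upwards [Complex.continuous_conj.continuousAt.eventually h1] with k hk
  rw [← conj_mem_contour, hk, im_sub_div_Sigma1, im_sub_div_Sigma2]

end Admissible

/-- The endpoints of the three segments. -/
def endpoints (E F : ℂ) : Set ℂ := {E, F, conj E, conj F}

lemma finite_endpoints : (endpoints E F).Finite := by simp [endpoints]

lemma mem_contour_cases (hk : k ∈ contour E F) (hp : k ∉ endpoints E F) :
    k ∈ openSegment ℝ E F ∨ k ∈ openSegment ℝ F (conj F) ∨ k ∈ openSegment ℝ (conj F) (conj E) := by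
  have hne : k ≠ E ∧ k ≠ F ∧ k ≠ conj E ∧ k ≠ conj F := by simpa [endpoints] using hp
  have key : ∀ a b : ℂ, k ∈ segment ℝ a b → k ≠ a → k ≠ b → k ∈ openSegment ℝ a b :=
    fun a b hs ha hb => mem_openSegment_of_ne_left_right ha.symm hb.symm hs
  rcases hk with (hk | hk) | hk
  · exact Or.inl (key _ _ hk hne.1 hne.2.1)
  · exact Or.inr (Or.inr (key _ _ hk hne.2.2.2 hne.2.2.1))
  · exact Or.inr (Or.inl (key _ _ hk hne.2.1 hne.2.2.2))

end SolitonGas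

namespace SolitonGas

variable {E F k z : ℂ}

/-! #### Boundary points of the regions -/

lemma conj_mem_regionTop : conj k ∈ regionTop E F ↔ k ∈ regionBot E F := Iff.rfl

lemma conj_mem_regionBot : conj k ∈ regionBot E F ↔ k ∈ regionTop E F := by
  rw [← conj_mem_regionTop, Complex.conj_conj]

lemma conj_mem_regionLeft : conj k ∈ regionLeft E ↔ k ∈ regionLeft E := by
  simp [regionLeft]

lemma conj_mem_regionRight : conj k ∈ regionRight F ↔ k ∈ regionRight F := by
  simp [regionRight]

lemma conj_mem_regionIn : conj k ∈ regionIn E F ↔ k ∈ regionIn E F := by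
  simp only [regionIn, Set.mem_inter_iff, Set.mem_ofPred_eq, Complex.conj_conj, Complex.conj_re]
  tauto

lemma conj_mem_closure {S T : Set ℂ} (h : ∀ k ∈ S, conj k ∈ T) (hz : z ∈ closure S) :
    conj z ∈ closure T :=
  map_mem_closure Complex.continuous_conj hz h

lemma mem_closure_of_ray {S : Set ℂ} {v : ℂ} (h : ∀ᶠ t : ℝ in 𝓝[>] 0, z + t * v ∈ S) :
    z ∈ closure S := by
  have hc : ContinuousAt (fun t : ℝ => z + t * v) 0 := by fun_prop
  exact mem_closure_of_tendsto
    (by simpa [ContinuousAt] using hc.tendsto.mono_left (nhdsWithin_le_nhds (s := Set.Ioi 0))) h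

lemma eventually_ray {S : Set ℂ} (hS : IsOpen S) (hz : z ∈ S) (v : ℂ) :
    ∀ᶠ t : ℝ in 𝓝[>] 0, z + t * v ∈ S := by
  have hc : ContinuousAt (fun t : ℝ => z + t * v) 0 := by fun_prop
  exact nhdsWithin_le_nhds (hc.eventually (hS.mem_nhds (by simpa using hz)))

lemma lineForm_ray (z v : ℂ) (t : ℝ) : lineForm E F (z + t * v) =
    lineForm E F z + t * (v.im * (F.re - E.re) - v.re * (F.im - E.im)) := by
  simp [lineForm]; ring

lemma lineForm_left : lineForm E F E = 0 := by simp [lineForm]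

lemma lineForm_right : lineForm E F F = 0 := by simp [lineForm]; ring

namespace Admissible

lemma lineForm_conj_left (h : Admissible E F) : lineForm E F (conj E) < 0 := by
  rw [lineForm_conj, lineForm_left]; nlinarith [h.imE, h.re_lt]

lemma lineForm_conj_right (h : Admissible E F) : lineForm E F (conj F) < 0 := by
  rw [lineForm_conj, lineForm_right]; nlinarith [h.imF, h.re_lt]

/-- Overlaps of neighbouring regions accumulate at the endpoints. This makes boundary values taken
from the two regions agree there, and it shows that the overlaps are nonempty. -/
lemma E_mem_closure_top_left (h : Admissible E F) :
    E ∈ closure (regionTop E F ∩ regionLeft E) := by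
  -- The component `E - F` prolongs the segment to the left of `E` without leaving its line; `i`
  -- lifts the ray above the line.
  refine mem_closure_of_ray (v := E - F + Complex.I) ?_
  filter_upwards [self_mem_nhdsWithin] with t (ht : 0 < t)
  have := h.re_lt
  constructor
  · rw [regionTop, Set.mem_ofPred_eq, lineForm_ray, lineForm_left]
    simp; nlinarith
  · simp [regionLeft]; nlinarith

lemma E_mem_closure_left_in (h : Admissible E F) :
    E ∈ closure (regionLeft E ∩ regionIn E F) := by
  refine mem_closure_of_ray (v := E - F - Complex.I) ?_
  filter_upwards [self_mem_nhdsWithin,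
    eventually_ray (isOpen_lt continuous_lineForm_conj continuous_const) h.lineForm_conj_left _,
    eventually_ray (isOpen_lt Complex.continuous_re continuous_const) h.re_lt _]
    with t (ht : 0 < t) h1 h2
  have := h.re_lt
  refine ⟨?_, ⟨?_, h1⟩, h2⟩
  · simp [regionLeft]; nlinarith
  · rw [Set.mem_ofPred_eq, lineForm_ray, lineForm_left]
    simp; nlinarith

lemma F_mem_closure_top_right (h : Admissible E F) :
    F ∈ closure (regionTop E F ∩ regionRight F) := by
  refine mem_closure_of_ray (v := F - E + Complex.I) ?_
  filter_upwards [self_mem_nhdsWithin] with t (ht : 0 < t)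
  have := h.re_lt
  constructor
  · rw [regionTop, Set.mem_ofPred_eq, lineForm_ray, lineForm_right]
    simp; nlinarith
  · simp [regionRight]; nlinarith

lemma F_mem_closure_in (h : Admissible E F) : F ∈ closure (regionIn E F) := by
  refine mem_closure_of_ray (v := E - F - Complex.I) ?_
  filter_upwards [self_mem_nhdsWithin,
    eventually_ray (isOpen_lt continuous_lineForm_conj continuous_const) h.lineForm_conj_right _]
    with t (ht : 0 < t) h1
  have := h.re_lt
  refine ⟨⟨?_, h1⟩, ?_⟩
  · rw [Set.mem_ofPred_eq, lineForm_ray, lineForm_right]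
    simp; nlinarith
  · simp; nlinarith

lemma conjE_mem_closure_bot_left (h : Admissible E F) :
    conj E ∈ closure (regionBot E F ∩ regionLeft E) :=
  conj_mem_closure (fun _ hk => ⟨conj_mem_regionBot.2 hk.1, conj_mem_regionLeft.2 hk.2⟩)
    h.E_mem_closure_top_left

lemma conjE_mem_closure_left_in (h : Admissible E F) :
    conj E ∈ closure (regionLeft E ∩ regionIn E F) :=
  conj_mem_closure (fun _ hk => ⟨conj_mem_regionLeft.2 hk.1, conj_mem_regionIn.2 hk.2⟩)
    h.E_mem_closure_left_in

lemma conjF_mem_closure_bot_right (h : Admissible E F) :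
    conj F ∈ closure (regionBot E F ∩ regionRight F) :=
  conj_mem_closure (fun _ hk => ⟨conj_mem_regionBot.2 hk.1, conj_mem_regionRight.2 hk.2⟩)
    h.F_mem_closure_top_right

lemma conjF_mem_closure_in (h : Admissible E F) : conj F ∈ closure (regionIn E F) :=
  conj_mem_closure (fun _ hk => conj_mem_regionIn.2 hk) h.F_mem_closure_in

lemma E_mem_closure_in (h : Admissible E F) : E ∈ closure (regionIn E F) :=
  closure_mono Set.inter_subset_right h.E_mem_closure_left_in

lemma conjE_mem_closure_in (h : Admissible E F) : conj E ∈ closure (regionIn E F) :=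
  closure_mono Set.inter_subset_right h.conjE_mem_closure_left_in

lemma Sigma1_subset_closure_top (h : Admissible E F) : Sigma1 E F ⊆ closure (regionTop E F) :=
  convex_regionTop.closure.segment_subset
    (closure_mono Set.inter_subset_left h.E_mem_closure_top_left)
    (closure_mono Set.inter_subset_left h.F_mem_closure_top_right)

lemma Sigma1_subset_closure_in (h : Admissible E F) : Sigma1 E F ⊆ closure (regionIn E F) :=
  convex_regionIn.closure.segment_subset h.E_mem_closure_in h.F_mem_closure_in

lemma SigmaF_subset_closure_right (h : Admissible E F) : SigmaF F ⊆ closure (regionRight F) :=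
  convex_regionRight.closure.segment_subset
    (closure_mono Set.inter_subset_right h.F_mem_closure_top_right)
    (closure_mono Set.inter_subset_right h.conjF_mem_closure_bot_right)

lemma SigmaF_subset_closure_in (h : Admissible E F) : SigmaF F ⊆ closure (regionIn E F) :=
  convex_regionIn.closure.segment_subset h.F_mem_closure_in h.conjF_mem_closure_in

lemma Sigma2_subset_closure_bot (h : Admissible E F) : Sigma2 E F ⊆ closure (regionBot E F) :=
  convex_regionBot.closure.segment_subset
    (closure_mono Set.inter_subset_left h.conjF_mem_closure_bot_right)
    (closure_mono Set.inter_subset_left h.conjE_mem_closure_bot_left)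

lemma Sigma2_subset_closure_in (h : Admissible E F) : Sigma2 E F ⊆ closure (regionIn E F) :=
  convex_regionIn.closure.segment_subset h.conjF_mem_closure_in h.conjE_mem_closure_in

/-! #### Connectedness and primitives in the complement of the contour -/

lemma exists_high_point (h : Admissible E F) (x y : ℝ) :
    ∃ N, y < N ∧ 0 < lineForm E F ⟨x, N⟩ := by
  have hpos := sub_pos.2 h.re_lt
  refine ⟨max (y + 1) (E.im + ((x - E.re) * (F.im - E.im) + 1) / (F.re - E.re)),
    (lt_add_one y).trans_le (le_max_left _ _), ?_⟩
  have h1 := le_max_right (y + 1) (E.im + ((x - E.re) * (F.im - E.im) + 1) / (F.re - E.re))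
  generalize max (y + 1) (E.im + ((x - E.re) * (F.im - E.im) + 1) / (F.re - E.re)) = N at h1
  have h2 : ((x - E.re) * (F.im - E.im) + 1) ≤ (N - E.im) * (F.re - E.re) := by
    rw [← div_le_iff₀ hpos]; linarith
  simp only [lineForm]
  linarith

lemma isPreconnected_compl (h : Admissible E F) : IsPreconnected (contour E F)ᶜ := by
  rw [h.compl_contour_eq]
  have hne : ∀ {S T : Set ℂ} {p : ℂ}, p ∈ closure (S ∩ T) → (S ∩ T).Nonempty :=
    fun hp => closure_nonempty_iff.1 ⟨_, hp⟩
  have h1 := convex_regionTop.isPreconnected.union' (hne h.F_mem_closure_top_right)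
    convex_regionRight.isPreconnected
  have h2 := h1.union' (((hne h.conjF_mem_closure_bot_right).mono (by
    rw [Set.inter_comm]; exact Set.inter_subset_inter_left _ Set.subset_union_right)))
    convex_regionBot.isPreconnected
  have h3 := h2.union' (((hne h.conjE_mem_closure_bot_left).mono
    (Set.inter_subset_inter_left _ Set.subset_union_right))) convex_regionLeft.isPreconnected
  exact h3.union' (((hne h.E_mem_closure_left_in).mono
    (Set.inter_subset_inter_left _ Set.subset_union_right))) convex_regionIn.isPreconnected

end Admissible

lemma isPreconnected_union_convex {S T : Set ℂ} (hS : IsPreconnected S) (hT : Convex ℝ T) {x : ℂ}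
    (hxS : x ∈ S) (hxT : x ∈ T) : IsPreconnected (S ∪ T) :=
  hS.union' ⟨x, hxS, hxT⟩ hT.isPreconnected

/-- The exterior of a square. -/
def boxExterior (ρ : ℝ) : Set ℂ :=
  {k | k.re < -ρ} ∪ {k | ρ < k.re} ∪ {k | ρ < k.im} ∪ {k | k.im < -ρ}

lemma isOpen_boxExterior (ρ : ℝ) : IsOpen (boxExterior ρ) :=
  (((isOpen_lt Complex.continuous_re continuous_const).union
    (isOpen_lt continuous_const Complex.continuous_re)).union
    (isOpen_lt continuous_const Complex.continuous_im)).union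
    (isOpen_lt Complex.continuous_im continuous_const)

lemma lt_norm_of_mem_boxExterior {ρ : ℝ} (hk : k ∈ boxExterior ρ) : ρ < ‖k‖ := by
  have h1 := Complex.abs_re_le_norm k
  have h2 := Complex.abs_im_le_norm k
  rw [abs_le] at h1 h2
  rcases hk with ((hk | hk) | hk) | hk <;> simp only [Set.mem_ofPred_eq] at hk <;> linarith

lemma isPreconnected_boxExterior (ρ : ℝ) : IsPreconnected (boxExterior ρ) := by
  have h1 := (convex_re_lt (-ρ)).isPreconnected.union'
    ⟨(⟨-ρ - 1, ρ + 1⟩ : ℂ), by simp, by simp⟩ (convex_lt_im ρ).isPreconnected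
  have h2 := h1.union' ⟨(⟨ρ + 1, ρ + 1⟩ : ℂ), Or.inr (by simp), by simp⟩
    (convex_lt_re ρ).isPreconnected
  have h3 := h2.union' ⟨(⟨ρ + 1, -ρ - 1⟩ : ℂ), Or.inr (by simp), by simp⟩
    (convex_im_lt (-ρ)).isPreconnected
  convert h3 using 1
  ext k
  simp only [boxExterior, Set.mem_union]
  tauto

namespace Admissible

/-- A function that is analytic off the contour and has a primitive near infinity has a primitive
off the contour. -/
lemma isExactOn_compl_contour (h : Admissible E F) {f : ℂ → ℂ}
    (hf : DifferentiableOn ℂ f (contour E F)ᶜ) {ρ₀ : ℝ}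
    (hext : Complex.IsExactOn f {k | ρ₀ < ‖k‖}) : Complex.IsExactOn f (contour E F)ᶜ := by
  have hE := h.imE
  have hF := h.imF
  have hlt := h.re_lt
  obtain ⟨ρ, hρ⟩ : ∃ ρ, ρ₀ ≤ ρ ∧ |E.re| ≤ ρ ∧ |F.re| ≤ ρ ∧ E.im ≤ ρ ∧ F.im ≤ ρ :=
    ⟨max ρ₀ (max |E.re| (max |F.re| (max E.im F.im))), by simp⟩
  obtain ⟨r0, r1, r2, r3, r4⟩ := hρ
  rw [abs_le] at r1 r2
  have exact_of : ∀ S ⊆ (contour E F)ᶜ, IsOpen S → Convex ℝ S → Complex.IsExactOn f S :=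
    fun S hS ho hc => IsExactOn.of_convex ho hc (hf.mono hS)
  obtain ⟨B₀, hB₀⟩ := hext
  have hX : Complex.IsExactOn f (boxExterior ρ) :=
    ⟨B₀, fun k hk => hB₀ k (r0.trans_lt (lt_norm_of_mem_boxExterior hk))⟩
  -- The primitive at infinity is extended over convex pieces one after the other, each meeting the
  -- union of the earlier ones in a connected set. `regionTop` and `regionBot` are trimmed to half
  -- planes so that they become disjoint; untrimmed they may meet on either side of the contour.
  set V₁ : Set ℂ := regionTop E F ∩ {k | 0 < k.im} with hV₁
  set V₃ : Set ℂ := regionBot E F ∩ {k | k.im < 0} with hV₃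
  have oV₁ : IsOpen V₁ := isOpen_regionTop.inter (isOpen_lt continuous_const Complex.continuous_im)
  have oV₃ : IsOpen V₃ := isOpen_regionBot.inter (isOpen_lt Complex.continuous_im continuous_const)
  have cV₁ : Convex ℝ V₁ := convex_regionTop.inter (convex_lt_im 0)
  have cV₃ : Convex ℝ V₃ := convex_regionBot.inter (convex_im_lt 0)
  have pV₁ : ∀ x y : ℝ, 0 ≤ y → ∃ N, y < N ∧ (⟨x, N⟩ : ℂ) ∈ V₁ := fun x y hy => by
    obtain ⟨N, h1, h2⟩ := h.exists_high_point x y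
    exact ⟨N, h1, h2, by simpa using hy.trans_lt h1⟩
  have pV₃ : ∀ x y : ℝ, 0 ≤ y → ∃ N, y < N ∧ (⟨x, -N⟩ : ℂ) ∈ V₃ := fun x y hy => by
    obtain ⟨N, h1, h2⟩ := h.exists_high_point x y
    refine ⟨N, h1, ?_, by simpa using hy.trans_lt h1⟩
    have : conj (⟨x, -N⟩ : ℂ) = ⟨x, N⟩ := by apply Complex.ext <;> simp
    rw [regionBot, Set.mem_ofPred_eq, this]
    exact h2
  have hρ0 : 0 ≤ ρ := by linarith
  -- first the two slanted half planes
  have s1 : Complex.IsExactOn f (boxExterior ρ ∪ V₁) := by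
    refine IsExactOn.union (isOpen_boxExterior ρ) oV₁ ?_ hX
      (exact_of _ (Set.inter_subset_left.trans h.regionTop_subset) oV₁ cV₁)
    obtain ⟨N, hN, hN'⟩ := pV₁ (-ρ - 1) ρ hρ0
    obtain ⟨N₂, hN₂, hN₂'⟩ := pV₁ (ρ + 1) ρ hρ0
    have c1 := isPreconnected_union_convex (isPreconnected_union_convex
      (cV₁.inter (convex_lt_im ρ)).isPreconnected
      (cV₁.inter (convex_re_lt (-ρ))) (x := ⟨-ρ - 1, N⟩) ⟨hN', hN⟩ ⟨hN', by simp⟩)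
      (cV₁.inter (convex_lt_re ρ)) (x := ⟨ρ + 1, N₂⟩) (Or.inl ⟨hN₂', hN₂⟩) ⟨hN₂', by simp⟩
    convert c1 using 1
    ext k
    simp only [boxExterior, hV₁, Set.mem_union, Set.mem_inter_iff, Set.mem_ofPred_eq]
    constructor
    · rintro ⟨((h1 | h1) | h1) | h1, h2, h3⟩
      · tauto
      · tauto
      · tauto
      · linarith
    · tauto
  have s2 : Complex.IsExactOn f (boxExterior ρ ∪ V₁ ∪ V₃) := by
    refine IsExactOn.union ((isOpen_boxExterior ρ).union oV₁) oV₃ ?_ s1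
      (exact_of _ (Set.inter_subset_left.trans h.regionBot_subset) oV₃ cV₃)
    obtain ⟨N, hN, hN'⟩ := pV₃ (-ρ - 1) ρ hρ0
    obtain ⟨N₂, hN₂, hN₂'⟩ := pV₃ (ρ + 1) ρ hρ0
    have c1 := isPreconnected_union_convex (isPreconnected_union_convex
      (cV₃.inter (convex_im_lt (-ρ))).isPreconnected
      (cV₃.inter (convex_re_lt (-ρ))) (x := ⟨-ρ - 1, -N⟩) ⟨hN', by simpa using hN⟩
      ⟨hN', by simp⟩)
      (cV₃.inter (convex_lt_re ρ)) (x := ⟨ρ + 1, -N₂⟩) (Or.inl ⟨hN₂', by simpa using hN₂⟩)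
      ⟨hN₂', by simp⟩
    convert c1 using 1
    ext k
    simp only [boxExterior, hV₁, hV₃, Set.mem_union, Set.mem_inter_iff, Set.mem_ofPred_eq]
    constructor
    · rintro ⟨(((h1 | h1) | h1) | h1) | h1, h2, h3⟩
      · tauto
      · tauto
      · linarith
      · tauto
      · linarith [h1.2]
    · tauto
  have o2 := ((isOpen_boxExterior ρ).union oV₁).union oV₃
  have s3 : Complex.IsExactOn f (boxExterior ρ ∪ V₁ ∪ V₃ ∪ regionRight F) := by
    refine IsExactOn.union o2 isOpen_regionRight ?_ s2
      (exact_of _ h.regionRight_subset isOpen_regionRight convex_regionRight)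
    obtain ⟨N, hN, hN'⟩ := pV₁ (ρ + 1) ρ hρ0
    obtain ⟨N₂, hN₂, hN₂'⟩ := pV₃ (ρ + 1) ρ hρ0
    have hr : ∀ y : ℝ, (⟨ρ + 1, y⟩ : ℂ) ∈ regionRight F := fun y => by
      simp only [regionRight, Set.mem_ofPred_eq]; linarith
    have hr' : ∀ y : ℝ, (⟨ρ + 1, y⟩ : ℂ) ∈ {k : ℂ | ρ < k.re} := fun y => by simp
    have c1 := isPreconnected_union_convex (isPreconnected_union_convex
      (isPreconnected_union_convex (isPreconnected_union_convex (convex_lt_re ρ).isPreconnected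
      (convex_regionRight.inter cV₁) (hr' N) ⟨hr _, hN'⟩)
      (convex_regionRight.inter cV₃) (Or.inl (hr' _)) ⟨hr _, hN₂'⟩)
      (convex_regionRight.inter (convex_lt_im ρ)) (Or.inl (Or.inl (hr' (ρ + 1)))) ⟨hr _, by simp⟩)
      (convex_regionRight.inter (convex_im_lt (-ρ))) (Or.inl (Or.inl (Or.inl (hr' (-ρ - 1)))))
      ⟨hr _, by simp⟩
    convert c1 using 1
    ext k
    simp only [boxExterior, regionRight, Set.mem_union, Set.mem_inter_iff, Set.mem_ofPred_eq]
    constructor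
    · rintro ⟨((((h1 | h1) | h1) | h1) | h1) | h1, h2⟩
      · linarith
      all_goals tauto
    · rintro ((((h1 | h1) | h1) | h1) | h1)
      · exact ⟨Or.inl (Or.inl (Or.inl (Or.inl (Or.inr h1)))), by linarith⟩
      all_goals tauto
  have s4 : Complex.IsExactOn f (boxExterior ρ ∪ V₁ ∪ V₃ ∪ regionRight F ∪ regionLeft E) := by
    refine IsExactOn.union (o2.union isOpen_regionRight) isOpen_regionLeft ?_ s3
      (exact_of _ h.regionLeft_subset isOpen_regionLeft convex_regionLeft)
    obtain ⟨N, hN, hN'⟩ := pV₁ (-ρ - 1) ρ hρ0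
    obtain ⟨N₂, hN₂, hN₂'⟩ := pV₃ (-ρ - 1) ρ hρ0
    have hr : ∀ y : ℝ, (⟨-ρ - 1, y⟩ : ℂ) ∈ regionLeft E := fun y => by
      simp only [regionLeft, Set.mem_ofPred_eq]; linarith
    have hr' : ∀ y : ℝ, (⟨-ρ - 1, y⟩ : ℂ) ∈ {k : ℂ | k.re < -ρ} := fun y => by simp
    have c1 := isPreconnected_union_convex (isPreconnected_union_convex
      (isPreconnected_union_convex (isPreconnected_union_convex (convex_re_lt (-ρ)).isPreconnected
      (convex_regionLeft.inter cV₁) (hr' N) ⟨hr _, hN'⟩)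
      (convex_regionLeft.inter cV₃) (Or.inl (hr' _)) ⟨hr _, hN₂'⟩)
      (convex_regionLeft.inter (convex_lt_im ρ)) (Or.inl (Or.inl (hr' (ρ + 1)))) ⟨hr _, by simp⟩)
      (convex_regionLeft.inter (convex_im_lt (-ρ))) (Or.inl (Or.inl (Or.inl (hr' (-ρ - 1)))))
      ⟨hr _, by simp⟩
    convert c1 using 1
    ext k
    simp only [boxExterior, regionRight, regionLeft, Set.mem_union, Set.mem_inter_iff,
      Set.mem_ofPred_eq]
    constructor
    · rintro ⟨(((((h1 | h1) | h1) | h1) | h1) | h1) | h1, h2⟩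
      · tauto
      · linarith
      · tauto
      · tauto
      · tauto
      · tauto
      · linarith
    · rintro ((((h1 | h1) | h1) | h1) | h1)
      · exact ⟨Or.inl (Or.inl (Or.inl (Or.inl (Or.inl (Or.inl h1))))), by linarith⟩
      all_goals tauto
  -- To the right of `E` the inner region stays inside the box, so it meets the earlier pieces only
  -- within `regionLeft`, and that intersection is convex.
  have hbound : ∀ k : ℂ, E.re ≤ k.re → k.re ≤ F.re → lineForm E F k < 0 → k.im ≤ ρ := by
    intro k h1 h2 h3
    rw [lineForm] at h3
    by_contra! h4
    nlinarith [mul_nonneg (sub_nonneg.2 h1) (sub_nonneg.2 r4),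
      mul_nonneg (sub_nonneg.2 h2) (sub_nonneg.2 r3)]
  have s5 := IsExactOn.union ((o2.union isOpen_regionRight).union isOpen_regionLeft)
    (isOpen_regionIn (E := E) (F := F)) (by
      convert (convex_regionLeft (E := E)).inter (convex_regionIn (E := E) (F := F)) |>.isPreconnected
        using 1
      ext k
      refine ⟨fun ⟨hk, hk'⟩ => ⟨?_, hk'⟩, fun ⟨hk, hk'⟩ => ⟨Or.inr hk, hk'⟩⟩
      obtain ⟨⟨k1, k2⟩, k3⟩ := hk'
      simp only [Set.mem_ofPred_eq] at k1 k2 k3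
      rcases hk with (((hk | hk) | hk) | hk) | hk
      · by_contra hcon
        simp only [regionLeft, Set.mem_ofPred_eq, not_lt] at hcon
        have b1 := hbound k hcon k3.le k1
        have b2 := hbound (conj k) (by simpa) (by simpa using k3.le) k2
        simp only [Complex.conj_im] at b2
        rcases hk with ((hk | hk) | hk) | hk <;> simp only [Set.mem_ofPred_eq] at hk <;> linarith
      · exact absurd hk.1 (not_lt.2 k1.le)
      · exact absurd hk.1 (not_lt.2 k2.le)
      · exact absurd hk (not_lt.2 k3.le)
      · exact hk) s4
    (exact_of _ h.regionIn_subset isOpen_regionIn convex_regionIn)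
  obtain ⟨B, hB⟩ := s5
  -- The part of `regionTop` lost in the trimming is already covered by the left and right half
  -- planes.
  have htop : ∀ k : ℂ, 0 < lineForm E F k → k.im ≤ 0 → k.re < E.re ∨ F.re < k.re := by
    intro k h1 h2
    by_contra! hcon
    rw [lineForm] at h1
    nlinarith [mul_nonneg (sub_nonneg.2 hcon.1) hF.le, mul_nonneg (sub_nonneg.2 hcon.2) hE.le,
      mul_nonneg (neg_nonneg.2 h2) (sub_nonneg.2 hlt.le)]
  refine ⟨B, fun k hk => hB k ?_⟩
  rcases h.notMem_contour_iff.1 hk with (((hk | hk) | hk) | hk) | hk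
  · by_cases h0 : 0 < k.im
    · exact Or.inl (Or.inl (Or.inl (Or.inl (Or.inr ⟨hk, h0⟩))))
    · rcases htop k hk (not_lt.1 h0) with h1 | h1
      · exact Or.inl (Or.inr h1)
      · exact Or.inl (Or.inl (Or.inr h1))
  · exact Or.inl (Or.inl (Or.inr hk))
  · by_cases h0 : k.im < 0
    · exact Or.inl (Or.inl (Or.inl (Or.inr ⟨hk, h0⟩)))
    · rcases htop (conj k) hk (by simpa using h0) with h1 | h1
      · exact Or.inl (Or.inr (conj_mem_regionLeft.1 h1))
      · exact Or.inl (Or.inl (Or.inr (conj_mem_regionRight.1 h1)))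
  · exact Or.inl (Or.inr hk)
  · exact Or.inr hk

end Admissible

end SolitonGas

namespace SolitonGas

variable {E F k z a b : ℂ}

/-! ### The square root -/

lemma log_eq_of_im_pos {w : ℂ} (hw : 0 < w.im) :
    Complex.log w = Complex.log (-w) + Real.pi * Complex.I := by
  rw [Complex.log, Complex.log, norm_neg, Complex.arg_neg_eq_arg_sub_pi_of_im_pos hw]
  push_cast; ring

lemma log_eq_of_im_neg {w : ℂ} (hw : w.im < 0) :
    Complex.log w = Complex.log (-w) - Real.pi * Complex.I := by
  rw [Complex.log, Complex.log, norm_neg, Complex.arg_neg_eq_arg_add_pi_of_im_neg hw]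
  push_cast; ring

lemma log_eq_of_re_neg {w : ℂ} (hw : w.re < 0) (h0 : w.im = 0) :
    Complex.log w = Complex.log (-w) + Real.pi * Complex.I := by
  have h1 : Complex.arg w = Real.pi := Complex.arg_eq_pi_iff.2 ⟨hw, h0⟩
  have h2 : Complex.arg (-w) = 0 := Complex.arg_eq_zero_iff.2 ⟨by simp [hw.le], by simp [h0]⟩
  rw [Complex.log, Complex.log, norm_neg, h1, h2]
  push_cast; ring

lemma exp_half_pi_mul_I : Complex.exp (Real.pi * Complex.I * (1 / 2)) = Complex.I := by
  rw [show (Real.pi * Complex.I * (1 / 2) : ℂ) = Real.pi / 2 * Complex.I by ring,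
    Complex.exp_pi_div_two_mul_I]

/-- The negative axis goes with the upper side because the principal argument is `π` there; this is
why `R` takes its left boundary values on the cuts. -/
lemma sqrt_eq_of_upper {w : ℂ} (hw : 0 < w.im ∨ w.re < 0 ∧ w.im = 0) :
    w ^ (1 / 2 : ℂ) = Complex.I * (-w) ^ (1 / 2 : ℂ) := by
  have h0 : w ≠ 0 := by rintro rfl; simp at hw
  have hl : Complex.log w = Complex.log (-w) + Real.pi * Complex.I :=
    hw.elim log_eq_of_im_pos fun h => log_eq_of_re_neg h.1 h.2
  rw [Complex.cpow_def_of_ne_zero h0, Complex.cpow_def_of_ne_zero (neg_ne_zero.2 h0), hl, add_mul,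
    Complex.exp_add, exp_half_pi_mul_I, mul_comm]

lemma sqrt_eq_of_im_neg {w : ℂ} (hw : w.im < 0) :
    w ^ (1 / 2 : ℂ) = -(Complex.I * (-w) ^ (1 / 2 : ℂ)) := by
  have h0 : w ≠ 0 := by rintro rfl; simp at hw
  rw [Complex.cpow_def_of_ne_zero h0, Complex.cpow_def_of_ne_zero (neg_ne_zero.2 h0),
    log_eq_of_im_neg hw, sub_mul, Complex.exp_sub, exp_half_pi_mul_I, Complex.div_I]
  ring

lemma sqrt_sq (w : ℂ) : (w ^ (1 / 2 : ℂ)) ^ 2 = w := by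
  rw [one_div]; exact Complex.cpow_ofNat_inv_pow w 2

lemma conj_sqrt {w : ℂ} (hw : w.arg ≠ Real.pi) :
    conj (w ^ (1 / 2 : ℂ)) = (conj w) ^ (1 / 2 : ℂ) := by
  have h2 : conj (1 / 2 : ℂ) = 1 / 2 := by
    rw [show (1 / 2 : ℂ) = ((1 / 2 : ℝ) : ℂ) by push_cast; rfl, Complex.conj_ofReal]
  rw [Complex.conj_cpow _ _ hw, h2]

/-- If the quotient were a real `w ≤ 0`, solving for `k` would give the convex combination of `a`
and `b` with weights `-w / (1 - w)` and `1 / (1 - w)`. -/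
lemma div_mem_slitPlane (hk : k ∉ segment ℝ a b) : (k - b) / (k - a) ∈ Complex.slitPlane := by
  have hka : k - a ≠ 0 := _root_.sub_ne_zero.2 fun h => hk (h ▸ left_mem_segment ℝ a b)
  by_contra hcon
  rw [Complex.mem_slitPlane_iff, not_or, not_lt, not_not] at hcon
  obtain ⟨h1, h2⟩ := hcon
  set w := (k - b) / (k - a) with hw
  have e : k - b = (w.re : ℂ) * (k - a) := by
    rw [← (div_eq_iff hka)]
    apply Complex.ext <;> simp [h2, ← hw]
  have hpos : 0 < 1 - w.re := by linarith
  refine hk ⟨-w.re / (1 - w.re), 1 / (1 - w.re), by apply div_nonneg <;> linarith, by positivity,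
    by field_simp; ring, ?_⟩
  have hne : (1 - (w.re : ℂ)) ≠ 0 := by
    exact_mod_cast hpos.ne'
  simp only [Complex.real_smul]
  push_cast
  field_simp
  linear_combination -e

/-- One factor of the square root `R`: the root of `(k - a) * (k - b)` with cut along the segment
and asymptotic to `k`. -/
noncomputable def halfR (a b k : ℂ) : ℂ := (k - a) * ((k - b) / (k - a)) ^ (1 / 2 : ℂ)

/-- The continuation of `halfR a b` from the left of the segment across it. -/
noncomputable def halfRt (a b k : ℂ) : ℂ :=
  Complex.I * ((k - a) * ((b - k) / (k - a)) ^ (1 / 2 : ℂ))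

lemma R_eq : R E F k = halfR E F k * halfR (conj F) (conj E) k := rfl

lemma halfR_sq : halfR a b k ^ 2 = (k - a) * (k - b) := by
  rw [halfR, mul_pow, sqrt_sq]
  rcases eq_or_ne (k - a) 0 with h | h
  · simp [h]
  · field_simp

lemma halfR_ne_zero (ha : k ≠ a) (hb : k ≠ b) : halfR a b k ≠ 0 := by
  intro h
  have := halfR_sq (a := a) (b := b) (k := k)
  rw [h] at this
  exact mul_ne_zero (_root_.sub_ne_zero.2 ha) (_root_.sub_ne_zero.2 hb) (by simpa using this.symm)

lemma differentiableAt_halfR (hk : k ∉ segment ℝ a b) : DifferentiableAt ℂ (halfR a b) k := by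
  have hka : k - a ≠ 0 := _root_.sub_ne_zero.2 fun h => hk (h ▸ left_mem_segment ℝ a b)
  unfold halfR
  refine DifferentiableAt.mul (by fun_prop) (DifferentiableAt.cpow (by fun_prop (disch := assumption))
    (by fun_prop) (div_mem_slitPlane hk))

lemma div_re_openSegment (hz : z ∈ openSegment ℝ a b) (hab : a ≠ b) :
    ∃ x : ℝ, x < 0 ∧ (z - b) / (z - a) = x := by
  rw [openSegment_eq_image'] at hz
  obtain ⟨t, ⟨h0, h1⟩, rfl⟩ := hz
  refine ⟨(t - 1) / t, div_neg_of_neg_of_pos (by linarith) h0, ?_⟩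
  have h2 : b - a ≠ 0 := _root_.sub_ne_zero.2 hab.symm
  have h3 : (t : ℂ) ≠ 0 := by exact_mod_cast h0.ne'
  simp only [Complex.real_smul, add_sub_cancel_left]
  push_cast
  rw [div_eq_div_iff (mul_ne_zero h3 h2) h3]
  ring

/-- On the open segment `(b - k) / (k - a)` is a positive real, well inside the domain of the
principal root. -/
lemma eventually_differentiableAt_halfRt (hz : z ∈ openSegment ℝ a b) (hab : a ≠ b) :
    ∀ᶠ k in 𝓝 z, DifferentiableAt ℂ (halfRt a b) k ∧ halfRt a b k ≠ 0 := by
  obtain ⟨x, hx, e⟩ := div_re_openSegment hz hab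
  have hza : z - a ≠ 0 := fun h => by
    rw [h, div_zero] at e
    exact hx.ne (by exact_mod_cast e.symm)
  have e' : (b - z) / (z - a) = ((-x : ℝ) : ℂ) := by
    rw [← neg_sub, neg_div, e]; push_cast; ring
  have hslit : (b - z) / (z - a) ∈ Complex.slitPlane := by
    rw [e']; exact Complex.ofReal_mem_slitPlane.2 (by linarith)
  have hc : ContinuousAt (fun k => (b - k) / (k - a)) z := by fun_prop (disch := assumption)
  filter_upwards [hc.eventually (Complex.isOpen_slitPlane.mem_nhds hslit),
    (show ContinuousAt (fun k => k - a) z by fun_prop).eventually_ne hza] with k hk hka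
  constructor
  · unfold halfRt
    exact DifferentiableAt.mul (by fun_prop) (DifferentiableAt.mul (by fun_prop)
      (DifferentiableAt.cpow (by fun_prop (disch := assumption)) (by fun_prop) hk))
  · rw [halfRt]
    refine mul_ne_zero Complex.I_ne_zero (mul_ne_zero hka ?_)
    rw [Complex.cpow_def_of_ne_zero (Complex.slitPlane_ne_zero hk)]
    exact Complex.exp_ne_zero _

/-- With `u = (k - a) / (b - a)` the quotient is `1 - u⁻¹`, so its imaginary part has the sign of
that of `u`. -/
lemma im_div_sub (hka : k ≠ a) (hab : a ≠ b) : ((k - b) / (k - a)).im =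
    ((k - a) / (b - a)).im / Complex.normSq ((k - a) / (b - a)) := by
  have h1 : k - a ≠ 0 := _root_.sub_ne_zero.2 hka
  have h2 : b - a ≠ 0 := _root_.sub_ne_zero.2 hab.symm
  have : (k - b) / (k - a) = 1 - ((k - a) / (b - a))⁻¹ := by field_simp; ring
  rw [this, Complex.sub_im, Complex.inv_im]
  simp
  ring

lemma ne_of_im_div_ne_zero (h : ((k - a) / (b - a)).im ≠ 0) : k ≠ a ∧ a ≠ b :=
  ⟨fun h0 => h (by simp [h0]), fun h0 => h (by simp [h0])⟩

lemma im_div_sub_pos (h : 0 < ((k - a) / (b - a)).im) : 0 < ((k - b) / (k - a)).im := by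
  obtain ⟨h1, h2⟩ := ne_of_im_div_ne_zero h.ne'
  rw [im_div_sub h1 h2]
  refine div_pos h (Complex.normSq_pos.2 fun h0 => h.ne' (by rw [h0]; simp))

lemma im_div_sub_neg (h : ((k - a) / (b - a)).im < 0) : ((k - b) / (k - a)).im < 0 := by
  obtain ⟨h1, h2⟩ := ne_of_im_div_ne_zero h.ne
  rw [im_div_sub h1 h2]
  refine div_neg_of_neg_of_pos h (Complex.normSq_pos.2 fun h0 => h.ne (by rw [h0]; simp))

lemma halfR_eq_left (h : 0 < ((k - a) / (b - a)).im) : halfR a b k = halfRt a b k := by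
  rw [halfR, halfRt, sqrt_eq_of_upper (Or.inl (im_div_sub_pos h)), ← neg_div, neg_sub]
  ring

lemma halfR_eq_right (h : ((k - a) / (b - a)).im < 0) : halfR a b k = -halfRt a b k := by
  rw [halfR, halfRt, sqrt_eq_of_im_neg (im_div_sub_neg h), ← neg_div, neg_sub]
  ring

lemma halfR_eq_openSegment (hz : z ∈ openSegment ℝ a b) (hab : a ≠ b) :
    halfR a b z = halfRt a b z := by
  obtain ⟨x, hx, e⟩ := div_re_openSegment hz hab
  rw [halfR, halfRt, sqrt_eq_of_upper (Or.inr (by rw [e]; simpa using hx)), ← neg_div, neg_sub]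
  ring

/-- The two factors of `R` are mirror images, also on the cuts: reflection followed by reversal of
the orientation sends left sides to left sides. The symmetry of `R` then holds at every point, so it
can be used inside integrals of `R₊`. -/
lemma conj_halfR_conj : conj (halfR a b (conj k)) = halfR (conj b) (conj a) k := by
  set w := (k - conj b) / (k - conj a) with hw
  have hcw : (conj k - b) / (conj k - a) = conj w := by simp [hw]
  rw [halfR, halfR, hcw, map_mul, map_sub, Complex.conj_conj]
  rcases eq_or_ne k (conj a) with h | h
  · have h1 : (k - conj a) / (k - conj b) = 0 := by simp [h]
    rw [h1]
    simp [h]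
  rcases eq_or_ne k (conj b) with h' | h'
  · have h1 : w = 0 := by simp [hw, h']
    rw [h1]
    simp [h']
  have h1 : k - conj a ≠ 0 := _root_.sub_ne_zero.2 h
  have h2 : k - conj b ≠ 0 := _root_.sub_ne_zero.2 h'
  have hw0 : w ≠ 0 := div_ne_zero h2 h1
  have e1 : (k - conj a) / (k - conj b) = w⁻¹ := by rw [hw, inv_div]
  have e2 : k - conj b = w * (k - conj a) := by rw [hw]; field_simp
  rw [e1, e2]
  have key : conj ((conj w) ^ (1 / 2 : ℂ)) = w * (w⁻¹) ^ (1 / 2 : ℂ) := by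
    -- Exchanging the endpoints inverts `w`. Off the negative axis the root commutes with inversion
    -- and conjugation; on it both rules fail, and everything is expressed through the root of the
    -- positive number `-w`.
    by_cases harg : w.arg = Real.pi
    · obtain ⟨h3, h4⟩ := Complex.arg_eq_pi_iff.1 harg
      have hwr : conj w = w := Complex.conj_eq_iff_im.2 h4
      have hwi : (w⁻¹).re < 0 ∧ (w⁻¹).im = 0 := by
        rw [Complex.inv_re, Complex.inv_im, h4]
        exact ⟨div_neg_of_neg_of_pos h3 (Complex.normSq_pos.2 hw0), by simp⟩
      have hnarg : Complex.arg (-w) = 0 :=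
        Complex.arg_eq_zero_iff.2 ⟨by simp [h3.le], by simp [h4]⟩
      rw [hwr, sqrt_eq_of_upper (Or.inr ⟨h3, h4⟩), sqrt_eq_of_upper (Or.inr hwi), ← inv_neg,
        Complex.inv_cpow _ _ (by rw [hnarg]; exact Real.pi_pos.ne), map_mul, Complex.conj_I,
        conj_sqrt (by rw [hnarg]; exact Real.pi_pos.ne), map_neg, hwr]
      have hs := sqrt_sq (-w)
      have hs0 : (-w) ^ (1 / 2 : ℂ) ≠ 0 := fun h0 => by
        rw [h0] at hs; exact hw0 (by simpa using hs.symm)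
      field_simp
      linear_combination -hs
    · rw [← conj_sqrt harg, Complex.inv_cpow _ _ harg, Complex.conj_conj]
      have hs := sqrt_sq w
      have hs0 : w ^ (1 / 2 : ℂ) ≠ 0 := fun h0 => by
        rw [h0] at hs; exact hw0 (by simpa using hs.symm)
      field_simp
      linear_combination hs
  rw [key]
  ring

lemma R_eq_mul_conj : R E F k = halfR E F k * conj (halfR E F (conj k)) := by
  rw [R_eq, conj_halfR_conj]

lemma conj_R_conj : conj (R E F (conj k)) = R E F k := by
  rw [R_eq_mul_conj, R_eq_mul_conj, map_mul, Complex.conj_conj, Complex.conj_conj, mul_comm]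

lemma R_sq : R E F k ^ 2 = (k - E) * (k - F) * ((k - conj E) * (k - conj F)) := by
  rw [R_eq, mul_pow, halfR_sq, halfR_sq]; ring

lemma R_ne_zero (hk : k ∉ endpoints E F) : R E F k ≠ 0 := by
  have hne : k ≠ E ∧ k ≠ F ∧ k ≠ conj E ∧ k ≠ conj F := by simpa [endpoints] using hk
  exact mul_ne_zero (halfR_ne_zero hne.1 hne.2.1) (halfR_ne_zero hne.2.2.2 hne.2.2.1)

lemma endpoints_subset_contour : endpoints E F ⊆ contour E F := by
  rintro k (rfl | rfl | rfl | rfl)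
  · exact Or.inl (Or.inl (left_mem_segment ℝ _ _))
  · exact Or.inl (Or.inl (right_mem_segment ℝ _ _))
  · exact Or.inl (Or.inr (right_mem_segment ℝ _ _))
  · exact Or.inl (Or.inr (left_mem_segment ℝ _ _))

lemma R_ne_zero_of_notMem (hk : k ∉ contour E F) : R E F k ≠ 0 :=
  R_ne_zero fun h => hk (endpoints_subset_contour h)

lemma differentiableAt_R (h1 : k ∉ Sigma1 E F) (h2 : k ∉ Sigma2 E F) :
    DifferentiableAt ℂ (R E F) k :=
  (differentiableAt_halfR h1).mul (differentiableAt_halfR h2)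

lemma norm_R : ‖R E F k‖ = √(‖k - E‖ * ‖k - F‖ * (‖k - conj E‖ * ‖k - conj F‖)) := by
  rw [← norm_mul, ← norm_mul, ← norm_mul, ← R_sq, norm_pow, Real.sqrt_sq (norm_nonneg _)]

/-- On the real axis, `R` is positive. -/
lemma R_ofReal_pos (hE : E.im ≠ 0) (hF : F.im ≠ 0) (x : ℝ) : ∃ y : ℝ, 0 < y ∧ R E F x = y := by
  refine ⟨Complex.normSq (halfR E F x), Complex.normSq_pos.2 (halfR_ne_zero ?_ ?_), ?_⟩
  · rintro rfl; simp at hE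
  · rintro rfl; simp at hF
  · rw [R_eq_mul_conj, Complex.conj_ofReal, Complex.mul_conj]

end SolitonGas

namespace SolitonGas

variable {E F k z a b : ℂ}

/-! ### The holomorphic differential -/

lemma tendsto_inv_cocompact : Tendsto (fun k : ℂ => k⁻¹) (cocompact ℂ) (𝓝 0) :=
  Metric.cobounded_eq_cocompact (α := ℂ) ▸ tendsto_inv₀_cobounded

/-- In the coordinate `w = 1 / k` one has `R k = k ^ 2 g w` with `g` analytic and nonzero at `0`, so
`dk / R` becomes `-dw / g`, which is regular at infinity and has no residue there. -/
lemma exists_primitive_exterior (E F : ℂ) : ∃ (ρ : ℝ) (B : ℂ → ℂ) (l : ℂ),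
    (∀ k, ρ < ‖k‖ → HasDerivAt B (1 / R E F k) k) ∧ Tendsto B (cocompact ℂ) (𝓝 l) := by
  set g : ℂ → ℂ := fun w => ((1 - E * w) * ((1 - F * w) / (1 - E * w)) ^ (1 / 2 : ℂ)) *
    ((1 - conj F * w) * ((1 - conj E * w) / (1 - conj F * w)) ^ (1 / 2 : ℂ)) with hg
  have hR : ∀ k : ℂ, k ≠ 0 → R E F k = k ^ 2 * g k⁻¹ := by
    intro k hk
    have h1 : ∀ a : ℂ, k - a = k * (1 - a * k⁻¹) := fun a => by field_simp
    rw [R, hg, h1 E, h1 F, h1 (conj E), h1 (conj F), mul_div_mul_left _ _ hk,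
      mul_div_mul_left _ _ hk]
    ring
  have hne : ∀ a : ℂ, ∀ᶠ w : ℂ in 𝓝 0, 1 - a * w ≠ 0 := fun a =>
    (show ContinuousAt (fun w : ℂ => 1 - a * w) 0 by fun_prop).eventually_ne (by simp)
  have hsl : ∀ a b : ℂ, ∀ᶠ w : ℂ in 𝓝 0, (1 - a * w) / (1 - b * w) ∈ Complex.slitPlane :=
    fun a b => (show ContinuousAt (fun w : ℂ => (1 - a * w) / (1 - b * w)) 0 by
      fun_prop (disch := simp)).eventually (Complex.isOpen_slitPlane.mem_nhds (by simp))
  have hgd : ∀ᶠ w in 𝓝 0, DifferentiableAt ℂ g w ∧ g w ≠ 0 := by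
    filter_upwards [hne E, hne (conj F), hsl F E, hsl (conj E) (conj F)] with w h1 h2 h3 h4
    constructor
    · refine DifferentiableAt.mul (DifferentiableAt.mul (by fun_prop) (DifferentiableAt.cpow
        (by fun_prop (disch := assumption)) (by fun_prop) h3)) (DifferentiableAt.mul (by fun_prop)
        (DifferentiableAt.cpow (by fun_prop (disch := assumption)) (by fun_prop) h4))
    · have hp : ∀ x ∈ Complex.slitPlane, x ^ (1 / 2 : ℂ) ≠ 0 := fun x hx => by
        rw [Complex.cpow_def_of_ne_zero (Complex.slitPlane_ne_zero hx)]
        exact Complex.exp_ne_zero _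
      exact mul_ne_zero (mul_ne_zero h1 (hp _ h3)) (mul_ne_zero h2 (hp _ h4))
  obtain ⟨δ, hδ, hball⟩ := Metric.eventually_nhds_iff_ball.1 hgd
  obtain ⟨G, hG⟩ := DifferentiableOn.isExactOn_ball (c := 0) (r := δ) (f := fun w => -(1 / g w))
    fun w hw => ((DifferentiableAt.div (by fun_prop) (hball w hw).1
      (hball w hw).2).neg).differentiableWithinAt
  refine ⟨δ⁻¹, fun k => G k⁻¹, G 0, fun k hk => ?_, ?_⟩
  · have hk0 : 0 < ‖k‖ := (inv_pos.2 hδ).trans hk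
    have hk1 : k ≠ 0 := norm_pos_iff.1 hk0
    have hw : k⁻¹ ∈ Metric.ball (0 : ℂ) δ := by
      rw [Metric.mem_ball, dist_zero_right, norm_inv]
      exact inv_lt_of_inv_lt₀ hδ hk
    have := (hG _ hw).comp k (hasDerivAt_inv hk1)
    refine this.congr_deriv ?_
    have := (hball _ hw).2
    rw [hR k hk1]
    field_simp
  · exact ((hG 0 (by simpa using hδ)).continuousAt.tendsto).comp tendsto_inv_cocompact

lemma exists_isAbelPrimitive (h : Admissible E F) (c : ℂ) :
    ∃ A : ℂ → ℂ, ∀ k ∉ contour E F, HasDerivAt A (c * (1 / R E F k)) k := by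
  obtain ⟨ρ, B, l, hB, -⟩ := exists_primitive_exterior E F
  have hf : DifferentiableOn ℂ (fun k => 1 / R E F k) (contour E F)ᶜ := fun k hk =>
    (DifferentiableAt.div (by fun_prop) (differentiableAt_R (fun h => hk (Or.inl (Or.inl h)))
      (fun h => hk (Or.inl (Or.inr h)))) (R_ne_zero_of_notMem hk)).differentiableWithinAt
  obtain ⟨A, hA⟩ := h.isExactOn_compl_contour hf ⟨B, hB⟩
  exact ⟨fun k => c * A k, fun k hk => (hA k hk).const_mul c⟩

lemma eventually_notMem_contour : ∀ᶠ k in cocompact ℂ, k ∉ contour E F :=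
  (((isCompact_segment _ _).union (isCompact_segment _ _)).union
    (isCompact_segment _ _)).compl_mem_cocompact

/-- Outside a large square, which is connected, the primitive differs by a constant from the one
that is regular at infinity. -/
lemma exists_tendsto_cocompact {A : ℂ → ℂ} {c : ℂ}
    (hA : ∀ k ∉ contour E F, HasDerivAt A (c * (1 / R E F k)) k) :
    ∃ l, Tendsto A (cocompact ℂ) (𝓝 l) := by
  obtain ⟨ρ, B, l, hB, hl⟩ := exists_primitive_exterior E F
  obtain ⟨ρ', hρ'⟩ := (((isCompact_segment _ _).union (isCompact_segment _ _)).union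
    (isCompact_segment _ _) : IsCompact (contour E F)).isBounded.exists_norm_le
  set r := max ρ ρ'
  have hbox : ∀ k ∈ boxExterior r, ρ < ‖k‖ ∧ k ∉ contour E F := fun k hk => by
    have := lt_norm_of_mem_boxExterior hk
    exact ⟨(le_max_left _ _).trans_lt this, fun hc =>
      absurd (hρ' k hc) (not_le.2 ((le_max_right _ _).trans_lt this))⟩
  obtain ⟨d, hd⟩ := exists_eq_add_const_of_hasDerivAt (isOpen_boxExterior r)
    (isPreconnected_boxExterior r) (fun k hk => hA k (hbox k hk).2)
    (fun k hk => (hB k (hbox k hk).1).const_mul c)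
  refine ⟨c * l + d, ((hl.const_mul c).add_const d).congr' ?_⟩
  have hfar : ∀ᶠ k in cocompact ℂ, k ∈ boxExterior r := by
    have hK : IsCompact (Set.Icc (-r) r ×ℂ Set.Icc (-r) r) := isCompact_Icc.reProdIm isCompact_Icc
    filter_upwards [hK.compl_mem_cocompact] with k hk
    by_contra hcon
    simp only [boxExterior, Set.mem_union, Set.mem_ofPred_eq, not_or, not_lt] at hcon
    exact hk ⟨⟨hcon.1.1.1, hcon.1.1.2⟩, ⟨hcon.2, hcon.1.2⟩⟩
  filter_upwards [hfar] with k hk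
  exact (hd k hk).symm

/-! #### Integrability and the normalizing period -/

/-- The convergent Beta integral with both parameters `1 / 2`. -/
lemma intervalIntegrable_inv_sqrt :
    IntervalIntegrable (fun t : ℝ => 1 / √(t * (1 - t))) MeasureTheory.volume 0 1 := by
  have h := (Complex.betaIntegral_convergent (u := 1 / 2) (v := 1 / 2) (by simp) (by simp)).norm
  refine h.congr_ae ?_
  rw [Set.uIoc_of_le zero_le_one]
  have h1 : ∀ᵐ t : ℝ ∂MeasureTheory.volume.restrict (Set.Ioc (0 : ℝ) 1), t ≠ 1 :=
    MeasureTheory.ae_restrict_of_ae (MeasureTheory.Measure.ae_ne _ 1)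
  filter_upwards [h1, MeasureTheory.ae_restrict_mem measurableSet_Ioc] with t ht1 ht
  have h0 : 0 < t := ht.1
  have h2 : 0 < 1 - t := sub_pos.2 (lt_of_le_of_ne ht.2 ht1)
  rw [norm_mul, Complex.norm_cpow_eq_rpow_re_of_pos h0,
    show (1 - (t : ℂ)) = ((1 - t : ℝ) : ℂ) by push_cast; rfl,
    Complex.norm_cpow_eq_rpow_re_of_pos h2]
  have e : ((1 / 2 : ℂ) - 1).re = -(1 / 2) := by norm_num
  rw [e, Real.rpow_neg h0.le, Real.rpow_neg h2.le, Real.sqrt_mul h0.le, Real.sqrt_eq_rpow,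
    Real.sqrt_eq_rpow]
  field_simp

lemma measurable_R : Measurable (R E F) := by
  unfold R
  fun_prop

lemma intervalIntegrable_inv_R {m : ℝ} (hm : 0 < m)
    (hR : ∀ t ∈ Set.Ioo (0 : ℝ) 1, m * √(t * (1 - t)) ≤ ‖R E F (a + t * (b - a))‖) :
    IntervalIntegrable (fun t : ℝ => 1 / R E F (a + t * (b - a))) MeasureTheory.volume 0 1 := by
  refine (intervalIntegrable_inv_sqrt.const_mul m⁻¹).mono_fun ?_ ?_
  · have : Measurable (fun t : ℝ => R E F (a + t * (b - a))) := measurable_R.comp (by fun_prop)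
    exact (measurable_const.div this).aestronglyMeasurable
  · rw [Set.uIoc_of_le zero_le_one]
    have h1 : ∀ᵐ t : ℝ ∂MeasureTheory.volume.restrict (Set.Ioc (0 : ℝ) 1), t ≠ 1 :=
      MeasureTheory.ae_restrict_of_ae (MeasureTheory.Measure.ae_ne _ 1)
    filter_upwards [h1, MeasureTheory.ae_restrict_mem measurableSet_Ioc] with t ht1 ht
    have h0 : 0 < t := ht.1
    have h2 : 0 < 1 - t := sub_pos.2 (lt_of_le_of_ne ht.2 ht1)
    have h3 : 0 < √(t * (1 - t)) := Real.sqrt_pos.2 (mul_pos h0 h2)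
    have h4 := hR t ⟨h0, by linarith⟩
    rw [norm_div, norm_one, Real.norm_of_nonneg (by positivity)]
    rw [show m⁻¹ * (1 / √(t * (1 - t))) = 1 / (m * √(t * (1 - t))) by field_simp]
    exact one_div_le_one_div_of_le (by positivity) h4

namespace Admissible

lemma intervalIntegrable_Sigma1 (h : Admissible E F) :
    IntervalIntegrable (fun t : ℝ => 1 / R E F (E + t * (F - E))) MeasureTheory.volume 0 1 := by
  have hE := h.imE
  have hF := h.imF
  have hn : 0 < ‖F - E‖ := norm_pos_iff.2 h.sub_ne_zero
  refine intervalIntegrable_inv_R (m := √(‖F - E‖ * ‖F - E‖ * (E.im * F.im)))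
    (Real.sqrt_pos.2 (by positivity)) fun t ⟨h0, h1⟩ => ?_
  have him : 0 < (E + t * (F - E)).im := by
    simp; nlinarith
  have b1 : E.im ≤ ‖E + t * (F - E) - conj E‖ := by
    refine le_trans ?_ (Complex.abs_im_le_norm _)
    rw [Complex.sub_im, Complex.conj_im]
    exact le_trans (by linarith) (le_abs_self _)
  have b2 : F.im ≤ ‖E + t * (F - E) - conj F‖ := by
    refine le_trans ?_ (Complex.abs_im_le_norm _)
    rw [Complex.sub_im, Complex.conj_im]
    exact le_trans (by linarith) (le_abs_self _)
  have e1 : ‖E + t * (F - E) - E‖ = t * ‖F - E‖ := by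
    rw [add_sub_cancel_left, norm_mul, Complex.norm_real, Real.norm_of_nonneg h0.le]
  have e2 : ‖E + t * (F - E) - F‖ = (1 - t) * ‖F - E‖ := by
    rw [show E + t * (F - E) - F = ((t - 1 : ℝ) : ℂ) * (F - E) by push_cast; ring, norm_mul,
      Complex.norm_real, Real.norm_of_nonpos (by linarith)]
    ring
  rw [norm_R, e1, e2, ← Real.sqrt_mul (by positivity)]
  refine Real.sqrt_le_sqrt ?_
  have h2 : 0 < 1 - t := by linarith
  calc _ = t * ‖F - E‖ * ((1 - t) * ‖F - E‖) * (E.im * F.im) := by ring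
    _ ≤ _ := by gcongr

lemma intervalIntegrable_SigmaF (h : Admissible E F) :
    IntervalIntegrable (fun t : ℝ => 1 / R E F (F + t * (conj F - F))) MeasureTheory.volume 0 1 := by
  have hF := h.imF
  have hd := sub_pos.2 h.re_lt
  have hn : ‖conj F - F‖ = 2 * F.im := by
    rw [show conj F - F = ((-(2 * F.im) : ℝ) : ℂ) * Complex.I by
      apply Complex.ext <;> simp; ring, norm_mul, Complex.norm_real, Complex.norm_I,
      Real.norm_of_nonpos (by linarith)]
    ring
  refine intervalIntegrable_inv_R
    (m := √(2 * F.im * (2 * F.im) * ((F.re - E.re) * (F.re - E.re))))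
    (Real.sqrt_pos.2 (by positivity)) fun t ⟨h0, h1⟩ => ?_
  have b1 : F.re - E.re ≤ ‖F + t * (conj F - F) - conj E‖ := by
    have e : (F + t * (conj F - F) - conj E).re = F.re - E.re := by simp
    exact (e.symm.le.trans (le_abs_self _)).trans (Complex.abs_re_le_norm _)
  have b2 : F.re - E.re ≤ ‖F + t * (conj F - F) - E‖ := by
    have e : (F + t * (conj F - F) - E).re = F.re - E.re := by simp
    exact (e.symm.le.trans (le_abs_self _)).trans (Complex.abs_re_le_norm _)
  have e1 : ‖F + t * (conj F - F) - F‖ = t * (2 * F.im) := by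
    rw [add_sub_cancel_left, norm_mul, Complex.norm_real, Real.norm_of_nonneg h0.le, hn]
  have e2 : ‖F + t * (conj F - F) - conj F‖ = (1 - t) * (2 * F.im) := by
    rw [show F + t * (conj F - F) - conj F = ((t - 1 : ℝ) : ℂ) * (conj F - F) by
      push_cast; ring, norm_mul, Complex.norm_real, Real.norm_of_nonpos (by linarith), hn]
    ring
  rw [norm_R, e1, e2, ← Real.sqrt_mul (by positivity)]
  refine Real.sqrt_le_sqrt ?_
  have h2 : 0 < 1 - t := by linarith
  calc _ = (F.re - E.re) * (t * (2 * F.im)) * ((F.re - E.re) * ((1 - t) * (2 * F.im))) := by ring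
    _ ≤ _ := by gcongr

/-- If the real part of `R` vanished, `R ^ 2` would be real; on this vertical segment that happens
only at the real point, where `R > 0`. The real part thus has no zero and keeps the sign it has
there. -/
lemma re_R_pos (h : Admissible E F) {y : ℝ} (hy : y ∈ Set.Ioo (-F.im) F.im) :
    0 < (R E F (F.re + y * Complex.I)).re := by
  have hE := h.imE
  have hd := sub_pos.2 h.re_lt
  have h0mem : (0 : ℝ) ∈ Set.Ioo (-F.im) F.im := ⟨by linarith [h.imF], h.imF⟩
  have hcont : ContinuousOn (fun y : ℝ => (R E F (F.re + y * Complex.I)).re)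
      (Set.Ioo (-F.im) F.im) := by
    intro y hy
    have hd : DifferentiableAt ℂ (R E F) (F.re + y * Complex.I) := by
      refine differentiableAt_R (fun hz => ?_) (fun hz => ?_)
      · have := ((mem_Sigma1 h).1 hz).1
        simp [lineForm] at this
        nlinarith [hy.1, hy.2]
      · have := ((mem_Sigma1 h).1 (conj_mem_Sigma1.2 hz)).1
        simp [lineForm] at this
        nlinarith [hy.1, hy.2]
    have hin : ContinuousAt (fun y : ℝ => (F.re + y * Complex.I : ℂ)) y := by fun_prop
    exact (Complex.continuous_re.continuousAt.comp
      (ContinuousAt.comp (f := fun y : ℝ => (F.re + y * Complex.I : ℂ)) hd.continuousAt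
        hin)).continuousWithinAt
  obtain ⟨p, hp, hRp⟩ := R_ofReal_pos h.imE.ne' h.imF.ne' F.re
  have hne : ∀ y ∈ Set.Ioo (-F.im) F.im, (R E F (F.re + y * Complex.I)).re ≠ 0 := by
    intro y hy h0
    rcases eq_or_ne y 0 with rfl | hy0
    · rw [Complex.ofReal_zero, zero_mul, add_zero, hRp, Complex.ofReal_re] at h0
      exact hp.ne' h0
    · have h1 : (R E F (F.re + y * Complex.I) ^ 2).im = 0 := by
        rw [pow_two, Complex.mul_im, h0]; ring
      have e : (R E F (F.re + y * Complex.I)) ^ 2 = ((F.im ^ 2 - y ^ 2 : ℝ) : ℂ) *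
          (((F.re - E.re) ^ 2 - y ^ 2 + E.im ^ 2 : ℝ) + ((2 * (F.re - E.re) * y : ℝ) : ℂ) *
            Complex.I) := by
        rw [R_sq]
        apply Complex.ext
        · simp [pow_two]; ring
        · simp [pow_two]; ring
      rw [e, Complex.im_ofReal_mul, Complex.add_im, Complex.ofReal_im, Complex.im_ofReal_mul,
        Complex.I_im, mul_one, zero_add] at h1
      rcases mul_eq_zero.1 h1 with h1 | h1
      · nlinarith [hy.1, hy.2, mul_pos (sub_pos.2 hy.2) (neg_lt_iff_pos_add'.1 hy.1)]
      · exact mul_ne_zero (by positivity) hy0 h1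
  by_contra! hneg
  have h1 := isPreconnected_Ioo.intermediate_value hy h0mem hcont
  have h2 : (0 : ℝ) ∈ Set.Icc (R E F (F.re + y * Complex.I)).re
      (R E F (F.re + (0 : ℝ) * Complex.I)).re := by
    refine ⟨hneg, ?_⟩
    rw [Complex.ofReal_zero, zero_mul, add_zero, hRp, Complex.ofReal_re]
    exact hp.le
  obtain ⟨x, hx, hx0⟩ := h1 h2
  exact hne x hx hx0

end Admissible

lemma segInt_symm (f : ℂ → ℂ) (a b : ℂ) : segInt f b a = -segInt f a b := by
  have := intervalIntegral.integral_comp_sub_left (a := 0) (b := 1)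
    (fun t : ℝ => f (a + t * (b - a))) 1
  rw [sub_zero, sub_self] at this
  rw [segInt, segInt, ← this, ← neg_sub b a, neg_mul]
  congr 2
  refine intervalIntegral.integral_congr fun t _ => ?_
  congr 1
  push_cast; ring

lemma conj_segInt (f : ℂ → ℂ) (a b : ℂ) :
    conj (segInt f a b) = segInt (fun z => conj (f (conj z))) (conj a) (conj b) := by
  rw [segInt, segInt, map_mul, map_sub, intervalIntegral.integral_of_le zero_le_one,
    intervalIntegral.integral_of_le zero_le_one, ← integral_conj]
  simp

lemma segInt_const_mul (c : ℂ) (f : ℂ → ℂ) (a b : ℂ) :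
    segInt (fun z => c * f z) a b = c * segInt f a b := by
  rw [segInt, segInt, intervalIntegral.integral_const_mul]
  ring

namespace Admissible

/-- The period of `dk / R` along the segment from `conj F` to `F` is `i q` with `q > 0`. -/
lemma exists_period (h : Admissible E F) :
    ∃ q : ℝ, 0 < q ∧ segInt (fun z => 1 / R E F z) (conj F) F = q * Complex.I := by
  have hint := h.intervalIntegrable_SigmaF
  set J : ℂ := ∫ t in (0 : ℝ)..1, 1 / R E F (F + t * (conj F - F)) with hJ
  have hJre : 0 < J.re := by
    have e : J.re = ∫ t in (0 : ℝ)..1, (1 / R E F (F + t * (conj F - F))).re :=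
      (Complex.reCLM.intervalIntegral_comp_comm hint).symm
    rw [e]
    refine intervalIntegral.intervalIntegral_pos_of_pos_on ?_ (fun t ht => ?_) one_pos
    · exact ⟨hint.1.re, hint.2.re⟩
    · have hF := h.imF
      have e2 : F + t * (conj F - F) = (F.re : ℂ) + ((F.im * (1 - 2 * t) : ℝ) : ℂ) * Complex.I := by
        apply Complex.ext
        · simp
        · simp; ring
      have h1 := h.re_R_pos (y := F.im * (1 - 2 * t)) ⟨by nlinarith [ht.1, ht.2], by
        nlinarith [ht.1, ht.2]⟩
      rw [e2, one_div, Complex.inv_re]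
      exact div_pos h1 (Complex.normSq_pos.2 fun h0 => h1.ne' (by rw [h0]; simp))
  have hS : segInt (fun z => 1 / R E F z) F (conj F) = (conj F - F) * J := rfl
  -- Reflection reverses the vertical path and fixes the integrand, so the period is purely
  -- imaginary; its sign comes from `re_R_pos`.
  have hconj : conj (segInt (fun z => 1 / R E F z) F (conj F)) =
      -segInt (fun z => 1 / R E F z) F (conj F) := by
    rw [conj_segInt, Complex.conj_conj, ← segInt_symm]
    congr 1
    funext z
    rw [map_div₀, conj_R_conj, map_one]
  have hJim : conj J = J := by
    rw [hS, map_mul, map_sub, Complex.conj_conj, ← neg_mul, neg_sub] at hconj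
    refine mul_left_cancel₀ (?_ : F - conj F ≠ 0) hconj
    intro h0
    have := congrArg Complex.im h0
    simp at this
    linarith [h.imF]
  refine ⟨2 * F.im * J.re, by have := h.imF; positivity, ?_⟩
  rw [segInt_symm, hS]
  have h1 : J = (J.re : ℂ) := (Complex.conj_eq_iff_re.1 hJim).symm
  rw [h1, Complex.ofReal_re]
  apply Complex.ext
  · simp
  · simp; ring

end Admissible

end SolitonGas

namespace SolitonGas

variable {E F k z a b : ℂ} {A : ℂ → ℂ}

/-! ### Boundary values of the Abel integral -/

namespace Admissible

lemma E_ne_F (h : Admissible E F) : E ≠ F := fun h0 => h.sub_ne_zero (by simp [h0])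

lemma E_ne_conjE (h : Admissible E F) : E ≠ conj E := fun h0 => by
  have := congrArg Complex.im h0
  simp at this
  linarith [h.imE]

lemma F_ne_conjF (h : Admissible E F) : F ≠ conj F := fun h0 => by
  have := congrArg Complex.im h0
  simp at this
  linarith [h.imF]

lemma E_ne_conjF (h : Admissible E F) : E ≠ conj F := fun h0 => by
  have := congrArg Complex.im h0
  simp at this
  linarith [h.imF, h.imE]

lemma F_ne_conjE (h : Admissible E F) : F ≠ conj E := fun h0 => by
  have := congrArg Complex.im h0
  simp at this
  linarith [h.imF, h.imE]

lemma conjE_ne_conjF (h : Admissible E F) : conj E ≠ conj F := fun h0 =>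
  h.E_ne_F ((starRingEnd ℂ).injective h0)

/-- Each endpoint is a simple root of `R ^ 2`, and the other three factors stay away from zero
nearby. -/
lemma norm_omegaHat_le (h : Admissible E F) {p : ℂ} (hp : p ∈ endpoints E F) :
    ∃ M, ∀ᶠ k in 𝓝 p, ‖omegaHat E F k‖ ≤ M / √‖k - p‖ := by
  have key : ∀ p q₁ q₂ q₃ : ℂ, p ≠ q₁ → p ≠ q₂ → p ≠ q₃ →
      (∀ k, ‖R E F k‖ = √(‖k - p‖ * (‖k - q₁‖ * (‖k - q₂‖ * ‖k - q₃‖)))) →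
      ∃ M, ∀ᶠ k in 𝓝 p, ‖omegaHat E F k‖ ≤ M / √‖k - p‖ := by
    intro p q₁ q₂ q₃ h1 h2 h3 hR
    set g : ℂ → ℝ := fun k => √(‖k - q₁‖ * (‖k - q₂‖ * ‖k - q₃‖))
    have hg : ContinuousAt g p := by fun_prop
    have hgp : 0 < g p := Real.sqrt_pos.2 (by
      have := norm_pos_iff.2 (_root_.sub_ne_zero.2 h1)
      have := norm_pos_iff.2 (_root_.sub_ne_zero.2 h2)
      have := norm_pos_iff.2 (_root_.sub_ne_zero.2 h3)
      positivity)
    set C := ‖(2 * segInt (fun z => 1 / R E F z) (conj F) F)⁻¹‖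
    refine ⟨C / (g p / 2), ?_⟩
    filter_upwards [hg.eventually_const_lt (half_lt_self hgp)] with k hk
    rw [omegaHat, norm_mul, norm_div, norm_one, hR, Real.sqrt_mul (norm_nonneg _), div_div,
      mul_one_div]
    rcases (Real.sqrt_nonneg ‖k - p‖).eq_or_lt with h0 | h0
    · simp [← h0]
    · change C / (√‖k - p‖ * g k) ≤ _
      rw [mul_comm]
      gcongr
  rcases hp with rfl | rfl | rfl | rfl
  · exact key _ _ _ _ h.E_ne_F h.E_ne_conjE h.E_ne_conjF fun k => by rw [norm_R]; ring_nf
  · exact key _ _ _ _ h.E_ne_F.symm h.F_ne_conjE h.F_ne_conjF fun k => by rw [norm_R]; ring_nf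
  · exact key _ _ _ _ h.E_ne_conjE.symm h.F_ne_conjE.symm h.conjE_ne_conjF fun k => by
      rw [norm_R]; ring_nf
  · exact key _ _ _ _ h.E_ne_conjF.symm h.F_ne_conjF.symm h.conjE_ne_conjF.symm fun k => by
      rw [norm_R]; ring_nf

lemma exists_tendsto_endpoint (h : Admissible E F)
    (hA : ∀ k ∉ contour E F, HasDerivAt A (omegaHat E F k) k) {C : Set ℂ} (hCo : IsOpen C)
    (hC : Convex ℝ C) (hCc : C ⊆ (contour E F)ᶜ) {p : ℂ} (hp : p ∈ endpoints E F)
    (hpC : p ∈ closure C) : ∃ l, Tendsto A (𝓝[C] p) (𝓝 l) := by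
  obtain ⟨M, hM⟩ := h.norm_omegaHat_le hp
  exact exists_tendsto_of_norm_deriv_le hCo hC (fun k hk => hA k (hCc hk)) hpC
    (fun hpC => hCc hpC (endpoints_subset_contour hp)) (nhdsWithin_le_nhds hM)

lemma notMem_Sigma2_of_im_nonneg (h : Admissible E F) (hk : 0 ≤ k.im) : k ∉ Sigma2 E F := fun hz =>
  absurd (h.im_pos_of_mem_Sigma1 (conj_mem_Sigma1.2 hz)) (by simpa using hk)

lemma notMem_Sigma1_of_im_nonpos (h : Admissible E F) (hk : k.im ≤ 0) : k ∉ Sigma1 E F := fun hz =>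
  absurd (h.im_pos_of_mem_Sigma1 hz) (by simpa using hk)

lemma isClosed_Sigma1 : IsClosed (Sigma1 E F) := (isCompact_segment _ _).isClosed

lemma isClosed_Sigma2 : IsClosed (Sigma2 E F) := (isCompact_segment _ _).isClosed

/-- One function, obtained by replacing the cut factor of `R` by `halfRt`, continues the
differential from the left and its negative from the right. The last clause says that the integrand
used in the definitions is the left one. -/
lemma continuation_Sigma1 (h : Admissible E F) (hz : z ∈ openSegment ℝ E F) :
    ∃ ft : ℂ → ℂ, (∀ᶠ k in 𝓝 z, DifferentiableAt ℂ ft k) ∧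
      (∀ᶠ k in 𝓝 z, k ∈ regionTop E F → omegaHat E F k = ft k) ∧
      (∀ᶠ k in 𝓝 z, k ∈ regionIn E F → omegaHat E F k = -ft k) ∧ omegaHat E F z = ft z := by
  set c := (2 * segInt (fun z => 1 / R E F z) (conj F) F)⁻¹ with hc
  have hz2 := h.notMem_Sigma2_of_im_nonneg (mem_openSegment_Sigma1 h hz).2.2.2.le
  have hzE : lineForm E F E = 0 := lineForm_left
  refine ⟨fun k => c * (1 / (halfRt E F k * halfR (conj F) (conj E) k)), ?_, ?_, ?_, ?_⟩
  · filter_upwards [eventually_differentiableAt_halfRt hz h.E_ne_F,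
      isClosed_Sigma2.isOpen_compl.mem_nhds hz2] with k hk hk2
    refine DifferentiableAt.mul (by fun_prop) (DifferentiableAt.div (by fun_prop)
      (hk.1.mul (differentiableAt_halfR hk2)) (mul_ne_zero hk.2 (halfR_ne_zero ?_ ?_)))
    · rintro rfl; exact hk2 (left_mem_segment ℝ _ _)
    · rintro rfl; exact hk2 (right_mem_segment ℝ _ _)
  · refine Eventually.of_forall fun k hk => ?_
    rw [omegaHat, R_eq, halfR_eq_left]
    rw [im_sub_div_Sigma1, hzE, sub_zero]
    exact div_pos hk h.normSq_pos
  · refine Eventually.of_forall fun k hk => ?_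
    rw [omegaHat, R_eq, halfR_eq_right]
    · rw [neg_mul, one_div_neg_eq_neg_one_div, mul_neg]
    rw [im_sub_div_Sigma1, hzE, sub_zero]
    exact div_neg_of_neg_of_pos hk.1.1 h.normSq_pos
  · rw [omegaHat, R_eq, halfR_eq_openSegment hz h.E_ne_F]

lemma continuation_Sigma2 (h : Admissible E F) (hz : z ∈ openSegment ℝ (conj F) (conj E)) :
    ∃ ft : ℂ → ℂ, (∀ᶠ k in 𝓝 z, DifferentiableAt ℂ ft k) ∧
      (∀ᶠ k in 𝓝 z, k ∈ regionBot E F → omegaHat E F k = ft k) ∧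
      (∀ᶠ k in 𝓝 z, k ∈ regionIn E F → omegaHat E F k = -ft k) ∧ omegaHat E F z = ft z := by
  set c := (2 * segInt (fun z => 1 / R E F z) (conj F) F)⁻¹ with hc
  have hz2 := h.notMem_Sigma1_of_im_nonpos (k := z) (by
    simpa using (mem_openSegment_Sigma1 h (mem_openSegment_Sigma2.1 hz)).2.2.2.le)
  have hzE : lineForm E F (conj (conj F)) = 0 := by rw [Complex.conj_conj, lineForm_right]
  refine ⟨fun k => c * (1 / (halfR E F k * halfRt (conj F) (conj E) k)), ?_, ?_, ?_, ?_⟩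
  · filter_upwards [eventually_differentiableAt_halfRt hz h.conjE_ne_conjF.symm,
      isClosed_Sigma1.isOpen_compl.mem_nhds hz2] with k hk hk2
    refine DifferentiableAt.mul (by fun_prop) (DifferentiableAt.div (by fun_prop)
      ((differentiableAt_halfR hk2).mul hk.1) (mul_ne_zero (halfR_ne_zero ?_ ?_) hk.2))
    · rintro rfl; exact hk2 (left_mem_segment ℝ _ _)
    · rintro rfl; exact hk2 (right_mem_segment ℝ _ _)
  · refine Eventually.of_forall fun k hk => ?_
    rw [omegaHat, R_eq, halfR_eq_left (a := conj F)]
    rw [im_sub_div_Sigma2, hzE, sub_zero]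
    exact div_pos hk h.normSq_pos
  · refine Eventually.of_forall fun k hk => ?_
    rw [omegaHat, R_eq, halfR_eq_right (a := conj F)]
    · rw [mul_neg, one_div_neg_eq_neg_one_div, mul_neg]
    rw [im_sub_div_Sigma2, hzE, sub_zero]
    exact div_neg_of_neg_of_pos hk.1.2 h.normSq_pos
  · rw [omegaHat, R_eq, halfR_eq_openSegment hz h.conjE_ne_conjF.symm]

lemma differentiableAt_omegaHat_SigmaF (h : Admissible E F) (hz : z ∈ openSegment ℝ F (conj F)) :
    ∀ᶠ k in 𝓝 z, DifferentiableAt ℂ (omegaHat E F) k := by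
  obtain ⟨h0, h1, h2⟩ := (mem_openSegment_SigmaF h.imF).1 hz
  have hlt := h.re_lt
  have z1 : z ∉ Sigma1 E F := fun hz => by
    have := ((mem_Sigma1 h).1 hz).1
    rw [lineForm, h0] at this
    nlinarith
  have z2 : z ∉ Sigma2 E F := fun hz => by
    have := ((mem_Sigma1 h).1 (conj_mem_Sigma1.2 hz)).1
    rw [lineForm, Complex.conj_re, Complex.conj_im, h0] at this
    nlinarith
  filter_upwards [isClosed_Sigma1.isOpen_compl.mem_nhds z1,
    isClosed_Sigma2.isOpen_compl.mem_nhds z2] with k k1 k2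
  unfold omegaHat
  refine DifferentiableAt.mul (by fun_prop) (DifferentiableAt.div (by fun_prop)
    (differentiableAt_R k1 k2) (R_ne_zero fun hk => ?_))
  rcases hk with rfl | rfl | rfl | rfl
  · exact k1 (left_mem_segment ℝ _ _)
  · exact k1 (right_mem_segment ℝ _ _)
  · exact k2 (right_mem_segment ℝ _ _)
  · exact k2 (left_mem_segment ℝ _ _)

end Admissible

lemma mem_segment_of_ne_endpoints (hz : z ∈ segment ℝ a b) : z = a ∨ z = b ∨ z ∈ openSegment ℝ a b := by
  by_cases h1 : z = a
  · exact Or.inl h1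
  by_cases h2 : z = b
  · exact Or.inr (Or.inl h2)
  exact Or.inr (Or.inr (mem_openSegment_of_ne_left_right (Ne.symm h1) (Ne.symm h2) hz))

lemma path_mem_segment {t : ℝ} (ht : t ∈ Set.Icc (0 : ℝ) 1) : a + t * (b - a) ∈ segment ℝ a b := by
  rw [segment_eq_image']
  exact ⟨t, ht, by simp⟩

lemma path_mem_openSegment {t : ℝ} (ht : t ∈ Set.Ioo (0 : ℝ) 1) :
    a + t * (b - a) ∈ openSegment ℝ a b := by
  rw [openSegment_eq_image']
  exact ⟨t, ht, by simp⟩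

lemma exists_path_of_mem_segment (hz : z ∈ segment ℝ a b) :
    ∃ t ∈ Set.Icc (0 : ℝ) 1, z = a + t * (b - a) := by
  rw [segment_eq_image'] at hz
  obtain ⟨t, ht, rfl⟩ := hz
  exact ⟨t, ht, by simp⟩

lemma eventually_path_mem_closure {C : Set ℂ} (hC : segment ℝ a b ⊆ closure C) {t₀ : ℝ}
    (ht : t₀ ∈ Set.Ioo (0 : ℝ) 1) : ∀ᶠ t : ℝ in 𝓝 t₀, a + t * (b - a) ∈ closure C := by
  filter_upwards [isOpen_Ioo.mem_nhds ht] with t ht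
  exact hC (path_mem_segment ⟨ht.1.le, ht.2.le⟩)

lemma continuousOn_path {C : Set ℂ} (hC : segment ℝ a b ⊆ closure C)
    (hlim : ∀ z ∈ segment ℝ a b, ∃ l, Tendsto A (𝓝[C] z) (𝓝 l)) :
    ContinuousOn (fun t : ℝ => extendFrom C A (a + t * (b - a))) (Set.Icc 0 1) :=
  (continuousOn_extendFrom hC hlim).comp (by fun_prop) fun _ ht => path_mem_segment ht

lemma eq_of_hasDerivAt_zero {u : ℝ → ℂ} (hc : ContinuousOn u (Set.Icc 0 1))
    (hd : ∀ t ∈ Set.Ioo (0 : ℝ) 1, HasDerivAt u 0 t) {t : ℝ} (ht : t ∈ Set.Icc (0 : ℝ) 1) :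
    u t = u 0 := by
  have := intervalIntegral.integral_eq_sub_of_hasDerivAt_of_le ht.1
    (hc.mono (Set.Icc_subset_Icc_right ht.2)) (fun x hx => hd x ⟨hx.1, hx.2.trans_le ht.2⟩)
    intervalIntegrable_const
  simp at this
  exact (sub_eq_zero.1 this.symm)

/-- The data of an Abel integral at the contour: the limits from the five regions. -/
structure AbelLimits (E F : ℂ) (A : ℂ → ℂ) : Prop where
  top : ∀ z ∈ Sigma1 E F, ∃ l, Tendsto A (𝓝[regionTop E F] z) (𝓝 l)
  right : ∀ z ∈ SigmaF F, ∃ l, Tendsto A (𝓝[regionRight F] z) (𝓝 l)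
  bot : ∀ z ∈ Sigma2 E F, ∃ l, Tendsto A (𝓝[regionBot E F] z) (𝓝 l)
  left : ∀ z ∈ ({E, conj E} : Set ℂ), ∃ l, Tendsto A (𝓝[regionLeft E] z) (𝓝 l)
  inn : ∀ z ∈ contour E F, ∃ l, Tendsto A (𝓝[regionIn E F] z) (𝓝 l)

namespace Admissible

/-- At endpoints the inverse square root bound gives the limit; at interior points of the segments
it comes from analytic continuation of the differential. -/
lemma abelLimits (h : Admissible E F)
    (hA : ∀ k ∉ contour E F, HasDerivAt A (omegaHat E F k) k) : AbelLimits E F A := by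
  have hTop := fun {p} => h.exists_tendsto_endpoint hA isOpen_regionTop convex_regionTop
    h.regionTop_subset (p := p)
  have hBot := fun {p} => h.exists_tendsto_endpoint hA isOpen_regionBot convex_regionBot
    h.regionBot_subset (p := p)
  have hRight := fun {p} => h.exists_tendsto_endpoint hA isOpen_regionRight convex_regionRight
    h.regionRight_subset (p := p)
  have hLeft := fun {p} => h.exists_tendsto_endpoint hA isOpen_regionLeft convex_regionLeft
    h.regionLeft_subset (p := p)
  have hIn := fun {p} => h.exists_tendsto_endpoint hA isOpen_regionIn convex_regionIn
    h.regionIn_subset (p := p)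
  have eE : E ∈ endpoints E F := by simp [endpoints]
  have eF : F ∈ endpoints E F := by simp [endpoints]
  have eE' : conj E ∈ endpoints E F := by simp [endpoints]
  have eF' : conj F ∈ endpoints E F := by simp [endpoints]
  have hTopS := h.Sigma1_subset_closure_top
  have hBotS := h.Sigma2_subset_closure_bot
  have hRightS := h.SigmaF_subset_closure_right
  refine ⟨fun z hz => ?_, fun z hz => ?_, fun z hz => ?_, fun z hz => ?_, fun z hz => ?_⟩
  · have hz' := hTopS hz
    rcases mem_segment_of_ne_endpoints hz with rfl | rfl | ho
    · exact hTop eE hz'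
    · exact hTop eF hz'
    · obtain ⟨ft, h1, h2, -, -⟩ := h.continuation_Sigma1 ho
      exact exists_tendsto_of_continuation isOpen_regionTop convex_regionTop
        (fun k hk => hA k (h.regionTop_subset hk)) h1 h2
  · have hz' := hRightS hz
    rcases mem_segment_of_ne_endpoints hz with rfl | rfl | ho
    · exact hRight eF hz'
    · exact hRight eF' hz'
    · exact exists_tendsto_of_continuation isOpen_regionRight convex_regionRight
        (fun k hk => hA k (h.regionRight_subset hk)) (h.differentiableAt_omegaHat_SigmaF ho)
        (Eventually.of_forall fun _ _ => rfl)
  · have hz' := hBotS hz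
    rcases mem_segment_of_ne_endpoints hz with rfl | rfl | ho
    · exact hBot eF' hz'
    · exact hBot eE' hz'
    · obtain ⟨ft, h1, h2, -, -⟩ := h.continuation_Sigma2 ho
      exact exists_tendsto_of_continuation isOpen_regionBot convex_regionBot
        (fun k hk => hA k (h.regionBot_subset hk)) h1 h2
  · rcases hz with rfl | rfl
    · exact hLeft eE (closure_mono Set.inter_subset_right h.E_mem_closure_top_left)
    · exact hLeft eE' (closure_mono Set.inter_subset_right h.conjE_mem_closure_bot_left)
  · by_cases hp : z ∈ endpoints E F
    · refine hIn hp ?_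
      rcases hz with (hz | hz) | hz
      · exact h.Sigma1_subset_closure_in hz
      · exact h.Sigma2_subset_closure_in hz
      · exact h.SigmaF_subset_closure_in hz
    · have hAI : ∀ k ∈ regionIn E F, HasDerivAt A (omegaHat E F k) k :=
        fun k hk => hA k (h.regionIn_subset hk)
      rcases mem_contour_cases hz hp with ho | ho | ho
      · obtain ⟨ft, h1, -, h3, -⟩ := h.continuation_Sigma1 ho
        exact exists_tendsto_of_continuation (ft := fun k => -ft k) isOpen_regionIn convex_regionIn
          hAI (h1.mono fun k hk => hk.neg) h3
      · exact exists_tendsto_of_continuation isOpen_regionIn convex_regionIn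
          hAI (h.differentiableAt_omegaHat_SigmaF ho) (Eventually.of_forall fun _ _ => rfl)
      · obtain ⟨ft, h1, -, h3, -⟩ := h.continuation_Sigma2 ho
        exact exists_tendsto_of_continuation (ft := fun k => -ft k) isOpen_regionIn convex_regionIn
          hAI (h1.mono fun k hk => hk.neg) h3

end Admissible

lemma extendFrom_eq_extendFrom {C D : Set ℂ} (hz : z ∈ closure (C ∩ D))
    (hC : ∃ l, Tendsto A (𝓝[C] z) (𝓝 l)) (hD : ∃ l, Tendsto A (𝓝[D] z) (𝓝 l)) :
    extendFrom C A z = extendFrom D A z := by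
  have := mem_closure_iff_nhdsWithin_neBot.1 hz
  exact tendsto_nhds_unique
    ((tendsto_extendFrom hC).mono_left (nhdsWithin_mono z Set.inter_subset_left))
    ((tendsto_extendFrom hD).mono_left (nhdsWithin_mono z Set.inter_subset_right))

/-- The relations between the boundary values of the Abel integral. -/
structure AbelJumps (E F : ℂ) (A : ℂ → ℂ) : Prop where
  sigma1 : ∀ z ∈ Sigma1 E F, extendFrom (regionTop E F) A z = -extendFrom (regionIn E F) A z
  sigmaF : ∀ z ∈ SigmaF F,
    extendFrom (regionRight F) A z = extendFrom (regionIn E F) A z + tau E F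
  sigma2 : ∀ z ∈ Sigma2 E F, extendFrom (regionBot E F) A z = -extendFrom (regionIn E F) A z - 1
  atF : extendFrom (regionTop E F) A F = tau E F / 2
  atF' : extendFrom (regionBot E F) A (conj F) = tau E F / 2 - 1 / 2
  atE' : extendFrom (regionLeft E) A (conj E) = -1 / 2

namespace Admissible

/-- Along `Sigma1` and `Sigma2` the derivatives of the two boundary values are opposite, along
`SigmaF` they are equal, so a sum or a difference is constant. The constants follow by travelling
along the contour: `0` at `E`, then `± τ / 2` on the two sides at `F`, hence the difference `τ` on
`SigmaF`. A half period further, at `conj F`, the values are `τ / 2 - 1 / 2` and `-τ / 2 - 1 / 2`,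
with sum `-1`. -/
lemma abelJumps (h : Admissible E F) (hA : IsAbelIntegral E F A) : AbelJumps E F A := by
  have hlim := h.abelLimits hA.1
  obtain ⟨q, hq, hper⟩ := h.exists_period
  have hper0 : segInt (fun z => 1 / R E F z) (conj F) F ≠ 0 := by
    rw [hper]; exact mul_ne_zero (by exact_mod_cast hq.ne') Complex.I_ne_zero
  have hS1 : Sigma1 E F ⊆ contour E F := fun z hz => Or.inl (Or.inl hz)
  have hS2 : Sigma2 E F ⊆ contour E F := fun z hz => Or.inl (Or.inr hz)
  have hSF : SigmaF F ⊆ contour E F := fun z hz => Or.inr hz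
  have mE : E ∈ Sigma1 E F := left_mem_segment ℝ _ _
  have mF : F ∈ Sigma1 E F := right_mem_segment ℝ _ _
  have mF1 : F ∈ SigmaF F := left_mem_segment ℝ _ _
  have mF2 : conj F ∈ SigmaF F := right_mem_segment ℝ _ _
  have mF3 : conj F ∈ Sigma2 E F := left_mem_segment ℝ _ _
  have mE3 : conj E ∈ Sigma2 E F := right_mem_segment ℝ _ _
  -- values at `E`
  have topE : extendFrom (regionTop E F) A E = 0 := extendFrom_eq (h.Sigma1_subset_closure_top mE)
    (hA.2.mono_left (nhdsWithin_mono _ h.regionTop_subset))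
  have inE : extendFrom (regionIn E F) A E = 0 := extendFrom_eq (h.Sigma1_subset_closure_in mE)
    (hA.2.mono_left (nhdsWithin_mono _ h.regionIn_subset))
  -- derivatives along the segments
  have dTop : ∀ t ∈ Set.Ioo (0 : ℝ) 1, HasDerivAt
      (fun t : ℝ => extendFrom (regionTop E F) A (E + t * (F - E)))
      ((F - E) * omegaHat E F (E + t * (F - E))) t := fun t ht => by
    obtain ⟨ft, h1, h2, -, h4⟩ := h.continuation_Sigma1 (path_mem_openSegment ht)
    rw [h4]
    exact hasDerivAt_extendFrom isOpen_regionTop convex_regionTop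
      (fun k hk => hA.1 k (h.regionTop_subset hk)) h1 h2
      (eventually_path_mem_closure h.Sigma1_subset_closure_top ht)
  have dIn1 : ∀ t ∈ Set.Ioo (0 : ℝ) 1, HasDerivAt
      (fun t : ℝ => extendFrom (regionIn E F) A (E + t * (F - E)))
      (-((F - E) * omegaHat E F (E + t * (F - E)))) t := fun t ht => by
    obtain ⟨ft, h1, -, h3, h4⟩ := h.continuation_Sigma1 (path_mem_openSegment ht)
    rw [h4, ← mul_neg]
    exact hasDerivAt_extendFrom (ft := fun k => -ft k) isOpen_regionIn convex_regionIn
      (fun k hk => hA.1 k (h.regionIn_subset hk)) (h1.mono fun k hk => hk.neg) h3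
      (eventually_path_mem_closure h.Sigma1_subset_closure_in ht)
  have dBot : ∀ t ∈ Set.Ioo (0 : ℝ) 1, HasDerivAt
      (fun t : ℝ => extendFrom (regionBot E F) A (conj F + t * (conj E - conj F)))
      ((conj E - conj F) * omegaHat E F (conj F + t * (conj E - conj F))) t := fun t ht => by
    obtain ⟨ft, h1, h2, -, h4⟩ := h.continuation_Sigma2 (path_mem_openSegment ht)
    rw [h4]
    exact hasDerivAt_extendFrom isOpen_regionBot convex_regionBot
      (fun k hk => hA.1 k (h.regionBot_subset hk)) h1 h2
      (eventually_path_mem_closure h.Sigma2_subset_closure_bot ht)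
  have dIn2 : ∀ t ∈ Set.Ioo (0 : ℝ) 1, HasDerivAt
      (fun t : ℝ => extendFrom (regionIn E F) A (conj F + t * (conj E - conj F)))
      (-((conj E - conj F) * omegaHat E F (conj F + t * (conj E - conj F)))) t := fun t ht => by
    obtain ⟨ft, h1, -, h3, h4⟩ := h.continuation_Sigma2 (path_mem_openSegment ht)
    rw [h4, ← mul_neg]
    exact hasDerivAt_extendFrom (ft := fun k => -ft k) isOpen_regionIn convex_regionIn
      (fun k hk => hA.1 k (h.regionIn_subset hk)) (h1.mono fun k hk => hk.neg) h3
      (eventually_path_mem_closure h.Sigma2_subset_closure_in ht)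
  have dRight : ∀ t ∈ Set.Ioo (0 : ℝ) 1, HasDerivAt
      (fun t : ℝ => extendFrom (regionRight F) A (F + t * (conj F - F)))
      ((conj F - F) * omegaHat E F (F + t * (conj F - F))) t := fun t ht =>
    hasDerivAt_extendFrom isOpen_regionRight convex_regionRight
      (fun k hk => hA.1 k (h.regionRight_subset hk))
      (h.differentiableAt_omegaHat_SigmaF (path_mem_openSegment ht))
      (Eventually.of_forall fun _ _ => rfl)
      (eventually_path_mem_closure h.SigmaF_subset_closure_right ht)
  have dInF : ∀ t ∈ Set.Ioo (0 : ℝ) 1, HasDerivAt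
      (fun t : ℝ => extendFrom (regionIn E F) A (F + t * (conj F - F)))
      ((conj F - F) * omegaHat E F (F + t * (conj F - F))) t := fun t ht =>
    hasDerivAt_extendFrom isOpen_regionIn convex_regionIn
      (fun k hk => hA.1 k (h.regionIn_subset hk))
      (h.differentiableAt_omegaHat_SigmaF (path_mem_openSegment ht))
      (Eventually.of_forall fun _ _ => rfl)
      (eventually_path_mem_closure h.SigmaF_subset_closure_in ht)
  -- continuity along the segments
  have cTop := continuousOn_path h.Sigma1_subset_closure_top hlim.top
  have cIn1 := continuousOn_path h.Sigma1_subset_closure_in fun z hz => hlim.inn z (hS1 hz)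
  have cBot := continuousOn_path h.Sigma2_subset_closure_bot hlim.bot
  have cIn2 := continuousOn_path h.Sigma2_subset_closure_in fun z hz => hlim.inn z (hS2 hz)
  have cRight := continuousOn_path h.SigmaF_subset_closure_right hlim.right
  have cInF := continuousOn_path h.SigmaF_subset_closure_in fun z hz => hlim.inn z (hSF hz)
  -- the first segment
  have sigma1 : ∀ z ∈ Sigma1 E F,
      extendFrom (regionTop E F) A z = -extendFrom (regionIn E F) A z := by
    intro z hz
    obtain ⟨t, ht, rfl⟩ := exists_path_of_mem_segment hz
    have := eq_of_hasDerivAt_zero (cTop.add cIn1) (fun t ht => by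
      simpa using (dTop t ht).add (dIn1 t ht)) ht
    simp only [Pi.add_apply, Complex.ofReal_zero, zero_mul, add_zero, topE, inE] at this
    linear_combination this
  have atF : extendFrom (regionTop E F) A F = tau E F / 2 := by
    have hint : IntervalIntegrable (fun t : ℝ => (F - E) * omegaHat E F (E + t * (F - E)))
        MeasureTheory.volume 0 1 := by
      unfold omegaHat
      exact (h.intervalIntegrable_Sigma1.const_mul _).const_mul _
    have := intervalIntegral.integral_eq_sub_of_hasDerivAt_of_le zero_le_one cTop dTop hint
    rw [intervalIntegral.integral_const_mul] at this
    simp only [Complex.ofReal_one, one_mul, add_sub_cancel, Complex.ofReal_zero, zero_mul,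
      add_zero, topE, sub_zero] at this
    rw [← this, tau]
    have e := segInt_const_mul (2 * segInt (fun z => 1 / R E F z) (conj F) F)⁻¹
      (fun z => 1 / R E F z) E F
    change segInt (omegaHat E F) E F = _ at e
    change segInt (omegaHat E F) E F = _
    rw [e]
    field_simp
  -- the vertical segment
  have rightF : extendFrom (regionRight F) A F = tau E F / 2 := by
    rw [← atF]
    exact (extendFrom_eq_extendFrom h.F_mem_closure_top_right (hlim.top F mF)
      (hlim.right F mF1)).symm
  have inF : extendFrom (regionIn E F) A F = -(tau E F / 2) := by
    rw [← atF, sigma1 F mF, neg_neg]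
  have sigmaF : ∀ z ∈ SigmaF F,
      extendFrom (regionRight F) A z = extendFrom (regionIn E F) A z + tau E F := by
    intro z hz
    obtain ⟨t, ht, rfl⟩ := exists_path_of_mem_segment hz
    have := eq_of_hasDerivAt_zero (cRight.sub cInF) (fun t ht => by
      simpa using (dRight t ht).sub (dInF t ht)) ht
    simp only [Pi.sub_apply, Complex.ofReal_zero, zero_mul, add_zero, rightF, inF] at this
    linear_combination this
  have rightF' : extendFrom (regionRight F) A (conj F) = tau E F / 2 - 1 / 2 := by
    have hint : IntervalIntegrable
        (fun t : ℝ => (conj F - F) * omegaHat E F (F + t * (conj F - F)))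
        MeasureTheory.volume 0 1 := by
      unfold omegaHat
      exact (h.intervalIntegrable_SigmaF.const_mul _).const_mul _
    have := intervalIntegral.integral_eq_sub_of_hasDerivAt_of_le zero_le_one cRight dRight hint
    rw [intervalIntegral.integral_const_mul] at this
    simp only [Complex.ofReal_one, one_mul, add_sub_cancel, Complex.ofReal_zero, zero_mul,
      add_zero, rightF] at this
    have e := segInt_const_mul (2 * segInt (fun z => 1 / R E F z) (conj F) F)⁻¹
      (fun z => 1 / R E F z) F (conj F)
    change segInt (omegaHat E F) F (conj F) = _ at e
    change segInt (omegaHat E F) F (conj F) = _ at this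
    rw [e, segInt_symm _ (conj F) F] at this
    have e2 : (2 * segInt (fun z => 1 / R E F z) (conj F) F)⁻¹ *
        -segInt (fun z => 1 / R E F z) (conj F) F = -1 / 2 := by field_simp
    rw [e2] at this
    linear_combination -this
  -- the third segment
  have atF' : extendFrom (regionBot E F) A (conj F) = tau E F / 2 - 1 / 2 := by
    rw [← rightF']
    exact extendFrom_eq_extendFrom h.conjF_mem_closure_bot_right (hlim.bot _ mF3)
      (hlim.right _ mF2)
  have sigma2 : ∀ z ∈ Sigma2 E F,
      extendFrom (regionBot E F) A z = -extendFrom (regionIn E F) A z - 1 := by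
    intro z hz
    obtain ⟨t, ht, rfl⟩ := exists_path_of_mem_segment hz
    have := eq_of_hasDerivAt_zero (cBot.add cIn2) (fun t ht => by
      simpa using (dBot t ht).add (dIn2 t ht)) ht
    have hF' := sigmaF (conj F) mF2
    rw [rightF'] at hF'
    simp only [Pi.add_apply, Complex.ofReal_zero, zero_mul, add_zero, atF'] at this
    linear_combination this - hF'
  refine ⟨sigma1, sigmaF, sigma2, atF, atF', ?_⟩
  -- At the free end `conj E` both sides of `Sigma2` communicate through `regionLeft`, so the two
  -- values coincide and each is half of their sum `-1`.
  have e1 := extendFrom_eq_extendFrom h.conjE_mem_closure_bot_left (hlim.bot _ mE3)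
    (hlim.left _ (by simp))
  have e2 := extendFrom_eq_extendFrom h.conjE_mem_closure_left_in (hlim.left _ (by simp))
    (hlim.inn _ (hS2 mE3))
  have e3 := sigma2 _ mE3
  rw [← e2, e1] at e3
  linear_combination e3 / 2

end Admissible

end SolitonGas

namespace SolitonGas

/-! ### The Abel integral: existence, symmetry and values on the real axis -/

variable {E F k z : ℂ} {A : ℂ → ℂ}

lemma nhdsWithin_eq_bot_of_notMem_closure {C : Set ℂ} (h : z ∉ closure C) : 𝓝[C] z = ⊥ := by
  rwa [mem_closure_iff_nhdsWithin_neBot, not_neBot] at h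

lemma ofReal_mem_contour (h : Admissible E F) {x : ℝ} : (x : ℂ) ∈ contour E F ↔ x = F.re := by
  have h1 : (x : ℂ) ∉ Sigma1 E F := h.notMem_Sigma1_of_im_nonpos (by simp)
  have h2 : (x : ℂ) ∉ Sigma2 E F := h.notMem_Sigma2_of_im_nonneg (by simp)
  have h3 := mem_SigmaF (k := (x : ℂ)) h.imF
  simp only [contour, Set.mem_union, h1, h2, h3, false_or]
  have := h.imF
  simp
  intro _
  linarith

/-- The point where the segment from `E` to `conj F` crosses the real axis; in particular it is real
and lies strictly between the abscissas of `E` and `F`. -/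
lemma E0_eq (h : Admissible E F) :
    E0 E F = ((E.re * F.im + E.im * F.re) / (E.im + F.im) : ℝ) := by
  have hE := h.imE
  have hF := h.imF
  have hd : E + F - conj E - conj F = 2 * Complex.I * ((E.im + F.im : ℝ) : ℂ) := by
    apply Complex.ext <;> simp; ring
  have hn : E * F - conj E * conj F = 2 * Complex.I * ((E.re * F.im + E.im * F.re : ℝ) : ℂ) := by
    apply Complex.ext <;> simp; ring
  rw [E0, hd, hn, mul_div_mul_left _ _ (by simp)]
  push_cast; ring

lemma E0_re_lt (h : Admissible E F) : (E0 E F).re < F.re := by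
  rw [E0_eq h, Complex.ofReal_re, div_lt_iff₀ (by linarith [h.imE, h.imF])]
  nlinarith [h.imE, h.imF, h.re_lt]

lemma E0_eq_re (h : Admissible E F) : E0 E F = ((E0 E F).re : ℂ) := by
  rw [E0_eq h, Complex.ofReal_re]

lemma E0_notMem_contour (h : Admissible E F) : E0 E F ∉ contour E F := by
  rw [E0_eq_re h, ofReal_mem_contour h]
  exact (E0_re_lt h).ne

namespace Admissible

lemma nhdsWithin_compl_E (h : Admissible E F) : 𝓝[(contour E F)ᶜ] E =
    𝓝[regionTop E F] E ⊔ 𝓝[regionLeft E] E ⊔ 𝓝[regionIn E F] E := by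
  have h1 : 𝓝[regionRight F] E = ⊥ := by
    refine nhdsWithin_eq_bot_of_notMem_closure fun hm => ?_
    have : E ∈ {k : ℂ | F.re ≤ k.re} := closure_minimal (s := regionRight F)
      (fun k (hk : F.re < k.re) => show F.re ≤ k.re from hk.le) (isClosed_le continuous_const Complex.continuous_re) hm
    exact absurd this (not_le.2 h.re_lt)
  have h2 : 𝓝[regionBot E F] E = ⊥ := by
    refine nhdsWithin_eq_bot_of_notMem_closure fun hm => ?_
    have : E ∈ {k : ℂ | 0 ≤ lineForm E F (conj k)} := closure_minimal (fun k (hk : 0 < lineForm E F (conj k)) =>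
      hk.le) (isClosed_le continuous_const continuous_lineForm_conj) hm
    exact absurd this (not_le.2 h.lineForm_conj_left)
  rw [h.compl_contour_eq, nhdsWithin_union, nhdsWithin_union, nhdsWithin_union, nhdsWithin_union,
    h1, h2]
  simp

/-- A primitive exists; what remains is a single limit at `E` from the whole complement. Near `E`
only the top, left and inner regions occur, and their limits agree through the overlaps, so the
common value can be subtracted. -/
lemma exists_isAbelIntegral (h : Admissible E F) : ∃ A, IsAbelIntegral E F A := by
  obtain ⟨A, hA⟩ := exists_isAbelPrimitive h (2 * segInt (fun z => 1 / R E F z) (conj F) F)⁻¹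
  have hl := h.abelLimits (A := A) hA
  have hE1 : E ∈ Sigma1 E F := left_mem_segment _ _ _
  have hEc : E ∈ contour E F := Or.inl (Or.inl hE1)
  have top := hl.top E hE1
  have left := hl.left E (by simp)
  have inn := hl.inn E hEc
  have e1 := extendFrom_eq_extendFrom h.E_mem_closure_top_left top left
  have e2 := extendFrom_eq_extendFrom h.E_mem_closure_left_in left inn
  have t1 := tendsto_extendFrom top
  have t2 := tendsto_extendFrom left
  have t3 := tendsto_extendFrom inn
  refine ⟨fun k => A k - extendFrom (regionTop E F) A E, fun k hk => (hA k hk).sub_const _, ?_⟩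
  rw [h.nhdsWithin_compl_E]
  have : Tendsto A (𝓝[regionTop E F] E ⊔ 𝓝[regionLeft E] E ⊔ 𝓝[regionIn E F] E)
      (𝓝 (extendFrom (regionTop E F) A E)) := by
    refine (t1.sup ?_).sup ?_
    · rwa [e1]
    · rwa [e1, e2]
  simpa using this.sub_const (extendFrom (regionTop E F) A E)

lemma conj_omegaHat_conj (h : Admissible E F) (k : ℂ) :
    conj (omegaHat E F (conj k)) = -omegaHat E F k := by
  obtain ⟨q, hq, hper⟩ := h.exists_period
  rw [omegaHat, omegaHat, hper]
  simp only [map_mul, map_inv₀, map_div₀, map_one, conj_R_conj, Complex.conj_ofReal,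
    Complex.conj_I, Complex.conj_ofNat]
  rw [mul_neg, mul_neg, inv_neg]; ring

lemma omegaHat_ne_zero (h : Admissible E F) (hk : k ∉ contour E F) : omegaHat E F k ≠ 0 := by
  obtain ⟨q, hq, hper⟩ := h.exists_period
  rw [omegaHat, hper]
  have := R_ne_zero_of_notMem hk
  have : (q : ℂ) ≠ 0 := by exact_mod_cast hq.ne'
  simp [*]

/-- Since the normalizing period is imaginary, the reflected function and `-A` have the same
derivative on a connected set. The constant is read off at `E`, where `A` tends to `0`, against
`conj E`, where it tends to `-1 / 2` from the left region. -/
lemma abel_conj (h : Admissible E F) (hA : IsAbelIntegral E F A) (hk : k ∉ contour E F) :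
    conj (A (conj k)) = -1 / 2 - A k := by
  have hd : ∀ k ∈ (contour E F)ᶜ,
      HasDerivAt (fun k => conj (A (conj k))) (-omegaHat E F k) k := by
    intro k hk
    have := (hA.1 (conj k) (fun hc => hk (conj_mem_contour.1 hc))).conj_conj
    rw [Complex.conj_conj, h.conj_omegaHat_conj] at this
    exact this
  obtain ⟨c, hc⟩ := exists_eq_add_const_of_hasDerivAt isOpen_compl_contour h.isPreconnected_compl
    hd (fun k hk => (hA.1 k hk).neg)
  have hl := h.abelLimits hA.1
  have hj := h.abelJumps hA
  have hcE := tendsto_extendFrom (hl.left (conj E) (by simp))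
  rw [hj.atE'] at hcE
  have hE : Tendsto A (𝓝[regionLeft E] E) (𝓝 0) :=
    hA.2.mono_left (nhdsWithin_mono _ h.regionLeft_subset)
  have hconj : Tendsto conj (𝓝[regionLeft E] E) (𝓝[regionLeft E] (conj E)) :=
    (Complex.continuous_conj.continuousWithinAt).tendsto_nhdsWithin
      (fun k hk => conj_mem_regionLeft.2 hk)
  have t1 : Tendsto (fun k => conj (A (conj k)) + A k) (𝓝[regionLeft E] E) (𝓝 (-1 / 2)) := by
    have := (Complex.continuous_conj.tendsto _).comp (hcE.comp hconj) |>.add hE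
    simpa [Function.comp_def, Complex.conj_ofNat] using this
  have t2 : Tendsto (fun k => conj (A (conj k)) + A k) (𝓝[regionLeft E] E) (𝓝 c) := by
    refine tendsto_const_nhds.congr' ?_
    filter_upwards [self_mem_nhdsWithin] with k hk
    rw [hc k (h.regionLeft_subset hk)]; simp
  have : (𝓝[regionLeft E] E).NeBot := mem_closure_iff_nhdsWithin_neBot.1
    (closure_mono Set.inter_subset_right h.E_mem_closure_top_left)
  have hce := tendsto_nhds_unique t1 t2
  rw [hc k hk, ← hce]; simp; ring

lemma abel_real_re (h : Admissible E F) (hA : IsAbelIntegral E F A) {x : ℝ} (hx : x ≠ F.re) :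
    (A x).re = -1 / 4 := by
  have := congrArg Complex.re
    (h.abel_conj hA (fun hm => hx ((ofReal_mem_contour h).1 hm) : (x : ℂ) ∉ contour E F))
  simp at this
  linarith

/-- The symmetry `abel_conj`, applied to the values `τ / 2` at `F` and `τ / 2 - 1 / 2` at `conj F`,
reads `conj τ = -τ`. -/
lemma tau_re (h : Admissible E F) : (tau E F).re = 0 := by
  obtain ⟨A, hA⟩ := h.exists_isAbelIntegral
  have hl := h.abelLimits hA.1
  have hj := h.abelJumps hA
  have t1 := tendsto_extendFrom (hl.top F (right_mem_segment _ _ _))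
  have t2 := tendsto_extendFrom (hl.bot (conj F) (left_mem_segment _ _ _))
  rw [hj.atF] at t1
  rw [hj.atF'] at t2
  have hconj : Tendsto conj (𝓝[regionTop E F] F) (𝓝[regionBot E F] (conj F)) :=
    (Complex.continuous_conj.continuousWithinAt).tendsto_nhdsWithin
      (fun k hk => conj_mem_regionBot.2 hk)
  have t3 := (Complex.continuous_conj.tendsto _).comp (t2.comp hconj)
  have t4 : Tendsto (fun k => conj (A (conj k))) (𝓝[regionTop E F] F)
      (𝓝 (-1 / 2 - tau E F / 2)) := by
    refine (t1.const_sub (-1 / 2)).congr' ?_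
    filter_upwards [self_mem_nhdsWithin] with k hk
    rw [h.abel_conj hA (h.regionTop_subset hk)]
  have : (𝓝[regionTop E F] F).NeBot := mem_closure_iff_nhdsWithin_neBot.1
    (closure_mono Set.inter_subset_left h.F_mem_closure_top_right)
  have := congrArg Complex.re (tendsto_nhds_unique t3 t4)
  simp [Complex.div_re, Complex.normSq] at this
  linarith

/-- Along the real axis the imaginary part of the Abel integral decreases. -/
lemma hasDerivAt_abel_im (h : Admissible E F) (hA : IsAbelIntegral E F A) {x : ℝ}
    (hx : x ≠ F.re) : ∃ y < 0, HasDerivAt (fun x : ℝ => (A x).im) y x := by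
  obtain ⟨q, hq, hper⟩ := h.exists_period
  obtain ⟨y, hy, hR⟩ := R_ofReal_pos h.imE.ne' h.imF.ne' x
  have h1 := (hA.1 x (fun hm => hx ((ofReal_mem_contour h).1 hm))).comp_ofReal
  have h2 := (Complex.imCLM.hasFDerivAt (x := A x)).comp_hasDerivAt x h1
  refine ⟨_, ?_, h2⟩
  have e : omegaHat E F x = ((-(2 * q * y)⁻¹ : ℝ) : ℂ) * Complex.I := by
    have hq' : (q : ℂ) ≠ 0 := by exact_mod_cast hq.ne'
    have hy' : (y : ℂ) ≠ 0 := by exact_mod_cast hy.ne'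
    rw [omegaHat, hper, hR]
    push_cast
    field_simp
    simp
  rw [e]
  simp
  positivity

lemma strictAntiOn_abel_im (h : Admissible E F) (hA : IsAbelIntegral E F A) {s : Set ℝ}
    (hs : Convex ℝ s) (hsF : F.re ∉ s) : StrictAntiOn (fun x : ℝ => (A x).im) s := by
  have hne : ∀ x ∈ s, x ≠ F.re := fun x hx he => hsF (he ▸ hx)
  refine strictAntiOn_of_deriv_neg hs (fun x hx => ?_) fun x hx => ?_
  · obtain ⟨y, -, hy⟩ := h.hasDerivAt_abel_im hA (hne x hx)
    exact hy.continuousAt.continuousWithinAt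
  · obtain ⟨y, hy0, hy⟩ := h.hasDerivAt_abel_im hA (hne x (interior_subset hx))
    rwa [hy.deriv]

lemma re_F_mem_SigmaF (h : Admissible E F) : (F.re : ℂ) ∈ SigmaF F := by
  rw [mem_SigmaF h.imF]; simpa using h.imF.le

lemma tendsto_ofReal_regionIn (h : Admissible E F) :
    Tendsto (fun x : ℝ => (x : ℂ)) (𝓝[<] F.re) (𝓝[regionIn E F] F.re) := by
  refine tendsto_nhdsWithin_iff.2
    ⟨Complex.continuous_ofReal.continuousAt.tendsto.mono_left nhdsWithin_le_nhds, ?_⟩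
  have hneg : lineForm E F (F.re : ℂ) < 0 := by
    simp [lineForm]; nlinarith [h.imF, h.re_lt]
  have hc : ContinuousAt (fun x : ℝ => lineForm E F (x : ℂ)) F.re :=
    (continuous_lineForm.comp Complex.continuous_ofReal).continuousAt
  filter_upwards [self_mem_nhdsWithin,
    nhdsWithin_le_nhds (hc.eventually (gt_mem_nhds hneg))] with x hx hx2
  exact ⟨⟨hx2, by simpa using hx2⟩, by simpa using hx⟩

lemma tendsto_ofReal_regionRight :
    Tendsto (fun x : ℝ => (x : ℂ)) (𝓝[>] F.re) (𝓝[regionRight F] F.re) := by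
  refine tendsto_nhdsWithin_iff.2
    ⟨Complex.continuous_ofReal.continuousAt.tendsto.mono_left nhdsWithin_le_nhds, ?_⟩
  filter_upwards [self_mem_nhdsWithin] with x hx
  simpa [regionRight] using hx

lemma tendsto_abel_real_in (h : Admissible E F) (hA : IsAbelIntegral E F A) :
    Tendsto (fun x : ℝ => A x) (𝓝[<] F.re) (𝓝 (extendFrom (regionIn E F) A F.re)) :=
  (tendsto_extendFrom ((h.abelLimits hA.1).inn _ (Or.inr h.re_F_mem_SigmaF))).comp
    h.tendsto_ofReal_regionIn

lemma tendsto_abel_real_right (h : Admissible E F) (hA : IsAbelIntegral E F A) :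
    Tendsto (fun x : ℝ => A x) (𝓝[>] F.re) (𝓝 (extendFrom (regionRight F) A F.re)) :=
  (tendsto_extendFrom ((h.abelLimits hA.1).right _ h.re_F_mem_SigmaF)).comp
    tendsto_ofReal_regionRight

lemma abel_in_re (h : Admissible E F) (hA : IsAbelIntegral E F A) :
    (extendFrom (regionIn E F) A F.re).re = -1 / 4 := by
  refine tendsto_nhds_unique
    ((Complex.continuous_re.tendsto _).comp (h.tendsto_abel_real_in hA))
    (tendsto_const_nhds.congr' ?_)
  filter_upwards [self_mem_nhdsWithin] with x (hx : x < F.re)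
  exact (h.abel_real_re hA hx.ne).symm

lemma abel_right_eq (h : Admissible E F) (hA : IsAbelIntegral E F A) :
    extendFrom (regionRight F) A F.re = extendFrom (regionIn E F) A F.re + tau E F :=
  (h.abelJumps hA).sigmaF _ h.re_F_mem_SigmaF

lemma abel_right_re (h : Admissible E F) (hA : IsAbelIntegral E F A) :
    (extendFrom (regionRight F) A F.re).re = -1 / 4 := by
  rw [h.abel_right_eq hA, Complex.add_re, h.tau_re, h.abel_in_re hA, add_zero]

lemma tendsto_ofReal_cocompact : Tendsto (fun x : ℝ => (x : ℂ)) (cocompact ℝ) (cocompact ℂ) :=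
  Complex.isometry_ofReal.isClosedEmbedding.tendsto_cocompact

lemma abel_infty_re (h : Admissible E F) (hA : IsAbelIntegral E F A) {l : ℂ}
    (hl : Tendsto A (cocompact ℂ) (𝓝 l)) : l.re = -1 / 4 := by
  have h1 : Tendsto (fun x : ℝ => (A x).re) atTop (𝓝 l.re) :=
    (Complex.continuous_re.tendsto _).comp (hl.comp (tendsto_ofReal_cocompact.mono_left
      atTop_le_cocompact))
  refine tendsto_nhds_unique h1 (tendsto_const_nhds.congr' ?_)
  filter_upwards [eventually_gt_atTop F.re] with x hx
  exact (h.abel_real_re hA hx.ne').symm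

lemma abel_im_lt_infty (h : Admissible E F) (hA : IsAbelIntegral E F A) {l : ℂ}
    (hl : Tendsto A (cocompact ℂ) (𝓝 l)) {x : ℝ} (hx : x < F.re) : (A x).im < l.im := by
  have h1 : Tendsto (fun x : ℝ => (A x).im) atBot (𝓝 l.im) :=
    (Complex.continuous_im.tendsto _).comp (hl.comp (tendsto_ofReal_cocompact.mono_left
      atBot_le_cocompact))
  have hs := h.strictAntiOn_abel_im hA (convex_Iio F.re) Set.self_notMem_Iio
  have hx' : x - 1 < F.re := by linarith
  refine (hs hx' hx (by linarith)).trans_le (ge_of_tendsto h1 ?_)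
  filter_upwards [eventually_lt_atBot (x - 1)] with y hy
  exact (hs (show y < F.re by linarith) hx' hy).le

lemma infty_lt_abel_im (h : Admissible E F) (hA : IsAbelIntegral E F A) {l : ℂ}
    (hl : Tendsto A (cocompact ℂ) (𝓝 l)) {x : ℝ} (hx : F.re < x) : l.im < (A x).im := by
  have h1 : Tendsto (fun x : ℝ => (A x).im) atTop (𝓝 l.im) :=
    (Complex.continuous_im.tendsto _).comp (hl.comp (tendsto_ofReal_cocompact.mono_left
      atTop_le_cocompact))
  have hs := h.strictAntiOn_abel_im hA (convex_Ioi F.re) Set.self_notMem_Ioi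
  have hx' : F.re < x + 1 := by linarith
  refine (le_of_tendsto h1 ?_).trans_lt (hs hx hx' (by linarith))
  filter_upwards [eventually_gt_atTop (x + 1)] with y hy
  exact (hs hx' (show F.re < y by linarith) hy).le

lemma abel_in_im_lt (h : Admissible E F) (hA : IsAbelIntegral E F A) {x : ℝ} (hx : x < F.re) :
    (extendFrom (regionIn E F) A F.re).im < (A x).im := by
  have h1 := (Complex.continuous_im.tendsto _).comp (h.tendsto_abel_real_in hA)
  have hs := h.strictAntiOn_abel_im hA (convex_Iio F.re) Set.self_notMem_Iio
  obtain ⟨x', hx1, hx2⟩ := exists_between hx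
  refine (le_of_tendsto h1 ?_).trans_lt (hs hx hx2 hx1)
  filter_upwards [self_mem_nhdsWithin, nhdsWithin_le_nhds (lt_mem_nhds hx2)] with y hy hy'
  exact (hs hx2 hy hy').le

lemma lt_abel_right_im (h : Admissible E F) (hA : IsAbelIntegral E F A) {x : ℝ} (hx : F.re < x) :
    (A x).im < (extendFrom (regionRight F) A F.re).im := by
  have h1 := (Complex.continuous_im.tendsto _).comp (h.tendsto_abel_real_right hA)
  have hs := h.strictAntiOn_abel_im hA (convex_Ioi F.re) Set.self_notMem_Ioi
  obtain ⟨x', hx1, hx2⟩ := exists_between hx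
  refine (hs hx1 hx hx2).trans_le (ge_of_tendsto h1 ?_)
  filter_upwards [self_mem_nhdsWithin, nhdsWithin_le_nhds (gt_mem_nhds hx1)] with y hy hy'
  exact (hs hy hx1 hy').le

/-- The imaginary part of `A` decreases along the real axis on both sides of the crossing with
`SigmaF`, and the two branches meet at infinity. Started from the right edge of the crossing and run
through infinity to its left edge, it decreases strictly by exactly `Im τ`. -/
lemma tau_im_pos (h : Admissible E F) : 0 < (tau E F).im := by
  obtain ⟨A, hA⟩ := h.exists_isAbelIntegral
  obtain ⟨l, hl⟩ := exists_tendsto_cocompact hA.1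
  have h1 := h.abel_in_im_lt hA (sub_one_lt F.re)
  have h2 := h.abel_im_lt_infty hA hl (sub_one_lt F.re)
  have h3 := h.infty_lt_abel_im hA hl (lt_add_one F.re)
  have h4 := h.lt_abel_right_im hA (lt_add_one F.re)
  rw [h.abel_right_eq hA, Complex.add_im] at h4
  linarith

/-- The values of the Abel integral on the real axis, the two boundary values at its intersection
with the contour and the limit at infinity. -/
structure IsRealValue (E F : ℂ) (A : ℂ → ℂ) (v : ℂ) : Prop where
  re_eq : v.re = -1 / 4
  im_ne : ∀ n : ℤ, v.im - (A (E0 E F)).im ≠ n * (tau E F).im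

lemma int_mul_ne {x T : ℝ} (h0 : x ≠ 0) (h1 : -T < x) (h2 : x < T) (n : ℤ) : x ≠ n * T := by
  have hT : 0 < T := by linarith
  rintro rfl
  have h3 : (n : ℝ) < 1 := by nlinarith
  have h4 : (-1 : ℝ) < n := by nlinarith
  have h5 : n = 0 := by
    have h6 : n < 1 := by exact_mod_cast h3
    have h7 : -1 < n := by exact_mod_cast h4
    omega
  simp [h5] at h0

/-- On the real axis the imaginary part of `A` is injective and its values fill less than one
period, so it can agree with its value at `E0` modulo `Im τ` only at `E0`. -/
lemma isRealValue (h : Admissible E F) (hA : IsAbelIntegral E F A) {x : ℝ} (hx : x ≠ F.re)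
    (hx0 : (x : ℂ) ≠ E0 E F) : IsRealValue E F A (A x) := by
  obtain ⟨l, hl⟩ := exists_tendsto_cocompact hA.1
  refine ⟨h.abel_real_re hA hx, ?_⟩
  have hT := h.tau_im_pos
  have hlt := E0_re_lt h
  have g1 := h.abel_in_im_lt hA hlt
  have g2 := h.abel_im_lt_infty hA hl hlt
  rw [← E0_eq_re h] at g1 g2
  rcases lt_or_gt_of_ne hx with hx | hx
  · have h1 := h.abel_in_im_lt hA hx
    have h2 := h.abel_im_lt_infty hA hl hx
    have h3 := h.infty_lt_abel_im hA hl (lt_add_one F.re)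
    have h4 := h.lt_abel_right_im hA (lt_add_one F.re)
    rw [h.abel_right_eq hA, Complex.add_im] at h4
    refine int_mul_ne (_root_.sub_ne_zero.2 fun he => hx0 ?_) (by linarith) (by linarith)
    rw [E0_eq_re h] at he ⊢
    have := (h.strictAntiOn_abel_im hA (convex_Iio F.re) Set.self_notMem_Iio).injOn hx hlt he
    rw [this]
  · have h3 := h.infty_lt_abel_im hA hl hx
    have h4 := h.lt_abel_right_im hA hx
    rw [h.abel_right_eq hA, Complex.add_im] at h4
    exact int_mul_ne (by linarith) (by linarith) (by linarith)

lemma isRealValue_in (h : Admissible E F) (hA : IsAbelIntegral E F A) :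
    IsRealValue E F A (extendFrom (regionIn E F) A F.re) := by
  obtain ⟨l, hl⟩ := exists_tendsto_cocompact hA.1
  refine ⟨h.abel_in_re hA, ?_⟩
  have hlt := E0_re_lt h
  have g1 := h.abel_in_im_lt hA hlt
  have g2 := h.abel_im_lt_infty hA hl hlt
  rw [← E0_eq_re h] at g1 g2
  have h3 := h.infty_lt_abel_im hA hl (lt_add_one F.re)
  have h4 := h.lt_abel_right_im hA (lt_add_one F.re)
  rw [h.abel_right_eq hA, Complex.add_im] at h4
  exact int_mul_ne (by linarith) (by linarith) (by linarith)

lemma isRealValue_right (h : Admissible E F) (hA : IsAbelIntegral E F A) :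
    IsRealValue E F A (extendFrom (regionRight F) A F.re) := by
  -- The right boundary value is the inner one plus `τ`, so the integer moves by one.
  refine ⟨h.abel_right_re hA, fun n hn => (h.isRealValue_in hA).im_ne (n - 1) ?_⟩
  rw [h.abel_right_eq hA, Complex.add_im] at hn
  push_cast
  linarith

lemma isRealValue_infty (h : Admissible E F) (hA : IsAbelIntegral E F A) {l : ℂ}
    (hl : Tendsto A (cocompact ℂ) (𝓝 l)) : IsRealValue E F A l := by
  refine ⟨h.abel_infty_re hA hl, ?_⟩
  have hlt := E0_re_lt h
  have g1 := h.abel_in_im_lt hA hlt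
  have g2 := h.abel_im_lt_infty hA hl hlt
  rw [← E0_eq_re h] at g1 g2
  have h3 := h.infty_lt_abel_im hA hl (lt_add_one F.re)
  have h4 := h.lt_abel_right_im hA (lt_add_one F.re)
  rw [h.abel_right_eq hA, Complex.add_im] at h4
  exact int_mul_ne (by linarith) (by linarith) (by linarith)

end Admissible

end SolitonGas

namespace SolitonGas

/-! ### The range of the real part of the Abel integral -/

variable {E F k z : ℂ} {A : ℂ → ℂ}

/-- Near an endpoint `A` need not have one limit from the whole complement, but it has one from each
of the five convex regions. Estimates may therefore be proved along a set on which `A` converges. -/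
lemma isBigO_endpoint (h : Admissible E F)
    (hA : ∀ k ∉ contour E F, HasDerivAt A (omegaHat E F k) k) {p : ℂ} (hp : p ∈ endpoints E F)
    {V W : Type*} [SeminormedAddCommGroup V] [SeminormedAddCommGroup W] {f : ℂ → V} {g : ℂ → W}
    (H : ∀ C ⊆ (contour E F)ᶜ, p ∈ closure C → ∀ v, Tendsto A (𝓝[C] p) (𝓝 v) → f =O[𝓝[C] p] g) :
    f =O[𝓝[(contour E F)ᶜ] p] g := by
  have key : ∀ C, IsOpen C → Convex ℝ C → C ⊆ (contour E F)ᶜ → f =O[𝓝[C] p] g := by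
    intro C ho hc hs
    by_cases hpC : p ∈ closure C
    · obtain ⟨v, hv⟩ := h.exists_tendsto_endpoint hA ho hc hs hp hpC
      exact H C hs hpC v hv
    · rw [nhdsWithin_eq_bot_of_notMem_closure hpC]
      simp
  rw [h.compl_contour_eq, nhdsWithin_union, nhdsWithin_union, nhdsWithin_union, nhdsWithin_union]
  exact ((((key _ isOpen_regionTop convex_regionTop h.regionTop_subset).sup
    (key _ isOpen_regionRight convex_regionRight h.regionRight_subset)).sup
    (key _ isOpen_regionBot convex_regionBot h.regionBot_subset)).sup
    (key _ isOpen_regionLeft convex_regionLeft h.regionLeft_subset)).sup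
    (key _ isOpen_regionIn convex_regionIn h.regionIn_subset)

/-- `cosh` maps the line of real part `x` into the ellipse with foci `±1` and sum of focal distances
`2 cosh x`. The half-angle formulas `cosh ζ ∓ 1 = 2 sinh² (ζ / 2), 2 cosh² (ζ / 2)` reduce this to
squared norms. -/
lemma norm_cosh_sub_add_norm_cosh_add (ζ : ℂ) :
    ‖Complex.cosh ζ - 1‖ + ‖Complex.cosh ζ + 1‖ = 2 * Real.cosh ζ.re := by
  have h1 : Complex.cosh ζ - 1 = 2 * Complex.sinh (ζ / 2) ^ 2 := by
    have := Complex.cosh_two_mul (ζ / 2)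
    rw [mul_div_cancel₀ _ two_ne_zero] at this
    rw [this]; linear_combination (Complex.cosh_sq (ζ / 2))
  have h2 : Complex.cosh ζ + 1 = 2 * Complex.cosh (ζ / 2) ^ 2 := by
    have := Complex.cosh_two_mul (ζ / 2)
    rw [mul_div_cancel₀ _ two_ne_zero] at this
    rw [this]; linear_combination -(Complex.cosh_sq (ζ / 2))
  have hz : ζ / 2 = ((ζ.re / 2 : ℝ) : ℂ) + ((ζ.im / 2 : ℝ) : ℂ) * Complex.I := by
    apply Complex.ext <;> simp
  have h3 : ζ.re = 2 * (ζ.re / 2) := by ring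
  rw [h1, h2, h3]
  generalize ζ.re / 2 = x at *
  generalize ζ.im / 2 = y at *
  rw [norm_mul, norm_mul, norm_pow, norm_pow, Complex.norm_two, ← Complex.normSq_eq_norm_sq,
    ← Complex.normSq_eq_norm_sq, hz, Complex.sinh_add, Complex.cosh_add, Complex.cosh_mul_I,
    Complex.sinh_mul_I, Real.cosh_two_mul]
  simp only [← Complex.ofReal_sinh, ← Complex.ofReal_cosh, ← Complex.ofReal_sin,
    ← Complex.ofReal_cos, Complex.normSq_apply]
  simp [-Complex.ofReal_sinh, -Complex.ofReal_cosh, -Complex.ofReal_sin, -Complex.ofReal_cos]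
  linear_combination (2 * (Real.sinh x ^ 2 + Real.cosh x ^ 2)) * (Real.sin_sq_add_cos_sq y)

namespace Admissible

/-- `cosh (2 π A / |τ|)` continues analytically across `Sigma1` and `SigmaF`. -/
lemma exists_cosh_extension (h : Admissible E F) (hA : IsAbelIntegral E F A) :
    ∃ g : ℂ → ℂ, DifferentiableOn ℂ g (Sigma2 E F)ᶜ ∧ ∀ k ∉ contour E F,
      g k = Complex.cosh ((2 * Real.pi / (tau E F).im : ℝ) * A k) := by
  set c : ℝ := 2 * Real.pi / (tau E F).im with hc
  have hT := h.tau_im_pos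
  -- The scale is chosen to turn `τ` into the period of `cosh`: evenness removes the sign change on
  -- `Sigma1` and periodicity the jump on `SigmaF`. The extra `-1` on `Sigma2` is not absorbed, so
  -- that segment stays excluded.
  have hτ : (c : ℂ) * tau E F = 2 * Real.pi * Complex.I := by
    have : tau E F = ((tau E F).im : ℂ) * Complex.I := by
      apply Complex.ext <;> simp [h.tau_re]
    rw [this, hc]
    have : ((tau E F).im : ℂ) ≠ 0 := by exact_mod_cast hT.ne'
    push_cast
    field_simp
  have hl := h.abelLimits hA.1
  have hj := h.abelJumps hA
  have hcc : Continuous fun a : ℂ => Complex.cosh (c * a) := by fun_prop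
  suffices hs : ∃ g : ℂ → ℂ, DifferentiableOn ℂ g (Sigma2 E F)ᶜ ∧
      ∀ k ∈ (Sigma2 E F)ᶜ \ contour E F, k ∉ endpoints E F → g k = Complex.cosh (c * A k) by
    obtain ⟨g, hg, hgf⟩ := hs
    exact ⟨g, hg, fun k hk => hgf k ⟨fun h2 => hk (Or.inl (Or.inr h2)), hk⟩
      (fun hq => hk (endpoints_subset_contour hq))⟩
  refine exists_differentiableOn_extension (U := (Sigma2 E F)ᶜ)
    (K := contour E F) (f := fun k => Complex.cosh (c * A k)) isClosed_Sigma2.isOpen_compl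
    isClosed_contour
    (fun k hk => (((hA.1 k hk.2).differentiableAt.const_mul _).ccosh).differentiableWithinAt)
    (finite_endpoints (E := E) (F := F)) ?_ ?_
  · rintro z ⟨hzU, hzK⟩ hzQ
    have hin := tendsto_extendFrom (hl.inn z hzK)
    rcases mem_contour_cases hzK hzQ with hz | hz | hz
    · have h1 := openSegment_subset_segment ℝ _ _ hz
      refine ⟨F - E, h.sub_ne_zero, h.eventually_mem_contour_Sigma1 hz,
        Complex.cosh (c * extendFrom (regionIn E F) A z), ?_, ?_⟩
      · rw [h.leftSide_Sigma1 hz]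
        have := (hcc.tendsto _).comp (tendsto_extendFrom (hl.top z h1))
        rwa [hj.sigma1 z h1, mul_neg, Complex.cosh_neg] at this
      · rw [h.rightSide_Sigma1 hz]
        exact (hcc.tendsto _).comp hin
    · have h1 := openSegment_subset_segment ℝ _ _ hz
      refine ⟨conj F - F, _root_.sub_ne_zero.2 h.F_ne_conjF.symm,
        h.eventually_mem_contour_SigmaF hz,
        Complex.cosh (c * extendFrom (regionIn E F) A z), ?_, ?_⟩
      · rw [h.leftSide_SigmaF hz]
        have := (hcc.tendsto _).comp (tendsto_extendFrom (hl.right z h1))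
        rwa [hj.sigmaF z h1, mul_add, hτ, Complex.cosh_add, Complex.cosh_mul_I,
          Complex.sinh_mul_I, Complex.cos_two_pi, Complex.sin_two_pi, zero_mul, mul_zero,
          mul_one, add_zero] at this
      · rw [h.rightSide_SigmaF hz]
        exact (hcc.tendsto _).comp hin
    · exact absurd (openSegment_subset_segment ℝ _ _ hz) hzU
  · intro p hp _
    have hO : (fun k => Complex.cosh (c * A k)) =O[𝓝[(contour E F)ᶜ] p] (fun _ => (1 : ℝ)) :=
      isBigO_endpoint h hA.1 hp fun C _ _ v hv => ((hcc.tendsto v).comp hv).isBigO_one ℝ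
    have h0 : Tendsto (fun k => k - p) (𝓝[(contour E F)ᶜ] p) (𝓝 0) := by
      have : Continuous fun k : ℂ => k - p := by fun_prop
      simpa using (this.tendsto p).mono_left nhdsWithin_le_nhds
    have := ((Asymptotics.isLittleO_one_iff ℝ).2 h0).mul_isBigO hO
    simpa using (Asymptotics.isLittleO_one_iff ℝ).1 (by simpa using this)

/-- On the real axis `Re A = -1 / 4`, so `g` takes its values on one ellipse; a maximum principle in
the upper half plane keeps `g` inside it. The sum of focal distances is not the modulus of an
analytic function, but it is the supremum of the moduli of `α (g - 1) + β (g + 1)` over `‖α‖, ‖β‖ ≤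
1`. -/
lemma cosh_extension_le (h : Admissible E F) (hA : IsAbelIntegral E F A) {g : ℂ → ℂ}
    (hg : DifferentiableOn ℂ g (Sigma2 E F)ᶜ)
    (hgA : ∀ k ∉ contour E F, g k = Complex.cosh ((2 * Real.pi / (tau E F).im : ℝ) * A k))
    (hz : 0 ≤ z.im) :
    ‖g z - 1‖ + ‖g z + 1‖ ≤ 2 * Real.cosh (2 * Real.pi / (tau E F).im * (-1 / 4)) := by
  set c : ℝ := 2 * Real.pi / (tau E F).im with hc
  have hU : ∀ k : ℂ, 0 ≤ k.im → DifferentiableAt ℂ g k := fun k hk =>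
    hg.differentiableAt (isClosed_Sigma2.isOpen_compl.mem_nhds (h.notMem_Sigma2_of_im_nonneg hk))
  have hreal' : ∀ x : ℝ, x ≠ F.re → ‖g x - 1‖ + ‖g x + 1‖ = 2 * Real.cosh (c * (-1 / 4)) := by
    intro x hx
    rw [hgA x (fun hm => hx ((ofReal_mem_contour h).1 hm)), norm_cosh_sub_add_norm_cosh_add,
      Complex.re_ofReal_mul, h.abel_real_re hA hx]
  have hreal : ∀ x : ℝ, ‖g x - 1‖ + ‖g x + 1‖ = 2 * Real.cosh (c * (-1 / 4)) := by
    have hcont : Continuous fun x : ℝ => ‖g x - 1‖ + ‖g x + 1‖ := by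
      have : Continuous fun x : ℝ => g x := continuous_iff_continuousAt.2 fun x =>
        ContinuousAt.comp (g := g) (f := fun x : ℝ => (x : ℂ))
          (hU x (by simp)).continuousAt Complex.continuous_ofReal.continuousAt
      exact (this.sub continuous_const).norm.add (this.add continuous_const).norm
    intro x
    by_cases hx : x = F.re
    · refine tendsto_nhds_unique ((hcont.tendsto x).mono_left
        (nhdsWithin_le_nhds (s := Set.Iio x))) (tendsto_const_nhds.congr' ?_)
      filter_upwards [self_mem_nhdsWithin] with y (hy : y < x)
      exact (hreal' y (by rw [← hx]; exact hy.ne)).symm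
    · exact hreal' x hx
  obtain ⟨l, hl⟩ := exists_tendsto_cocompact hA.1
  have hginf : Tendsto g (cocompact ℂ) (𝓝 (Complex.cosh (c * l))) := by
    have hcc : Continuous fun a : ℂ => Complex.cosh (c * a) := by fun_prop
    refine ((hcc.tendsto _).comp hl).congr' ?_
    filter_upwards [eventually_notMem_contour] with k hk
    exact (hgA k hk).symm
  have hmulI : Tendsto (fun k : ℂ => Complex.I * k) (cocompact ℂ) (cocompact ℂ) :=
    (Homeomorph.mulLeft₀ Complex.I Complex.I_ne_zero).isClosedEmbedding.tendsto_cocompact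
  have hscalar : ∀ α β : ℂ, ‖α‖ ≤ 1 → ‖β‖ ≤ 1 →
      ‖α * (g z - 1) + β * (g z + 1)‖ ≤ 2 * Real.cosh (c * (-1 / 4)) := by
    intro α β hα hβ
    -- Multiplication by `i` carries the right half plane, where the Phragmén–Lindelöf principle is
    -- applied, to the upper one.
    set f : ℂ → ℂ := fun w => α * (g (Complex.I * w) - 1) + β * (g (Complex.I * w) + 1) with hf
    have hfd : ∀ w : ℂ, 0 ≤ w.re → DifferentiableAt ℂ f w := by
      intro w hw
      have : DifferentiableAt ℂ (fun w => g (Complex.I * w)) w :=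
        DifferentiableAt.comp (g := g) (f := fun w => Complex.I * w) w
          (hU _ (by simpa using hw)) (by fun_prop)
      exact ((this.sub_const 1).const_mul α).add ((this.add_const 1).const_mul β)
    have hfl : Tendsto f (cocompact ℂ)
        (𝓝 (α * (Complex.cosh (c * l) - 1) + β * (Complex.cosh (c * l) + 1))) := by
      have := hginf.comp hmulI
      exact ((this.sub_const 1).const_mul α).add ((this.add_const 1).const_mul β)
    have hz' : z = Complex.I * (-Complex.I * z) := by
      rw [← mul_assoc, mul_neg, Complex.I_mul_I, neg_neg, one_mul]
    have : α * (g z - 1) + β * (g z + 1) = f (-Complex.I * z) := by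
      simp only [hf, ← hz']
    rw [this]
    refine PhragmenLindelof.right_half_plane_of_bounded_on_real
      (f := f) (z := -Complex.I * z) ⟨fun w hw => (hfd w (le_of_lt hw)).differentiableWithinAt,
        ?_⟩ ⟨0, by norm_num, 0, ?_⟩ ?_ ?_ (by simpa using hz)
    · intro w hw
      rw [Complex.closure_setOfPred_lt_re] at hw
      exact (hfd w hw).continuousAt.continuousWithinAt
    · simp only [zero_mul, Real.exp_zero, Metric.cobounded_eq_cocompact]
      exact ((hfl.mono_left inf_le_left).isBigO_one ℝ)
    · exact (hfl.comp (tendsto_ofReal_cocompact.mono_left atTop_le_cocompact)).norm.isBoundedUnder_le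
    · intro x
      have hx : Complex.I * (x * Complex.I) = ((-x : ℝ) : ℂ) := by
        push_cast; linear_combination (x : ℂ) * Complex.I_mul_I
      simp only [hf, hx]
      refine (norm_add_le _ _).trans ?_
      rw [norm_mul, norm_mul, ← hreal (-x)]
      gcongr
      · exact mul_le_of_le_one_left (norm_nonneg _) hα
      · exact mul_le_of_le_one_left (norm_nonneg _) hβ
  have hphase : ∀ w : ℂ, ∃ α : ℂ, ‖α‖ ≤ 1 ∧ α * w = ‖w‖ := by
    intro w
    by_cases hw : w = 0
    · exact ⟨0, by simp, by simp [hw]⟩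
    · refine ⟨conj w / ‖w‖, ?_, ?_⟩
      · simp [hw]
      · have : (‖w‖ : ℂ) ≠ 0 := by simpa using hw
        rw [div_mul_eq_mul_div, mul_comm, Complex.mul_conj, Complex.normSq_eq_norm_sq]
        push_cast
        field_simp
  obtain ⟨α, hα, hα'⟩ := hphase (g z - 1)
  obtain ⟨β, hβ, hβ'⟩ := hphase (g z + 1)
  have := hscalar α β hα hβ
  rw [hα', hβ', ← Complex.ofReal_add, Complex.norm_real, Real.norm_of_nonneg (by positivity)] at this
  exact this

/-- If `g z` lay on the ellipse, the open mapping theorem would put `(1 + t) g z` in the image for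
small `t > 0`, and that point is outside. If `g` were constant, differentiating `cosh (c A)` twice
would make `sinh` and `cosh` vanish together, since the derivative of `A` has no zero. -/
lemma cosh_extension_lt (h : Admissible E F) (hA : IsAbelIntegral E F A) {g : ℂ → ℂ}
    (hg : DifferentiableOn ℂ g (Sigma2 E F)ᶜ)
    (hgA : ∀ k ∉ contour E F, g k = Complex.cosh ((2 * Real.pi / (tau E F).im : ℝ) * A k))
    (hz : 0 < z.im) :
    ‖g z - 1‖ + ‖g z + 1‖ < 2 * Real.cosh (2 * Real.pi / (tau E F).im * (-1 / 4)) := by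
  have hle := fun {w : ℂ} (hw : 0 ≤ w.im) => h.cosh_extension_le hA hg hgA hw
  set c : ℝ := 2 * Real.pi / (tau E F).im with hc
  have hc0 : 0 < c := div_pos (by positivity) h.tau_im_pos
  set H : Set ℂ := {w | 0 < w.im} with hH
  have hHo : IsOpen H := isOpen_lt continuous_const Complex.continuous_im
  have hHs : H ⊆ (Sigma2 E F)ᶜ := fun w hw => h.notMem_Sigma2_of_im_nonneg (le_of_lt hw)
  have han : AnalyticOnNhd ℂ g H := (hg.mono hHs).analyticOnNhd hHo
  rcases han.is_constant_or_isOpen (convex_lt_im 0).isPreconnected with ⟨w, hw⟩ | hopen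
  · exfalso
    set p : ℂ := ⟨E.re - 1, 1⟩ with hp
    have hpU : p ∈ H ∩ regionLeft E := ⟨by simp [hH, hp], by simp [regionLeft, hp]⟩
    have hev : ∀ᶠ k in 𝓝 p, k ∈ H ∩ regionLeft E :=
      (hHo.inter isOpen_regionLeft).mem_nhds hpU
    have hcosh : ∀ k ∈ H ∩ regionLeft E, Complex.cosh (c * A k) = w := fun k hk => by
      rw [← hgA k (h.regionLeft_subset hk.2), hw k hk.1]
    have hd : ∀ k ∈ H ∩ regionLeft E, HasDerivAt (fun k => c * A k) (c * omegaHat E F k) k :=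
      fun k hk => (hA.1 k (h.regionLeft_subset hk.2)).const_mul _
    have hne : ∀ k ∈ H ∩ regionLeft E, (c : ℂ) * omegaHat E F k ≠ 0 := fun k hk =>
      mul_ne_zero (by exact_mod_cast hc0.ne') (h.omegaHat_ne_zero (h.regionLeft_subset hk.2))
    have hsinh : ∀ k ∈ H ∩ regionLeft E, Complex.sinh (c * A k) = 0 := by
      intro k hk
      have h1 := (hd k hk).ccosh
      have h2 : HasDerivAt (fun k => Complex.cosh (c * A k)) 0 k := by
        refine (hasDerivAt_const k w).congr_of_eventuallyEq ?_
        filter_upwards [(hHo.inter isOpen_regionLeft).mem_nhds hk] with j hj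
        exact hcosh j hj
      exact (mul_eq_zero.1 (h1.unique h2)).resolve_right (hne k hk)
    have h1 := (hd p hpU).csinh
    have h2 : HasDerivAt (fun k => Complex.sinh (c * A k)) 0 p := by
      refine (hasDerivAt_const p 0).congr_of_eventuallyEq ?_
      filter_upwards [hev] with j hj
      exact hsinh j hj
    have h3 := (mul_eq_zero.1 (h1.unique h2)).resolve_right (hne p hpU)
    have h4 := Complex.cosh_sq_sub_sinh_sq (c * A p)
    rw [h3, hsinh p hpU] at h4
    simp at h4
  · refine lt_of_le_of_ne (hle (le_of_lt hz)) fun he => ?_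
    have himg : IsOpen (g '' H) := hopen H subset_rfl hHo
    have hc1 : ContinuousAt (fun t : ℝ => (1 + t : ℂ) * g z) 0 := by fun_prop
    have hev : ∀ᶠ t : ℝ in 𝓝[>] 0, (1 + t : ℂ) * g z ∈ g '' H :=
      nhdsWithin_le_nhds (hc1.eventually (himg.mem_nhds (by simpa using ⟨z, hz, rfl⟩)))
    obtain ⟨t, ⟨w, hw, hwt⟩, ht : 0 < t⟩ := (hev.and self_mem_nhdsWithin).exists
    have hMw := hle (le_of_lt hw)
    rw [hwt] at hMw
    have hnt : ‖(1 + t : ℂ)‖ = 1 + t := by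
      rw [← Complex.ofReal_one, ← Complex.ofReal_add, Complex.norm_real,
        Real.norm_of_nonneg (by positivity)]
    have hnt' : ‖(t : ℂ)‖ = t := by rw [Complex.norm_real, Real.norm_of_nonneg ht.le]
    have h1 : (1 + t) * ‖g z - 1‖ ≤ ‖(1 + t : ℂ) * g z - 1‖ + t := by
      have := norm_sub_le ((1 + t : ℂ) * g z - 1) t
      rwa [show (1 + t : ℂ) * g z - 1 - t = (1 + t) * (g z - 1) by ring, norm_mul, hnt,
        hnt'] at this
    have h2 : (1 + t) * ‖g z + 1‖ ≤ ‖(1 + t : ℂ) * g z + 1‖ + t := by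
      have := norm_add_le ((1 + t : ℂ) * g z + 1) t
      rwa [show (1 + t : ℂ) * g z + 1 + t = (1 + t) * (g z + 1) by ring, norm_mul, hnt,
        hnt'] at this
    have hM : 1 < Real.cosh (c * (-1 / 4)) := Real.one_lt_cosh.2 (by positivity)
    have hprod : 0 < t * (Real.cosh (c * (-1 / 4)) - 1) := mul_pos ht (by linarith)
    nlinarith

/-- Formulated for limits along a set `C`, so that it covers points off the contour as well as
one-sided boundary values on it: `g` is continuous at `z`, and every such limit `v` satisfies `cosh
(c v) = g z`. -/
lemma abel_re_of_im_pos (h : Admissible E F) (hA : IsAbelIntegral E F A) (hz : 0 < z.im)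
    {C : Set ℂ} (hC : C ⊆ (contour E F)ᶜ) (hzC : z ∈ closure C) {v : ℂ}
    (hv : Tendsto A (𝓝[C] z) (𝓝 v)) : |v.re| < 1 / 4 := by
  obtain ⟨g, hg, hgA⟩ := h.exists_cosh_extension hA
  have hlt := h.cosh_extension_lt hA hg hgA hz
  have hc0 : 0 < 2 * Real.pi / (tau E F).im := div_pos (by positivity) h.tau_im_pos
  set c : ℝ := 2 * Real.pi / (tau E F).im with hc
  have hcc : Continuous fun a : ℂ => Complex.cosh (c * a) := by fun_prop
  have hgz : ContinuousAt g z := (hg.differentiableAt (isClosed_Sigma2.isOpen_compl.mem_nhds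
    (h.notMem_Sigma2_of_im_nonneg hz.le))).continuousAt
  have : (𝓝[C] z).NeBot := mem_closure_iff_nhdsWithin_neBot.1 hzC
  have heq : g z = Complex.cosh (c * v) := by
    refine tendsto_nhds_unique (hgz.tendsto.mono_left nhdsWithin_le_nhds)
      (((hcc.tendsto v).comp hv).congr' ?_)
    filter_upwards [self_mem_nhdsWithin] with k hk
    exact (hgA k (hC hk)).symm
  rw [heq, norm_cosh_sub_add_norm_cosh_add, Complex.re_ofReal_mul] at hlt
  have h1 := Real.cosh_lt_cosh.1 (lt_of_mul_lt_mul_left hlt (by norm_num))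
  rw [abs_mul, abs_mul] at h1
  have h2 := lt_of_mul_lt_mul_left h1 (abs_nonneg _)
  norm_num at h2 ⊢
  exact h2

lemma abel_re_of_im_neg (h : Admissible E F) (hA : IsAbelIntegral E F A) (hz : z.im < 0)
    {C : Set ℂ} (hC : C ⊆ (contour E F)ᶜ) (hzC : z ∈ closure C) {v : ℂ}
    (hv : Tendsto A (𝓝[C] z) (𝓝 v)) : |v.re + 1 / 2| < 1 / 4 := by
  have hmaps : Set.MapsTo conj (conj ⁻¹' C) C := fun _ hk => hk
  have hCc : conj ⁻¹' C ⊆ (contour E F)ᶜ := fun k hk hm => hC hk (conj_mem_contour.2 hm)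
  have h1 : Tendsto conj (𝓝[conj ⁻¹' C] (conj z)) (𝓝[C] z) := by
    have := (Complex.continuous_conj.continuousWithinAt
      (s := conj ⁻¹' C) (x := conj z)).tendsto_nhdsWithin hmaps
    rwa [Complex.conj_conj] at this
  have h2 : Tendsto A (𝓝[conj ⁻¹' C] (conj z)) (𝓝 (-1 / 2 - conj v)) := by
    refine (((Complex.continuous_conj.tendsto v).comp (hv.comp h1)).const_sub (-1 / 2)).congr' ?_
    filter_upwards [self_mem_nhdsWithin] with k hk
    simp only [Function.comp_apply]
    rw [h.abel_conj hA (hCc hk)]; ring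
  have h3 := h.abel_re_of_im_pos hA (z := conj z) (by simpa using hz) hCc
    (conj_mem_closure (S := C) (fun k hk => by simpa using hk) hzC) h2
  rw [← abs_neg] at h3
  convert h3 using 2
  simp; ring

end Admissible

end SolitonGas

namespace SolitonGas

/-! ### Reality of the constants and non-vanishing of the denominators -/

variable {E F k z : ℂ} {A : ℂ → ℂ} {v : ℂ}

lemma conj_e1 : conj (e1 E F) = e1 E F := by
  simp [e1, Complex.conj_ofNat]; ring

lemma conj_segInt_vertical {f : ℂ → ℂ} (hf : ∀ z, conj (f (conj z)) = f z) :
    conj (segInt f F (conj F)) = -segInt f F (conj F) := by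
  rw [conj_segInt, Complex.conj_conj, segInt_symm]
  simp only [hf]

lemma conj_c1 : conj (c1 E F) = c1 E F := by
  rw [c1, map_div₀, map_neg, conj_segInt_vertical, conj_segInt_vertical, neg_div_neg_eq]
  · simp [conj_R_conj]
  · simp [conj_R_conj, conj_e1]

/-- Conjugation fixes the integrand and exchanges the two paths. -/
lemma conj_Omega : conj (Omega E F) = Omega E F := by
  have hf : ∀ z, conj ((conj z ^ 2 - e1 E F * conj z + c1 E F) / R E F (conj z)) =
      (z ^ 2 - e1 E F * z + c1 E F) / R E F z := by
    intro z; simp [conj_R_conj, conj_e1, conj_c1]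
  rw [Omega, map_add, conj_segInt, conj_segInt, Complex.conj_conj, Complex.conj_conj, add_comm]
  simp only [hf]

/-- Conjugation exchanges the two integrals in the numerator, the sign of the logarithm being
compensated by the reversed orientation; the prefactor `i` and the period are both imaginary, so
their signs cancel. -/
lemma conj_Delta (ℓ : ℂ → ℂ) : conj (Delta E F ℓ) = Delta E F ℓ := by
  have h1 : conj (segInt (fun z => -ℓ z / R E F z) E F) =
      segInt (fun z => conj (ℓ (conj z)) / R E F z) (conj F) (conj E) := by
    rw [conj_segInt, segInt_symm, ← neg_one_mul, ← segInt_const_mul]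
    congr 1
    ext z
    simp [conj_R_conj, neg_div]
  have h2 : conj (segInt (fun z => conj (ℓ (conj z)) / R E F z) (conj F) (conj E)) =
      segInt (fun z => -ℓ z / R E F z) E F := by rw [← h1, Complex.conj_conj]
  rw [Delta, map_div₀, map_mul, map_add, h1, h2, conj_segInt_vertical, Complex.conj_I, neg_mul,
    neg_div_neg_eq, add_comm]
  simp [conj_R_conj]

namespace Admissible

lemma eq_of_theta_eq_zero (h : Admissible E F) (hz : theta E F z = 0) :
    ∃ n m : ℤ, z.re = 1 / 2 + n ∧ z.im = (m + 1 / 2) * (tau E F).im := by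
  obtain ⟨n, m, rfl⟩ := jacobiTheta_eq_zero h.tau_im_pos h.tau_re hz
  exact ⟨n, m, by simp [h.tau_re], by simp; ring⟩

lemma abel_E0_re (h : Admissible E F) (hA : IsAbelIntegral E F A) :
    (A (E0 E F)).re = -1 / 4 := by
  rw [E0_eq_re h]
  exact h.abel_real_re hA (E0_re_lt h).ne

/-- The argument has real part `-1 / 4 - 1 / 4 + 1 / 2 = 0`, whereas the zeros of theta have
half-odd real parts. -/
lemma theta_add_ne_zero_of_re (h : Admissible E F) (hA : IsAbelIntegral E F A)
    (hv : v.re = -1 / 4) : theta E F (v + A (E0 E F) + 1 / 2 + tau E F / 2) ≠ 0 := by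
  intro h0
  obtain ⟨n, m, hn, -⟩ := h.eq_of_theta_eq_zero h0
  simp [h.tau_re, h.abel_E0_re hA, hv] at hn
  have : ((2 * n + 1 : ℤ) : ℝ) = (0 : ℤ) := by push_cast; linarith
  have := Int.cast_injective this
  omega

/-- Decided by imaginary parts, on which a real `s` has no influence: `s = 1 / 2` gives the
`k`-dependent denominator, and the real phase gives the normalizing ones. -/
lemma theta_sub_ne_zero_of_isRealValue (h : Admissible E F) (hv : IsRealValue E F A v) (s : ℝ) :
    theta E F (v - A (E0 E F) - tau E F / 2 - s) ≠ 0 := by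
  intro h0
  obtain ⟨n, m, -, hm⟩ := h.eq_of_theta_eq_zero h0
  apply hv.im_ne (m + 1)
  simp at hm
  push_cast
  linarith

lemma theta_sub_half_ne_zero_of_isRealValue (h : Admissible E F) (hv : IsRealValue E F A v) :
    theta E F (v - A (E0 E F) - 1 / 2 - tau E F / 2) ≠ 0 := by
  have := h.theta_sub_ne_zero_of_isRealValue hv (1 / 2)
  rw [sub_right_comm] at this
  simpa using this

/-- Decided by real parts: a zero would force `v.re` into `-1 / 4 + ℤ` or `1 / 4 + ℤ` respectively,
and the two open strips avoid both. -/
lemma theta_ne_zero_of_abs_re (h : Admissible E F) (hA : IsAbelIntegral E F A)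
    (hv : |v.re| < 1 / 4 ∨ |v.re + 1 / 2| < 1 / 4) :
    theta E F (v - A (E0 E F) - 1 / 2 - tau E F / 2) ≠ 0 ∧
      theta E F (v + A (E0 E F) + 1 / 2 + tau E F / 2) ≠ 0 := by
  have hint : ∀ (n : ℤ) (x : ℝ), (n : ℝ) = x → -1 < x → x < 1 → x = 0 := by
    rintro n x rfl h1 h2
    have h3 : -1 < n := by exact_mod_cast h1
    have h4 : n < 1 := by exact_mod_cast h2
    have : n = 0 := by omega
    simp [this]
  have hv' : -3 / 4 < v.re ∧ v.re < 1 / 4 ∧ v.re ≠ -1 / 4 := by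
    rcases hv with hv | hv <;> rw [abs_lt] at hv <;>
      exact ⟨by linarith, by linarith, by rintro h; linarith⟩
  obtain ⟨h1, h2, h3⟩ := hv'
  constructor <;> intro h0 <;> obtain ⟨n, m, hn, -⟩ := h.eq_of_theta_eq_zero h0 <;>
    simp [h.tau_re, h.abel_E0_re hA] at hn
  · have := hint (n + 1) (v.re + 1 / 4) (by push_cast; linarith) (by linarith) (by linarith)
    exact h3 (by linarith)
  · have := hint n (v.re - 1 / 4) (by linarith) (by linarith) (by linarith)
    linarith

/-- The denominators do not vanish at limits of the Abel integral at points off the real axis. -/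
lemma theta_ne_zero_of_im_ne_zero (h : Admissible E F) (hA : IsAbelIntegral E F A) (hz : z.im ≠ 0)
    {C : Set ℂ} (hC : C ⊆ (contour E F)ᶜ) (hzC : z ∈ closure C)
    (hv : Tendsto A (𝓝[C] z) (𝓝 v)) :
    theta E F (v - A (E0 E F) - 1 / 2 - tau E F / 2) ≠ 0 ∧
      theta E F (v + A (E0 E F) + 1 / 2 + tau E F / 2) ≠ 0 := by
  refine h.theta_ne_zero_of_abs_re hA ?_
  rcases lt_or_gt_of_ne hz with hz | hz
  · exact Or.inr (h.abel_re_of_im_neg hA hz hC hzC hv)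
  · exact Or.inl (h.abel_re_of_im_pos hA hz hC hzC hv)

lemma tendsto_abel (hA : IsAbelIntegral E F A) (hk : k ∉ contour E F) :
    Tendsto A (𝓝[(contour E F)ᶜ] k) (𝓝 (A k)) :=
  (hA.1 k hk).continuousAt.tendsto.mono_left nhdsWithin_le_nhds

lemma theta_add_ne_zero (h : Admissible E F) (hA : IsAbelIntegral E F A) (hk : k ∉ contour E F) :
    theta E F (A k + A (E0 E F) + 1 / 2 + tau E F / 2) ≠ 0 := by
  by_cases hz : k.im = 0
  · have hkr : k = (k.re : ℂ) := by apply Complex.ext <;> simp [hz]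
    rw [hkr] at hk ⊢
    exact h.theta_add_ne_zero_of_re hA (h.abel_real_re hA fun he => hk
      ((ofReal_mem_contour h).2 he))
  · exact (h.theta_ne_zero_of_im_ne_zero hA hz subset_rfl (subset_closure hk)
      (tendsto_abel hA hk)).2

lemma theta_sub_ne_zero (h : Admissible E F) (hA : IsAbelIntegral E F A) (hk : k ∉ contour E F)
    (hk0 : k ≠ E0 E F) : theta E F (A k - A (E0 E F) - 1 / 2 - tau E F / 2) ≠ 0 := by
  by_cases hz : k.im = 0
  · have hkr : k = (k.re : ℂ) := by apply Complex.ext <;> simp [hz]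
    rw [hkr] at hk hk0 ⊢
    exact h.theta_sub_half_ne_zero_of_isRealValue (h.isRealValue hA (fun he => hk
      ((ofReal_mem_contour h).2 he)) hk0)
  · exact (h.theta_ne_zero_of_im_ne_zero hA hz subset_rfl (subset_closure hk)
      (tendsto_abel hA hk)).1

lemma theta_ne_zero_in (h : Admissible E F) (hA : IsAbelIntegral E F A) (hz : z ∈ contour E F) :
    theta E F (extendFrom (regionIn E F) A z - A (E0 E F) - 1 / 2 - tau E F / 2) ≠ 0 ∧
      theta E F (extendFrom (regionIn E F) A z + A (E0 E F) + 1 / 2 + tau E F / 2) ≠ 0 := by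
  by_cases hz0 : z.im = 0
  · have hzr : z = (z.re : ℂ) := by apply Complex.ext <;> simp [hz0]
    rw [hzr, ofReal_mem_contour h] at hz
    rw [hzr, hz]
    exact ⟨h.theta_sub_half_ne_zero_of_isRealValue (h.isRealValue_in hA),
      h.theta_add_ne_zero_of_re hA (h.abel_in_re hA)⟩
  · have hcl : z ∈ closure (regionIn E F) := by
      rcases hz with (hz | hz) | hz
      · exact h.Sigma1_subset_closure_in hz
      · exact h.Sigma2_subset_closure_in hz
      · exact h.SigmaF_subset_closure_in hz
    exact h.theta_ne_zero_of_im_ne_zero hA hz0 h.regionIn_subset hcl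
      (tendsto_extendFrom ((h.abelLimits hA.1).inn z hz))

lemma theta_ne_zero_right (h : Admissible E F) (hA : IsAbelIntegral E F A) (hz : z ∈ SigmaF F) :
    theta E F (extendFrom (regionRight F) A z - A (E0 E F) - 1 / 2 - tau E F / 2) ≠ 0 ∧
      theta E F (extendFrom (regionRight F) A z + A (E0 E F) + 1 / 2 + tau E F / 2) ≠ 0 := by
  by_cases hz0 : z.im = 0
  · have hzr : z = (z.re : ℂ) := by apply Complex.ext <;> simp [hz0]
    have hz' : z ∈ contour E F := Or.inr hz
    rw [hzr, ofReal_mem_contour h] at hz'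
    rw [hzr, hz']
    exact ⟨h.theta_sub_half_ne_zero_of_isRealValue (h.isRealValue_right hA),
      h.theta_add_ne_zero_of_re hA (h.abel_right_re hA)⟩
  · exact h.theta_ne_zero_of_im_ne_zero hA hz0 h.regionRight_subset
      (h.SigmaF_subset_closure_right hz) (tendsto_extendFrom ((h.abelLimits hA.1).right z hz))

end Admissible

end SolitonGas

namespace SolitonGas

/-! ### The fourth root `gam` -/

variable {E F k z a b : ℂ}

lemma ne_of_notMem_segment (hk : k ∉ segment ℝ a b) : k - a ≠ 0 ∧ k - b ≠ 0 :=
  ⟨_root_.sub_ne_zero.2 fun h => hk (h ▸ left_mem_segment ℝ a b),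
    _root_.sub_ne_zero.2 fun h => hk (h ▸ right_mem_segment ℝ a b)⟩

lemma differentiableAt_cpow_div (hk : k ∉ segment ℝ a b) (p : ℂ) :
    DifferentiableAt ℂ (fun k => ((k - b) / (k - a)) ^ p) k :=
  DifferentiableAt.cpow
    (by fun_prop (disch := exact (ne_of_notMem_segment hk).1)) (by fun_prop) (div_mem_slitPlane hk)

lemma cpow_div_ne_zero (hk : k ∉ segment ℝ a b) (p : ℂ) : ((k - b) / (k - a)) ^ p ≠ 0 := by
  rw [Complex.cpow_ne_zero_iff]
  exact Or.inl (div_ne_zero (ne_of_notMem_segment hk).2 (ne_of_notMem_segment hk).1)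

lemma im_sub_div_eq_of_mem_openSegment (hz : z ∈ openSegment ℝ a b) (k : ℂ) :
    ((k - z) / (b - a)).im = ((k - a) / (b - a)).im := by
  rw [openSegment_eq_image'] at hz
  obtain ⟨t, -, rfl⟩ := hz
  rcases eq_or_ne (b - a) 0 with h | h
  · simp [h]
  · have : (k - (a + t • (b - a))) / (b - a) = (k - a) / (b - a) - (t : ℂ) := by
      rw [Complex.real_smul]; field_simp; ring
    rw [this]; simp

/-- The two boundary values of a power of `(k - b) / (k - a)` on the segment. -/
lemma exists_tendsto_cpow_div (hz : z ∈ openSegment ℝ a b) (hab : a ≠ b) (p : ℂ) :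
    ∃ l ≠ 0, Tendsto (fun k => ((k - b) / (k - a)) ^ p) (𝓝[leftSide (b - a) z] z)
        (𝓝 (Complex.exp (Real.pi * Complex.I * p) * l)) ∧
      Tendsto (fun k => ((k - b) / (k - a)) ^ p) (𝓝[rightSide (b - a) z] z)
        (𝓝 (Complex.exp (-(Real.pi * Complex.I * p)) * l)) := by
  obtain ⟨x, hx, e⟩ := div_re_openSegment hz hab
  have hza : z - a ≠ 0 := fun h => by
    rw [h, div_zero] at e
    exact hx.ne (by exact_mod_cast e.symm)
  have hx0 : (-x : ℂ) ≠ 0 := by exact_mod_cast (neg_pos.2 hx).ne'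
  have hc : Tendsto (fun k => Complex.exp (Complex.log (-((k - b) / (k - a))) * p)) (𝓝 z)
      (𝓝 (Complex.exp (Complex.log (-x) * p))) := by
    have : ContinuousAt (fun k => Complex.log (-((k - b) / (k - a)))) z := by
      refine ContinuousAt.clog (by fun_prop (disch := assumption)) ?_
      rw [e, ← Complex.ofReal_neg]
      exact Complex.ofReal_mem_slitPlane.2 (neg_pos.2 hx)
    have h2 : ContinuousAt (fun k => Complex.exp (Complex.log (-((k - b) / (k - a))) * p)) z := by
      fun_prop
    rw [ContinuousAt, e] at h2
    exact h2
  refine ⟨_, Complex.exp_ne_zero _, ((hc.mono_left nhdsWithin_le_nhds).const_mul _).congr' ?_,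
    ((hc.mono_left nhdsWithin_le_nhds).const_mul _).congr' ?_⟩
  · filter_upwards [self_mem_nhdsWithin] with k (hk : 0 < ((k - z) / (b - a)).im)
    rw [im_sub_div_eq_of_mem_openSegment hz] at hk
    have hw := im_div_sub_pos hk
    have h0 : (k - b) / (k - a) ≠ 0 := by rintro h; simp [h] at hw
    rw [Complex.cpow_def_of_ne_zero h0, log_eq_of_im_pos hw, ← Complex.exp_add]
    congr 1; ring
  · filter_upwards [self_mem_nhdsWithin] with k (hk : ((k - z) / (b - a)).im < 0)
    rw [im_sub_div_eq_of_mem_openSegment hz] at hk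
    have hw := im_div_sub_neg hk
    have h0 : (k - b) / (k - a) ≠ 0 := by rintro h; simp [h] at hw
    rw [Complex.cpow_def_of_ne_zero h0, log_eq_of_im_neg hw, ← Complex.exp_add]
    congr 1; ring

lemma differentiableAt_gam (hk : k ∉ contour E F) : DifferentiableAt ℂ (gam E F) k :=
  ((differentiableAt_cpow_div (fun h => hk (Or.inl (Or.inl h))) _).mul
    (differentiableAt_cpow_div (fun h => hk (Or.inr h)) _)).mul
    (differentiableAt_cpow_div (fun h => hk (Or.inl (Or.inr h))) _)

lemma gam_ne_zero (hk : k ∉ contour E F) : gam E F k ≠ 0 :=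
  mul_ne_zero (mul_ne_zero (cpow_div_ne_zero (fun h => hk (Or.inl (Or.inl h))) _)
    (cpow_div_ne_zero (fun h => hk (Or.inr h)) _))
    (cpow_div_ne_zero (fun h => hk (Or.inl (Or.inr h))) _)

lemma fourthRoot_sq (w : ℂ) : (w ^ (1 / 4 : ℂ)) ^ 2 = w ^ (1 / 2 : ℂ) := by
  rw [← Complex.cpow_nat_mul]; norm_num

lemma gam_sq (hk : k ∉ contour E F) : gam E F k ^ 2 = R E F k / ((k - E) * (k - F)) := by
  have h1 : k - E ≠ 0 ∧ k - F ≠ 0 := ne_of_notMem_segment (fun h => hk (Or.inl (Or.inl h)))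
  have h2 : k - conj F ≠ 0 ∧ _ := ne_of_notMem_segment (fun h => hk (Or.inl (Or.inr h)))
  obtain ⟨hE, hF⟩ := h1
  obtain ⟨hF', hE'⟩ := h2
  rw [gam, mul_pow, mul_pow, fourthRoot_sq, fourthRoot_sq, sqrt_sq, R]
  field_simp

lemma gam_pow_four (hk : k ∉ contour E F) :
    gam E F k ^ 4 = ((k - conj E) * (k - conj F)) / ((k - E) * (k - F)) := by
  have h1 : k - E ≠ 0 ∧ k - F ≠ 0 := ne_of_notMem_segment (fun h => hk (Or.inl (Or.inl h)))
  obtain ⟨hE, hF⟩ := h1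
  rw [show gam E F k ^ 4 = (gam E F k ^ 2) ^ 2 by ring, gam_sq hk, div_pow, R_sq]
  field_simp

lemma tendsto_gam_cocompact : Tendsto (gam E F) (cocompact ℂ) (𝓝 1) := by
  have key : ∀ a b p : ℂ, Tendsto (fun k => ((k - b) / (k - a)) ^ p) (cocompact ℂ) (𝓝 1) := by
    intro a b p
    have h1 : Tendsto (fun k : ℂ => (1 - b * k⁻¹) / (1 - a * k⁻¹)) (cocompact ℂ) (𝓝 1) := by
      have := ((tendsto_inv_cocompact.const_mul b).const_sub 1).div
        ((tendsto_inv_cocompact.const_mul a).const_sub 1) (by simp)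
      simpa [Pi.div_def] using this
    have h2 : Tendsto (fun k : ℂ => (k - b) / (k - a)) (cocompact ℂ) (𝓝 1) := by
      refine h1.congr' ?_
      have h0 : ∀ᶠ k : ℂ in cocompact ℂ, k ≠ 0 := 
        (isCompact_singleton (x := (0 : ℂ))).compl_mem_cocompact
      filter_upwards [h0] with k hk
      rw [← mul_div_mul_left (1 - b * k⁻¹) (1 - a * k⁻¹) hk]
      congr 1 <;> field_simp
    have := h2.cpow (tendsto_const_nhds (x := p)) (by simp)
    simpa using this
  have := ((key E F (1 / 4)).mul (key F (conj F) (1 / 2))).mul (key (conj F) (conj E) (1 / 4))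
  simp only [mul_one] at this
  exact this

/-- The ratio of the two boundary values of a quarter power is `i`; for a half power it is `-1`.
These are the jumps of `gam`. -/
lemma exp_quarter_pi : Complex.exp (Real.pi * Complex.I * (1 / 4)) =
    Complex.I * Complex.exp (-(Real.pi * Complex.I * (1 / 4))) := by
  rw [show Real.pi * Complex.I * (1 / 4) =
    Real.pi * Complex.I * (1 / 2) + -(Real.pi * Complex.I * (1 / 4)) by ring, Complex.exp_add,
    exp_half_pi_mul_I]
  congr 3; ring

lemma exp_half_pi : Complex.exp (Real.pi * Complex.I * (1 / 2)) =
    -Complex.exp (-(Real.pi * Complex.I * (1 / 2))) := by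
  rw [Complex.exp_neg, exp_half_pi_mul_I]; simp

namespace Admissible

lemma notMem_SigmaF_of_openSegment (h : Admissible E F) (hz : z ∈ openSegment ℝ E F) :
    z ∉ SigmaF F := fun hm =>
  (SolitonGas.mem_openSegment_Sigma1 h hz).2.2.1.ne ((mem_SigmaF h.imF).1 hm).1

lemma notMem_Sigma1_of_openSegment (h : Admissible E F) (hz : z ∈ openSegment ℝ F (conj F)) :
    z ∉ Sigma1 E F := by
  intro hm
  have h1 := ((SolitonGas.mem_Sigma1 h).1 hm).1
  obtain ⟨h2, -, h3⟩ := (mem_openSegment_SigmaF h.imF).1 hz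
  rw [lineForm, h2] at h1
  have h4 : (z.im - F.im) * (F.re - E.re) = 0 := by linarith
  rcases mul_eq_zero.1 h4 with h5 | h5
  · linarith
  · linarith [h.re_lt]

lemma notMem_Sigma2_of_openSegment (h : Admissible E F) (hz : z ∈ openSegment ℝ F (conj F)) :
    z ∉ Sigma2 E F := by
  rw [← conj_mem_Sigma1]
  refine h.notMem_Sigma1_of_openSegment ?_
  rw [conj_mem_openSegment, Complex.conj_conj, openSegment_symm]
  exact hz

lemma gam_jump_Sigma1 (h : Admissible E F) (hz : z ∈ openSegment ℝ E F) : ∃ g ≠ 0,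
    Tendsto (gam E F) (𝓝[regionTop E F] z) (𝓝 (Complex.I * g)) ∧
    Tendsto (gam E F) (𝓝[regionIn E F] z) (𝓝 g) := by
  obtain ⟨l, hl0, hl, hr⟩ := exists_tendsto_cpow_div hz h.E_ne_F (1 / 4)
  rw [h.leftSide_Sigma1 hz, exp_quarter_pi, mul_assoc] at hl
  rw [h.rightSide_Sigma1 hz] at hr
  have n1 := h.notMem_SigmaF_of_openSegment hz
  have n2 : z ∉ Sigma2 E F := h.notMem_Sigma2_of_im_nonneg (SolitonGas.mem_openSegment_Sigma1 h hz).2.2.2.le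
  have c1 := (differentiableAt_cpow_div n1 (1 / 2)).continuousAt.tendsto
  have c2 := (differentiableAt_cpow_div n2 (1 / 4)).continuousAt.tendsto
  refine ⟨_, mul_ne_zero (mul_ne_zero (mul_ne_zero (Complex.exp_ne_zero _) hl0)
    (cpow_div_ne_zero n1 _)) (cpow_div_ne_zero n2 _), ?_,
    (hr.mul (c1.mono_left nhdsWithin_le_nhds)).mul (c2.mono_left nhdsWithin_le_nhds)⟩
  rw [← mul_assoc, ← mul_assoc]
  exact (hl.mul (c1.mono_left nhdsWithin_le_nhds)).mul (c2.mono_left nhdsWithin_le_nhds)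

lemma gam_jump_Sigma2 (h : Admissible E F) (hz : z ∈ openSegment ℝ (conj F) (conj E)) : ∃ g ≠ 0,
    Tendsto (gam E F) (𝓝[regionBot E F] z) (𝓝 (Complex.I * g)) ∧
    Tendsto (gam E F) (𝓝[regionIn E F] z) (𝓝 g) := by
  obtain ⟨l, hl0, hl, hr⟩ := exists_tendsto_cpow_div hz h.conjE_ne_conjF.symm (1 / 4)
  rw [h.leftSide_Sigma2 hz, exp_quarter_pi, mul_assoc] at hl
  rw [h.rightSide_Sigma2 hz] at hr
  have hz' := mem_openSegment_Sigma2.1 hz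
  have n1 : z ∉ SigmaF F := by
    have := h.notMem_SigmaF_of_openSegment hz'
    rwa [SigmaF, conj_mem_segment, Complex.conj_conj, segment_symm] at this
  have n2 : z ∉ Sigma1 E F := h.notMem_Sigma1_of_im_nonpos
    (by simpa using (SolitonGas.mem_openSegment_Sigma1 h hz').2.2.2.le)
  have c1 := (differentiableAt_cpow_div n1 (1 / 2)).continuousAt.tendsto
  have c2 := (differentiableAt_cpow_div n2 (1 / 4)).continuousAt.tendsto
  refine ⟨_, mul_ne_zero (mul_ne_zero (cpow_div_ne_zero n2 _) (cpow_div_ne_zero n1 _))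
    (mul_ne_zero (Complex.exp_ne_zero _) hl0), ?_,
    ((c2.mono_left nhdsWithin_le_nhds).mul (c1.mono_left nhdsWithin_le_nhds)).mul hr⟩
  rw [mul_left_comm]
  exact ((c2.mono_left nhdsWithin_le_nhds).mul (c1.mono_left nhdsWithin_le_nhds)).mul hl

lemma gam_jump_SigmaF (h : Admissible E F) (hz : z ∈ openSegment ℝ F (conj F)) : ∃ g ≠ 0,
    Tendsto (gam E F) (𝓝[regionRight F] z) (𝓝 (-g)) ∧
    Tendsto (gam E F) (𝓝[regionIn E F] z) (𝓝 g) := by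
  obtain ⟨l, hl0, hl, hr⟩ := exists_tendsto_cpow_div hz h.F_ne_conjF (1 / 2)
  rw [h.leftSide_SigmaF hz, exp_half_pi, neg_mul] at hl
  rw [h.rightSide_SigmaF hz] at hr
  have n1 := h.notMem_Sigma1_of_openSegment hz
  have n2 := h.notMem_Sigma2_of_openSegment hz
  have c1 := (differentiableAt_cpow_div n1 (1 / 4)).continuousAt.tendsto
  have c2 := (differentiableAt_cpow_div n2 (1 / 4)).continuousAt.tendsto
  refine ⟨_, mul_ne_zero (mul_ne_zero (cpow_div_ne_zero n1 _)
    (mul_ne_zero (Complex.exp_ne_zero _) hl0)) (cpow_div_ne_zero n2 _), ?_,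
    ((c1.mono_left nhdsWithin_le_nhds).mul hr).mul (c2.mono_left nhdsWithin_le_nhds)⟩
  rw [← neg_mul, ← mul_neg]
  exact ((c1.mono_left nhdsWithin_le_nhds).mul hl).mul (c2.mono_left nhdsWithin_le_nhds)

/-- `E0` is the real `x` for which `(x - E) (x - F)` is real, and its value there is some `-m < 0`.
Then `R ^ 2 = m ^ 2` with `R > 0` on the real axis, so `gam ^ 2 = m / (-m)`. -/
lemma gam_E0_sq (h : Admissible E F) : gam E F (E0 E F) ^ 2 = -1 := by
  have hE := h.imE
  have hF := h.imF
  rw [gam_sq (E0_notMem_contour h)]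
  obtain ⟨y, hy, hR⟩ := R_ofReal_pos hE.ne' hF.ne' (E0 E F).re
  rw [← E0_eq_re h] at hR
  have he := E0_eq h
  set x : ℝ := (E.re * F.im + E.im * F.re) / (E.im + F.im) with hx
  have hxm : x * (E.im + F.im) = E.re * F.im + E.im * F.re := by
    rw [hx]; field_simp
  set m : ℝ := E.im * F.im - (x - E.re) * (x - F.re) with hm
  have hprod : (E0 E F - E) * (E0 E F - F) = ((-m : ℝ) : ℂ) := by
    rw [he]
    apply Complex.ext
    · simp [hm]
    · simp; linear_combination -hxm
  have hprod' : (E0 E F - conj E) * (E0 E F - conj F) = ((-m : ℝ) : ℂ) := by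
    rw [he]
    apply Complex.ext
    · simp [hm]
    · simp; linear_combination hxm
  have hm0 : 0 < m := by
    have h1 : E.re < x := by
      rw [hx, lt_div_iff₀ (by linarith)]; nlinarith [h.re_lt]
    have h2 : x < F.re := by
      rw [hx, div_lt_iff₀ (by linarith)]; nlinarith [h.re_lt]
    have h3 := mul_pos hE hF
    have h4 := mul_pos (_root_.sub_pos.2 h1) (_root_.sub_pos.2 h2)
    nlinarith
  have hsq := R_sq (E := E) (F := F) (k := E0 E F)
  rw [hprod, hprod', hR] at hsq
  have hy2 : y ^ 2 = m ^ 2 := by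
    have : y ^ 2 = -m * -m := by exact_mod_cast hsq
    linarith
  have hym : y = m := (pow_left_inj₀ hy.le hm0.le two_ne_zero).1 hy2
  rw [hprod, hR, hym]
  have : (m : ℂ) ≠ 0 := by exact_mod_cast hm0.ne'
  push_cast
  field_simp

/-- The fourth power is rational, with simple poles at `E`, `F` and simple zeros at their
conjugates. Treating the inverse alongside covers `gam + 1 / gam` and `gam - 1 / gam`. -/
lemma gam_pow_four_isBigO (h : Admissible E F) {p : ℂ} (hp : p ∈ endpoints E F) :
    (fun k => (k - p) * gam E F k ^ 4) =O[𝓝[(contour E F)ᶜ] p] (fun _ => (1 : ℝ)) ∧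
    (fun k => (k - p) * (gam E F k ^ 4)⁻¹) =O[𝓝[(contour E F)ᶜ] p] (fun _ => (1 : ℝ)) := by
  have d1 := _root_.sub_ne_zero.2 h.E_ne_F
  have d2 := _root_.sub_ne_zero.2 h.E_ne_F.symm
  have d3 := _root_.sub_ne_zero.2 h.E_ne_conjE
  have d4 := _root_.sub_ne_zero.2 h.E_ne_conjE.symm
  have d5 := _root_.sub_ne_zero.2 h.F_ne_conjF
  have d6 := _root_.sub_ne_zero.2 h.F_ne_conjF.symm
  have d7 := _root_.sub_ne_zero.2 h.E_ne_conjF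
  have d8 := _root_.sub_ne_zero.2 h.E_ne_conjF.symm
  have d9 := _root_.sub_ne_zero.2 h.F_ne_conjE
  have d10 := _root_.sub_ne_zero.2 h.F_ne_conjE.symm
  have d11 := _root_.sub_ne_zero.2 h.conjE_ne_conjF
  have d12 := _root_.sub_ne_zero.2 h.conjE_ne_conjF.symm
  have key : ∀ f g : ℂ → ℂ, ContinuousAt g p → (∀ k ∉ contour E F, f k = g k) →
      f =O[𝓝[(contour E F)ᶜ] p] (fun _ => (1 : ℝ)) := by
    intro f g hg hfg
    refine ((hg.tendsto.mono_left nhdsWithin_le_nhds).isBigO_one ℝ).congr' ?_ .rfl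
    filter_upwards [self_mem_nhdsWithin] with k hk
    exact (hfg k hk).symm
  have hne : ∀ k ∉ contour E F, k - E ≠ 0 ∧ k - F ≠ 0 ∧ k - conj F ≠ 0 ∧ k - conj E ≠ 0 := by
    intro k hk
    obtain ⟨h1, h2⟩ := ne_of_notMem_segment (fun h => hk (Or.inl (Or.inl h)))
    obtain ⟨h3, h4⟩ := ne_of_notMem_segment (fun h => hk (Or.inl (Or.inr h)))
    exact ⟨h1, h2, h3, h4⟩
  rcases hp with rfl | rfl | rfl | rfl <;> constructor
  · exact key _ (fun k => (k - conj p) * (k - conj F) / (k - F)) (by fun_prop (disch := assumption))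
      fun k hk => by
        obtain ⟨h1, h2, h3, h4⟩ := hne k hk
        rw [gam_pow_four hk]; field_simp
  · exact key _ (fun k => (k - p) ^ 2 * (k - F) / ((k - conj p) * (k - conj F)))
      (by fun_prop (disch := first | assumption | exact mul_ne_zero ‹_› ‹_›))
      fun k hk => by
        obtain ⟨h1, h2, h3, h4⟩ := hne k hk
        rw [gam_pow_four hk]; field_simp
  · exact key _ (fun k => (k - conj E) * (k - conj p) / (k - E)) (by fun_prop (disch := assumption))
      fun k hk => by
        obtain ⟨h1, h2, h3, h4⟩ := hne k hk
        rw [gam_pow_four hk]; field_simp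
  · exact key _ (fun k => (k - p) ^ 2 * (k - E) / ((k - conj E) * (k - conj p)))
      (by fun_prop (disch := first | assumption | exact mul_ne_zero ‹_› ‹_›))
      fun k hk => by
        obtain ⟨h1, h2, h3, h4⟩ := hne k hk
        rw [gam_pow_four hk]; field_simp
  · exact key _ (fun k => (k - conj E) ^ 2 * (k - conj F) / ((k - E) * (k - F)))
      (by fun_prop (disch := first | assumption | exact mul_ne_zero ‹_› ‹_›))
      fun k hk => by
        obtain ⟨h1, h2, h3, h4⟩ := hne k hk
        rw [gam_pow_four hk]; field_simp
  · exact key _ (fun k => (k - E) * (k - F) / (k - conj F)) (by fun_prop (disch := assumption))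
      fun k hk => by
        obtain ⟨h1, h2, h3, h4⟩ := hne k hk
        rw [gam_pow_four hk]; field_simp
  · exact key _ (fun k => (k - conj F) ^ 2 * (k - conj E) / ((k - E) * (k - F)))
      (by fun_prop (disch := first | assumption | exact mul_ne_zero ‹_› ‹_›))
      fun k hk => by
        obtain ⟨h1, h2, h3, h4⟩ := hne k hk
        rw [gam_pow_four hk]; field_simp
  · exact key _ (fun k => (k - E) * (k - F) / (k - conj E)) (by fun_prop (disch := assumption))
      fun k hk => by
        obtain ⟨h1, h2, h3, h4⟩ := hne k hk
        rw [gam_pow_four hk]; field_simp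

lemma isBigO_rpow_of_pow_four {l : Filter ℂ} {p : ℂ} {f : ℂ → ℂ} (hl : ∀ᶠ k in l, k ≠ p)
    (hf : (fun k => (k - p) * f k ^ 4) =O[l] (fun _ => (1 : ℝ))) :
    f =O[l] (fun k => ‖k - p‖ ^ (-(1 / 4) : ℝ)) := by
  obtain ⟨M, hM⟩ := hf.bound
  refine Asymptotics.IsBigO.of_bound (M ^ (1 / 4 : ℝ)) ?_
  filter_upwards [hM, hl] with k hk hkp
  have hpos : 0 < ‖k - p‖ := norm_pos_iff.2 (_root_.sub_ne_zero.2 hkp)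
  simp only [norm_mul, norm_pow, norm_one, mul_one] at hk
  have hM0 : 0 ≤ M := le_trans (by positivity) hk
  have h1 : ‖f k‖ ^ 4 ≤ M * ‖k - p‖⁻¹ := by
    rw [← div_eq_mul_inv, le_div_iff₀ hpos]; linarith
  rw [Real.norm_of_nonneg (by positivity), Real.rpow_neg (norm_nonneg _),
    ← Real.inv_rpow (norm_nonneg _), ← Real.mul_rpow hM0 (by positivity)]
  have h2 : ‖f k‖ = (‖f k‖ ^ 4) ^ (1 / 4 : ℝ) := by
    rw [← Real.rpow_natCast, ← Real.rpow_mul (norm_nonneg _)]; norm_num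
  rw [h2]
  exact Real.rpow_le_rpow (by positivity) h1 (by norm_num)

lemma gam_isBigO (h : Admissible E F) {p : ℂ} (hp : p ∈ endpoints E F) :
    (fun k => gam E F k) =O[𝓝[(contour E F)ᶜ] p] (fun k => ‖k - p‖ ^ (-(1 / 4) : ℝ)) ∧
    (fun k => 1 / gam E F k) =O[𝓝[(contour E F)ᶜ] p] (fun k => ‖k - p‖ ^ (-(1 / 4) : ℝ)) := by
  have hev : ∀ᶠ k in 𝓝[(contour E F)ᶜ] p, k ≠ p := by
    filter_upwards [self_mem_nhdsWithin] with k hk he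
    exact hk (he ▸ endpoints_subset_contour hp)
  obtain ⟨h1, h2⟩ := h.gam_pow_four_isBigO hp
  refine ⟨isBigO_rpow_of_pow_four hev h1, isBigO_rpow_of_pow_four hev ?_⟩
  simpa [one_div] using h2

end Admissible

end SolitonGas

namespace SolitonGas

/-! ### The explicit solution -/

variable {E F k z s φ ainf a0 a g : ℂ} {A : ℂ → ℂ}

lemma theta_neg (z : ℂ) : theta E F (-z) = theta E F z := jacobiTheta₂_neg_left z _

lemma theta_add_one (z : ℂ) : theta E F (z + 1) = theta E F z := jacobiTheta₂_add_left z _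

lemma theta_add_tau (z : ℂ) : theta E F (z + tau E F) =
    Complex.exp (-Real.pi * Complex.I * (tau E F + 2 * z)) * theta E F z :=
  jacobiTheta₂_add_left' z _

/-- The multiplier of a quotient depends only on the difference of the arguments, hence on `s` and
the shift `1 / 2`, not on `k`. -/
lemma theta_add_tau_div (x y : ℂ) : theta E F (x + tau E F) / theta E F (y + tau E F) =
    Complex.exp (2 * Real.pi * Complex.I * (y - x)) * (theta E F x / theta E F y) := by
  rw [theta_add_tau, theta_add_tau, mul_div_mul_comm, ← Complex.exp_sub]
  congr 2; ring

lemma Admissible.differentiable_theta (h : Admissible E F) : Differentiable ℂ (theta E F) :=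
  fun z => differentiableAt_jacobiTheta₂_fst z h.tau_im_pos

/-- The explicit matrix as a function of the value `g` of `gam`. -/
noncomputable def modelMatrix (E F s ainf a0 a g : ℂ) : Matrix (Fin 2) (Fin 2) ℂ :=
  !![1 / 2 * (g + 1 / g) * (theta E F (a - a0 - tau E F / 2 - s) /
          theta E F (a - a0 - 1 / 2 - tau E F / 2)) *
        (theta E F (ainf - a0 - 1 / 2 - tau E F / 2) / theta E F (ainf - a0 - tau E F / 2 - s)),
     1 / 2 * (g - 1 / g) * (theta E F (a + a0 + tau E F / 2 + s) /
          theta E F (a + a0 + 1 / 2 + tau E F / 2)) *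
        (theta E F (ainf - a0 - 1 / 2 - tau E F / 2) / theta E F (ainf - a0 - tau E F / 2 - s));
     1 / 2 * (g - 1 / g) * (theta E F (a + a0 + tau E F / 2 - s) /
          theta E F (a + a0 + 1 / 2 + tau E F / 2)) *
        (theta E F (ainf - a0 - 1 / 2 - tau E F / 2) / theta E F (ainf - a0 - tau E F / 2 + s)),
     1 / 2 * (g + 1 / g) * (theta E F (a - a0 - tau E F / 2 + s) /
          theta E F (a - a0 - 1 / 2 - tau E F / 2)) *
        (theta E F (ainf - a0 - 1 / 2 - tau E F / 2) / theta E F (ainf - a0 - tau E F / 2 + s))]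

lemma matrix_ext_two {M N : Matrix (Fin 2) (Fin 2) ℂ} (h00 : M 0 0 = N 0 0) (h01 : M 0 1 = N 0 1)
    (h10 : M 1 0 = N 1 0) (h11 : M 1 1 = N 1 1) : M = N := by
  ext i j
  fin_cases i <;> fin_cases j <;> assumption

/-- Evenness of theta exchanges the quotients of the two columns, and `g ↦ i g` exchanges `g + 1 /
g` with `g - 1 / g` up to the factor `i`. -/
lemma modelMatrix_neg (g : ℂ) : modelMatrix E F s ainf a0 (-a) (Complex.I * g) =
    modelMatrix E F s ainf a0 a g * !![0, Complex.I; Complex.I, 0] := by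
  have e1 : Complex.I * g + 1 / (Complex.I * g) = (g - 1 / g) * Complex.I := by
    rw [one_div, mul_inv, Complex.inv_I]; ring
  have e2 : Complex.I * g - 1 / (Complex.I * g) = (g + 1 / g) * Complex.I := by
    rw [one_div, mul_inv, Complex.inv_I]; ring
  have t1 : ∀ x : ℂ, theta E F (-a - a0 - tau E F / 2 - x) = theta E F (a + a0 + tau E F / 2 + x) :=
    fun x => by rw [← theta_neg]; congr 1; ring
  have t2 : ∀ x : ℂ, theta E F (-a - a0 - tau E F / 2 + x) = theta E F (a + a0 + tau E F / 2 - x) :=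
    fun x => by rw [← theta_neg]; congr 1; ring
  have t3 : ∀ x : ℂ, theta E F (-a + a0 + tau E F / 2 + x) = theta E F (a - a0 - tau E F / 2 - x) :=
    fun x => by rw [← theta_neg]; congr 1; ring
  have t4 : ∀ x : ℂ, theta E F (-a + a0 + tau E F / 2 - x) = theta E F (a - a0 - tau E F / 2 + x) :=
    fun x => by rw [← theta_neg]; congr 1; ring
  have t5 : theta E F (-a - a0 - 1 / 2 - tau E F / 2) =
      theta E F (a + a0 + 1 / 2 + tau E F / 2) := by
    rw [← theta_neg]; congr 1; ring
  have t6 : theta E F (-a + a0 + 1 / 2 + tau E F / 2) =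
      theta E F (a - a0 - 1 / 2 - tau E F / 2) := by
    rw [← theta_neg]; congr 1; ring
  rw [modelMatrix, modelMatrix, e1, e2, t1, t2, t3, t4, t5, t6]
  apply matrix_ext_two <;> simp [Matrix.mul_apply, Fin.sum_univ_two] <;> ring

lemma modelMatrix_sub_one (g : ℂ) :
    modelMatrix E F s ainf a0 (a - 1) g = modelMatrix E F s ainf a0 a g := by
  have t1 : ∀ x : ℂ, theta E F (a - 1 - a0 - tau E F / 2 - x) =
      theta E F (a - a0 - tau E F / 2 - x) :=
    fun x => by rw [← theta_add_one]; congr 1; ring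
  have t2 : ∀ x : ℂ, theta E F (a - 1 - a0 - tau E F / 2 + x) =
      theta E F (a - a0 - tau E F / 2 + x) :=
    fun x => by rw [← theta_add_one]; congr 1; ring
  have t3 : ∀ x : ℂ, theta E F (a - 1 + a0 + tau E F / 2 + x) =
      theta E F (a + a0 + tau E F / 2 + x) :=
    fun x => by rw [← theta_add_one]; congr 1; ring
  have t4 : ∀ x : ℂ, theta E F (a - 1 + a0 + tau E F / 2 - x) =
      theta E F (a + a0 + tau E F / 2 - x) :=
    fun x => by rw [← theta_add_one]; congr 1; ring
  have t5 : theta E F (a - 1 - a0 - 1 / 2 - tau E F / 2) =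
      theta E F (a - a0 - 1 / 2 - tau E F / 2) := by
    rw [← theta_add_one]; congr 1; ring
  have t6 : theta E F (a - 1 + a0 + 1 / 2 + tau E F / 2) =
      theta E F (a + a0 + 1 / 2 + tau E F / 2) := by
    rw [← theta_add_one]; congr 1; ring
  rw [modelMatrix, modelMatrix, t1, t2, t3, t4, t5, t6]

/-- The shift by `s` yields `exp (± i φ)`, and the `1 / 2` in the denominators yields a factor `-1`
that cancels the sign change of `g`. -/
lemma modelMatrix_add_tau (hs : s = φ / (2 * Real.pi)) (g : ℂ) :
    modelMatrix E F s ainf a0 (a + tau E F) (-g) = modelMatrix E F s ainf a0 a g *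
      !![Complex.exp (Complex.I * φ), 0; 0, Complex.exp (-(Complex.I * φ))] := by
  have hpi : (Real.pi : ℂ) ≠ 0 := by exact_mod_cast Real.pi_ne_zero
  have hφ : 2 * Real.pi * Complex.I * s = Complex.I * φ := by
    rw [hs]; field_simp
  have hexp : ∀ w : ℂ, Complex.exp (w - Real.pi * Complex.I) = -Complex.exp w := fun w => by
    rw [Complex.exp_sub, Complex.exp_pi_mul_I]; ring
  have hexp' : ∀ w : ℂ, Complex.exp (w + Real.pi * Complex.I) = -Complex.exp w := fun w => by
    rw [Complex.exp_add, Complex.exp_pi_mul_I]; ring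
  have e1 : -g + 1 / -g = -(g + 1 / g) := by rw [one_div, inv_neg]; ring
  have e2 : -g - 1 / -g = -(g - 1 / g) := by rw [one_div, inv_neg]; ring
  have t1 : theta E F (a + tau E F - a0 - tau E F / 2 - s) /
      theta E F (a + tau E F - a0 - 1 / 2 - tau E F / 2) =
      -Complex.exp (Complex.I * φ) * (theta E F (a - a0 - tau E F / 2 - s) /
        theta E F (a - a0 - 1 / 2 - tau E F / 2)) := by
    rw [← hφ, ← hexp, show a + tau E F - a0 - tau E F / 2 - s =
      a - a0 - tau E F / 2 - s + tau E F by ring, show a + tau E F - a0 - 1 / 2 - tau E F / 2 =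
      a - a0 - 1 / 2 - tau E F / 2 + tau E F by ring, theta_add_tau_div]
    congr 2; ring
  have t2 : theta E F (a + tau E F - a0 - tau E F / 2 + s) /
      theta E F (a + tau E F - a0 - 1 / 2 - tau E F / 2) =
      -Complex.exp (-(Complex.I * φ)) * (theta E F (a - a0 - tau E F / 2 + s) /
        theta E F (a - a0 - 1 / 2 - tau E F / 2)) := by
    rw [← hφ, ← hexp, show a + tau E F - a0 - tau E F / 2 + s =
      a - a0 - tau E F / 2 + s + tau E F by ring, show a + tau E F - a0 - 1 / 2 - tau E F / 2 =
      a - a0 - 1 / 2 - tau E F / 2 + tau E F by ring, theta_add_tau_div]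
    congr 2; ring
  have t3 : theta E F (a + tau E F + a0 + tau E F / 2 + s) /
      theta E F (a + tau E F + a0 + 1 / 2 + tau E F / 2) =
      -Complex.exp (-(Complex.I * φ)) * (theta E F (a + a0 + tau E F / 2 + s) /
        theta E F (a + a0 + 1 / 2 + tau E F / 2)) := by
    rw [← hφ, ← hexp', show a + tau E F + a0 + tau E F / 2 + s =
      a + a0 + tau E F / 2 + s + tau E F by ring, show a + tau E F + a0 + 1 / 2 + tau E F / 2 =
      a + a0 + 1 / 2 + tau E F / 2 + tau E F by ring, theta_add_tau_div]
    congr 2; ring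
  have t4 : theta E F (a + tau E F + a0 + tau E F / 2 - s) /
      theta E F (a + tau E F + a0 + 1 / 2 + tau E F / 2) =
      -Complex.exp (Complex.I * φ) * (theta E F (a + a0 + tau E F / 2 - s) /
        theta E F (a + a0 + 1 / 2 + tau E F / 2)) := by
    rw [← hφ, ← hexp', show a + tau E F + a0 + tau E F / 2 - s =
      a + a0 + tau E F / 2 - s + tau E F by ring, show a + tau E F + a0 + 1 / 2 + tau E F / 2 =
      a + a0 + 1 / 2 + tau E F / 2 + tau E F by ring, theta_add_tau_div]
    congr 2; ring
  rw [modelMatrix, modelMatrix, e1, e2, t1, t2, t3, t4]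
  apply matrix_ext_two <;> simp [Matrix.mul_apply, Fin.sum_univ_two] <;> ring

lemma modelMatrix_infty (h1 : theta E F (ainf - a0 - 1 / 2 - tau E F / 2) ≠ 0)
    (h2 : theta E F (ainf - a0 - tau E F / 2 - s) ≠ 0)
    (h3 : theta E F (ainf - a0 - tau E F / 2 + s) ≠ 0) :
    modelMatrix E F s ainf a0 ainf 1 = 1 := by
  rw [modelMatrix]
  have h4 : (2⁻¹ : ℂ) * (1 + 1) = 1 := by norm_num
  apply matrix_ext_two <;> simp [h4]
  · simp only [one_div] at h1
    rw [div_mul_div_cancel₀ h1, div_self h2]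
  · simp only [one_div] at h1
    rw [div_mul_div_cancel₀ h1, div_self h3]

lemma tendsto_matrix_two {l : Filter ℂ} {M : ℂ → Matrix (Fin 2) (Fin 2) ℂ}
    {N : Matrix (Fin 2) (Fin 2) ℂ} :
    Tendsto M l (𝓝 N) ↔ ∀ i j, Tendsto (fun k => M k i j) l (𝓝 (N i j)) :=
  tendsto_pi_nhds.trans (forall_congr' fun _ => tendsto_pi_nhds)

/-- The data of the construction: the branch points, an Abel integral, its limit at infinity and
a parameter for which the normalizing denominators do not vanish. -/
structure Model (E F : ℂ) (A : ℂ → ℂ) (ainf s : ℂ) : Prop extends Admissible E F where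
  isAbelIntegral : IsAbelIntegral E F A
  tendsto_infty : Tendsto A (cocompact ℂ) (𝓝 ainf)
  infty_half : theta E F (ainf - A (E0 E F) - 1 / 2 - tau E F / 2) ≠ 0
  infty_sub : theta E F (ainf - A (E0 E F) - tau E F / 2 - s) ≠ 0
  infty_add : theta E F (ainf - A (E0 E F) - tau E F / 2 + s) ≠ 0

/-- The explicit solution, with the removable singularity filled in. -/
noncomputable def explicitSolution (E F : ℂ) (A : ℂ → ℂ) (ainf s : ℂ) :
    ℂ → Matrix (Fin 2) (Fin 2) ℂ :=
  Function.update (fun k => explicitMatrix E F s ainf (A (E0 E F)) (A k) k) (E0 E F)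
    (Matrix.of fun i j => limUnder (𝓝[≠] (E0 E F))
      fun k => explicitMatrix E F s ainf (A (E0 E F)) (A k) k i j)

lemma explicitSolution_of_ne (hk : k ≠ E0 E F) : explicitSolution E F A ainf s k =
    explicitMatrix E F s ainf (A (E0 E F)) (A k) k :=
  Function.update_of_ne hk _ _

lemma tendsto_div_of_hasDerivAt {N D : ℂ → ℂ} {c n d : ℂ} (hN : HasDerivAt N n c)
    (hD : HasDerivAt D d c) (hN0 : N c = 0) (hD0 : D c = 0) (hd : d ≠ 0) :
    Tendsto (fun k => N k / D k) (𝓝[≠] c) (𝓝 (n / d)) := by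
  refine ((hN.tendsto_slope).div (hD.tendsto_slope) hd).congr' ?_
  filter_upwards [self_mem_nhdsWithin] with k hk
  have : k - c ≠ 0 := _root_.sub_ne_zero.2 hk
  simp only [slope_def_field, hN0, hD0, sub_zero, Pi.div_apply]
  field_simp

/-- In the coordinate `1 / k` the function has a removable singularity at `0`, and an analytic
function differs from its value there by `O(w)`. -/
lemma isBigO_inv_of_tendsto {f : ℂ → ℂ} {L : ℂ}
    (hd : ∀ᶠ k in cocompact ℂ, DifferentiableAt ℂ f k) (hf : Tendsto f (cocompact ℂ) (𝓝 L)) :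
    (fun k => f k - L) =O[cocompact ℂ] (fun k : ℂ => k⁻¹) := by
  have hinv : Tendsto (fun w : ℂ => w⁻¹) (𝓝[≠] 0) (cocompact ℂ) := by
    rw [← Metric.cobounded_eq_cocompact]; exact tendsto_inv₀_nhdsNE_zero
  set u : ℂ → ℂ := Function.update (fun w => f w⁻¹) 0 L with hu
  have hc : ContinuousAt u 0 := continuousAt_update_same.2 (hf.comp hinv)
  have han : AnalyticAt ℂ u 0 := by
    refine Complex.analyticAt_of_differentiable_on_punctured_nhds_of_continuousAt ?_ hc
    filter_upwards [hinv.eventually hd, self_mem_nhdsWithin] with w hw hw0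
    have : DifferentiableAt ℂ (fun w => f w⁻¹) w :=
      DifferentiableAt.comp (g := f) (f := fun w => w⁻¹) w hw (differentiableAt_inv hw0)
    refine this.congr_of_eventuallyEq ?_
    filter_upwards [isOpen_ne.mem_nhds hw0] with v hv
    exact Function.update_of_ne hv _ _
  have hO := han.differentiableAt.isBigO_sub.comp_tendsto tendsto_inv_cocompact
  have h0 : ∀ᶠ k : ℂ in cocompact ℂ, k ≠ 0 := (isCompact_singleton (x := (0 : ℂ))).compl_mem_cocompact
  refine hO.congr' ?_ ?_
  · filter_upwards [h0] with k hk
    simp [hu, hk]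
  · filter_upwards with k
    simp

lemma differentiableAt_gam_add_inv (hk : k ∉ contour E F) :
    DifferentiableAt ℂ (fun k => 1 / 2 * (gam E F k + 1 / gam E F k)) k ∧
      DifferentiableAt ℂ (fun k => 1 / 2 * (gam E F k - 1 / gam E F k)) k := by
  have hg := differentiableAt_gam hk
  have h1 : DifferentiableAt ℂ (fun k => 1 / gam E F k) k :=
    (differentiableAt_const _).div hg (gam_ne_zero hk)
  exact ⟨(hg.add h1).const_mul _, (hg.sub h1).const_mul _⟩

namespace Model

variable (m : Model E F A ainf s)
include m

lemma tendsto_modelMatrix {l : Filter ℂ} (hA : Tendsto A l (𝓝 a))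
    (hg : Tendsto (gam E F) l (𝓝 g)) (hg0 : g ≠ 0)
    (hd : theta E F (a - A (E0 E F) - 1 / 2 - tau E F / 2) ≠ 0 ∧
      theta E F (a + A (E0 E F) + 1 / 2 + tau E F / 2) ≠ 0) :
    Tendsto (fun k => explicitMatrix E F s ainf (A (E0 E F)) (A k) k) l
      (𝓝 (modelMatrix E F s ainf (A (E0 E F)) a g)) := by
  have hc := fun z => (m.differentiable_theta z).continuousAt.tendsto
  have hp := hg.add (tendsto_const_nhds (x := (1 : ℂ)).div hg hg0)
  have hm := hg.sub (tendsto_const_nhds (x := (1 : ℂ)).div hg hg0)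
  have d1 := (hc _).comp (((hA.sub_const (A (E0 E F))).sub_const (1 / 2)).sub_const (tau E F / 2))
  have d2 := (hc _).comp (((hA.add_const (A (E0 E F))).add_const (1 / 2)).add_const (tau E F / 2))
  have n1 := ((hA.sub_const (A (E0 E F))).sub_const (tau E F / 2))
  have n2 := ((hA.add_const (A (E0 E F))).add_const (tau E F / 2))
  refine tendsto_matrix_two.2 fun i j => ?_
  fin_cases i <;> fin_cases j
  · exact ((hp.const_mul _).mul (((hc _).comp (n1.sub_const s)).div d1 hd.1)).mul_const _
  · exact ((hm.const_mul _).mul (((hc _).comp (n2.add_const s)).div d2 hd.2)).mul_const _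
  · exact ((hm.const_mul _).mul (((hc _).comp (n2.sub_const s)).div d2 hd.2)).mul_const _
  · exact ((hp.const_mul _).mul (((hc _).comp (n1.add_const s)).div d1 hd.1)).mul_const _

lemma differentiableAt_theta_abel (hk : k ∉ contour E F) (c : ℂ) :
    DifferentiableAt ℂ (fun k => theta E F (A k + c)) k :=
  DifferentiableAt.comp (g := theta E F) (f := fun k => A k + c) k (m.differentiable_theta _)
    ((m.isAbelIntegral.1 k hk).differentiableAt.add_const c)

lemma differentiableAt_theta_sub (hk : k ∉ contour E F) (c : ℂ) :
    DifferentiableAt ℂ (fun k => theta E F (A k - A (E0 E F) - tau E F / 2 + c)) k := by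
  convert m.differentiableAt_theta_abel hk (-A (E0 E F) - tau E F / 2 + c) using 3
  ring

lemma differentiableAt_theta_sub_half (hk : k ∉ contour E F) :
    DifferentiableAt ℂ (fun k => theta E F (A k - A (E0 E F) - 1 / 2 - tau E F / 2)) k := by
  convert m.differentiableAt_theta_abel hk (-A (E0 E F) - 1 / 2 - tau E F / 2) using 3
  ring

lemma differentiableAt_explicit_offDiag (hk : k ∉ contour E F) :
    DifferentiableAt ℂ (fun k => explicitMatrix E F s ainf (A (E0 E F)) (A k) k 0 1) k ∧
    DifferentiableAt ℂ (fun k => explicitMatrix E F s ainf (A (E0 E F)) (A k) k 1 0) k := by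
  have hd : DifferentiableAt ℂ
      (fun k => theta E F (A k + A (E0 E F) + 1 / 2 + tau E F / 2)) k := by
    convert m.differentiableAt_theta_abel hk (A (E0 E F) + 1 / 2 + tau E F / 2) using 3
    ring
  have hn : ∀ c, DifferentiableAt ℂ
      (fun k => theta E F (A k + A (E0 E F) + tau E F / 2 + c)) k := fun c => by
    convert m.differentiableAt_theta_abel hk (A (E0 E F) + tau E F / 2 + c) using 3
    ring
  have hn' : DifferentiableAt ℂ
      (fun k => theta E F (A k + A (E0 E F) + tau E F / 2 - s)) k := by
    simpa only [sub_eq_add_neg] using hn (-s)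
  have h0 := m.theta_add_ne_zero m.isAbelIntegral hk
  exact ⟨(((differentiableAt_gam_add_inv hk).2.mul ((hn s).div hd h0)).mul_const _),
    (((differentiableAt_gam_add_inv hk).2.mul (hn'.div hd h0)).mul_const _)⟩

lemma differentiableAt_explicit_diag (hk : k ∉ contour E F) (hk0 : k ≠ E0 E F) :
    DifferentiableAt ℂ (fun k => explicitMatrix E F s ainf (A (E0 E F)) (A k) k 0 0) k ∧
    DifferentiableAt ℂ (fun k => explicitMatrix E F s ainf (A (E0 E F)) (A k) k 1 1) k := by
  have hd := m.differentiableAt_theta_sub_half hk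
  have hn' : DifferentiableAt ℂ
      (fun k => theta E F (A k - A (E0 E F) - tau E F / 2 - s)) k := by
    simpa only [sub_eq_add_neg] using m.differentiableAt_theta_sub hk (-s)
  have h0 := m.theta_sub_ne_zero m.isAbelIntegral hk hk0
  exact ⟨(((differentiableAt_gam_add_inv hk).1.mul (hn'.div hd h0)).mul_const _),
    (((differentiableAt_gam_add_inv hk).1.mul ((m.differentiableAt_theta_sub hk s).div hd h0)).mul_const
      _)⟩

/-- The zero of the diagonal denominator at `E0` is simple: the zero of theta is simple and `A` has
nonzero derivative. -/
lemma exists_hasDerivAt_theta_E0 : ∃ d ≠ 0,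
    HasDerivAt (fun k => theta E F (A k - A (E0 E F) - 1 / 2 - tau E F / 2)) d (E0 E F) := by
  have hk := E0_notMem_contour m.toAdmissible
  set z0 : ℂ := 1 / 2 + tau E F / 2 with hz0
  have h1 : HasDerivAt (theta E F) (deriv (theta E F) (-z0)) (-z0) :=
    (m.differentiable_theta _).hasDerivAt
  have h2 : HasDerivAt (fun z => theta E F (-z)) (deriv (theta E F) (-z0) * -1) z0 :=
    HasDerivAt.comp (h₂ := theta E F) (h := fun z => -z) z0 h1 (hasDerivAt_neg z0)
  have h3 : deriv (theta E F) z0 ≠ 0 := jacobiTheta_deriv_half_period m.tau_im_pos m.tau_re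
  simp only [theta_neg] at h2
  have h4 : deriv (theta E F) (-z0) ≠ 0 := fun h0 => by
    have := h2.deriv
    rw [h0, zero_mul] at this
    exact h3 this
  have hin : HasDerivAt (fun k => A k - A (E0 E F) - 1 / 2 - tau E F / 2)
      (omegaHat E F (E0 E F)) (E0 E F) :=
    (((m.isAbelIntegral.1 _ hk).sub_const _).sub_const _).sub_const _
  refine ⟨_, mul_ne_zero h4 (m.omegaHat_ne_zero hk),
    HasDerivAt.comp (h₂ := theta E F) (E0 E F) ?_ hin⟩
  rw [show A (E0 E F) - A (E0 E F) - 1 / 2 - tau E F / 2 = -z0 by rw [hz0]; ring]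
  exact h1

/-- In the diagonal entries `gam + 1 / gam` vanishes at `E0` and cancels the simple zero of the
denominator; the other entries are regular. -/
lemma tendsto_explicit_E0 (i j : Fin 2) : ∃ l, Tendsto
    (fun k => explicitMatrix E F s ainf (A (E0 E F)) (A k) k i j) (𝓝[≠] (E0 E F)) (𝓝 l) := by
  have hk := E0_notMem_contour m.toAdmissible
  obtain ⟨d, hd0, hd⟩ := m.exists_hasDerivAt_theta_E0
  have hD0 : theta E F (A (E0 E F) - A (E0 E F) - 1 / 2 - tau E F / 2) = 0 := by
    rw [← theta_neg, show -(A (E0 E F) - A (E0 E F) - 1 / 2 - tau E F / 2) =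
      1 / 2 + tau E F / 2 by ring]
    exact jacobiTheta_half_period
  have hg0 : 1 / 2 * (gam E F (E0 E F) + 1 / gam E F (E0 E F)) = 0 := by
    have h1 := m.gam_E0_sq
    have h2 := gam_ne_zero hk
    field_simp
    rw [h1]; norm_num
  have key : ∀ c, ∃ l, Tendsto (fun k => 1 / 2 * (gam E F k + 1 / gam E F k) *
      (theta E F (A k - A (E0 E F) - tau E F / 2 + c) /
        theta E F (A k - A (E0 E F) - 1 / 2 - tau E F / 2))) (𝓝[≠] (E0 E F)) (𝓝 l) := by
    intro c
    have := tendsto_div_of_hasDerivAt ((differentiableAt_gam_add_inv hk).1.mul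
      (m.differentiableAt_theta_sub hk c)).hasDerivAt hd (by simp only [Pi.mul_apply, hg0, zero_mul])
      hD0 hd0
    simp only [Pi.mul_apply, mul_div_assoc] at this
    exact ⟨_, this⟩
  fin_cases i <;> fin_cases j
  · obtain ⟨l, hl⟩ := key (-s)
    simp only [← sub_eq_add_neg] at hl
    exact ⟨_, hl.mul_const _⟩
  · exact ⟨_, (m.differentiableAt_explicit_offDiag hk).1.continuousAt.tendsto.mono_left
      nhdsWithin_le_nhds⟩
  · exact ⟨_, (m.differentiableAt_explicit_offDiag hk).2.continuousAt.tendsto.mono_left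
      nhdsWithin_le_nhds⟩
  · obtain ⟨l, hl⟩ := key s
    exact ⟨_, hl.mul_const _⟩

lemma differentiableAt_explicit (hk : k ∉ contour E F) (hk0 : k ≠ E0 E F) (i j : Fin 2) :
    DifferentiableAt ℂ (fun k => explicitMatrix E F s ainf (A (E0 E F)) (A k) k i j) k := by
  fin_cases i <;> fin_cases j
  · exact (m.differentiableAt_explicit_diag hk hk0).1
  · exact (m.differentiableAt_explicit_offDiag hk).1
  · exact (m.differentiableAt_explicit_offDiag hk).2
  · exact (m.differentiableAt_explicit_diag hk hk0).2

lemma differentiableAt_explicitSolution (hk : k ∉ contour E F) (i j : Fin 2) :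
    DifferentiableAt ℂ (fun k => explicitSolution E F A ainf s k i j) k := by
  have hne : ∀ k, k ∉ contour E F → k ≠ E0 E F →
      DifferentiableAt ℂ (fun k => explicitSolution E F A ainf s k i j) k := by
    intro k hk hk0
    refine (m.differentiableAt_explicit hk hk0 i j).congr_of_eventuallyEq ?_
    filter_upwards [isOpen_ne.mem_nhds hk0] with w hw
    rw [explicitSolution_of_ne hw]
  by_cases hk0 : k = E0 E F
  · subst hk0
    refine (Complex.analyticAt_of_differentiable_on_punctured_nhds_of_continuousAt ?_
      ?_).differentiableAt
    · filter_upwards [nhdsWithin_le_nhds (isOpen_compl_contour.mem_nhds hk),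
        self_mem_nhdsWithin] with w hw hw0
      exact hne w hw hw0
    · have e : (fun k => explicitSolution E F A ainf s k i j) = Function.update
          (fun k => explicitMatrix E F s ainf (A (E0 E F)) (A k) k i j) (E0 E F)
          (limUnder (𝓝[≠] (E0 E F))
            fun k => explicitMatrix E F s ainf (A (E0 E F)) (A k) k i j) := by
        ext w
        by_cases hw : w = E0 E F
        · subst hw; simp [explicitSolution]
        · rw [explicitSolution_of_ne hw, Function.update_of_ne hw]
      rw [e, continuousAt_update_same]
      exact tendsto_nhds_limUnder (m.tendsto_explicit_E0 i j)
  · exact hne k hk hk0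

lemma tendsto_explicitSolution {C : Set ℂ} (hz : z ∈ contour E F)
    (hA : Tendsto A (𝓝[C] z) (𝓝 a))
    (hg : Tendsto (gam E F) (𝓝[C] z) (𝓝 g)) (hg0 : g ≠ 0)
    (hd : theta E F (a - A (E0 E F) - 1 / 2 - tau E F / 2) ≠ 0 ∧
      theta E F (a + A (E0 E F) + 1 / 2 + tau E F / 2) ≠ 0) :
    Tendsto (explicitSolution E F A ainf s) (𝓝[C] z)
      (𝓝 (modelMatrix E F s ainf (A (E0 E F)) a g)) := by
  refine (m.tendsto_modelMatrix hA hg hg0 hd).congr' ?_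
  have : z ≠ E0 E F := fun he => E0_notMem_contour m.toAdmissible (he ▸ hz)
  filter_upwards [nhdsWithin_le_nhds (isOpen_ne.mem_nhds this)] with k hk
  rw [explicitSolution_of_ne hk]

lemma hasJump_Sigma1 : HasJump (explicitSolution E F A ainf s) E F
    !![0, Complex.I; Complex.I, 0] := by
  intro z hz
  have hA := m.isAbelIntegral
  have hl := m.abelLimits hA.1
  have hz1 : z ∈ Sigma1 E F := openSegment_subset_segment ℝ _ _ hz
  have hzc : z ∈ contour E F := Or.inl (Or.inl hz1)
  obtain ⟨g, hg0, hgl, hgr⟩ := m.gam_jump_Sigma1 hz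
  have t1 := tendsto_extendFrom (hl.top z hz1)
  have d1 := m.theta_ne_zero_of_im_ne_zero hA (m.im_pos_of_mem_Sigma1 hz1).ne'
    m.regionTop_subset (m.Sigma1_subset_closure_top hz1) t1
  have s1 := m.tendsto_explicitSolution hzc t1 hgl (mul_ne_zero Complex.I_ne_zero hg0) d1
  have s2 := m.tendsto_explicitSolution hzc (tendsto_extendFrom (hl.inn z hzc)) hgr hg0
    (m.theta_ne_zero_in hA hzc)
  rw [(m.abelJumps hA).sigma1 z hz1] at s1
  rw [← m.leftSide_Sigma1 hz] at s1
  rw [← m.rightSide_Sigma1 hz] at s2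
  exact ⟨_, _, s1, s2, modelMatrix_neg g⟩

lemma hasJump_Sigma2 : HasJump (explicitSolution E F A ainf s) (conj F) (conj E)
    !![0, Complex.I; Complex.I, 0] := by
  intro z hz
  have hA := m.isAbelIntegral
  have hl := m.abelLimits hA.1
  have hz1 : z ∈ Sigma2 E F := openSegment_subset_segment ℝ _ _ hz
  have hzc : z ∈ contour E F := Or.inl (Or.inr hz1)
  obtain ⟨g, hg0, hgl, hgr⟩ := m.gam_jump_Sigma2 hz
  have t1 := tendsto_extendFrom (hl.bot z hz1)
  have him : z.im ≠ 0 := by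
    have := m.im_pos_of_mem_Sigma1 (conj_mem_Sigma1.2 hz1)
    rw [Complex.conj_im] at this
    linarith
  have d1 := m.theta_ne_zero_of_im_ne_zero hA him
    m.regionBot_subset (m.Sigma2_subset_closure_bot hz1) t1
  have s1 := m.tendsto_explicitSolution hzc t1 hgl (mul_ne_zero Complex.I_ne_zero hg0) d1
  have s2 := m.tendsto_explicitSolution hzc (tendsto_extendFrom (hl.inn z hzc)) hgr hg0
    (m.theta_ne_zero_in hA hzc)
  rw [(m.abelJumps hA).sigma2 z hz1, modelMatrix_sub_one] at s1
  rw [← m.leftSide_Sigma2 hz] at s1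
  rw [← m.rightSide_Sigma2 hz] at s2
  exact ⟨_, _, s1, s2, modelMatrix_neg g⟩

lemma hasJump_SigmaF (hs : s = φ / (2 * Real.pi)) :
    HasJump (explicitSolution E F A ainf s) F (conj F)
      !![Complex.exp (Complex.I * φ), 0; 0, Complex.exp (-(Complex.I * φ))] := by
  intro z hz
  have hA := m.isAbelIntegral
  have hl := m.abelLimits hA.1
  have hz1 : z ∈ SigmaF F := openSegment_subset_segment ℝ _ _ hz
  have hzc : z ∈ contour E F := Or.inr hz1
  obtain ⟨g, hg0, hgl, hgr⟩ := m.gam_jump_SigmaF hz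
  have s1 := m.tendsto_explicitSolution hzc (tendsto_extendFrom (hl.right z hz1)) hgl
    (neg_ne_zero.2 hg0) (m.theta_ne_zero_right hA hz1)
  have s2 := m.tendsto_explicitSolution hzc (tendsto_extendFrom (hl.inn z hzc)) hgr hg0
    (m.theta_ne_zero_in hA hzc)
  rw [(m.abelJumps hA).sigmaF z hz1] at s1
  rw [← m.leftSide_SigmaF hz] at s1
  rw [← m.rightSide_SigmaF hz] at s2
  exact ⟨_, _, s1, s2, modelMatrix_add_tau hs g⟩

lemma isModelSolution (hs : s = φ / (2 * Real.pi)) :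
    IsModelSolution E F φ (explicitSolution E F A ainf s) where
  analytic i j k hk := (m.differentiableAt_explicitSolution hk i j).differentiableWithinAt
  jump_Sigma1 := m.hasJump_Sigma1
  jump_Sigma2 := m.hasJump_Sigma2
  jump_SigmaF := m.hasJump_SigmaF hs
  normalization i j := by
    refine isBigO_inv_of_tendsto (f := fun k => explicitSolution E F A ainf s k i j) ?_ ?_
    · filter_upwards [eventually_notMem_contour] with k hk
      exact m.differentiableAt_explicitSolution hk i j
    · have hd : theta E F (ainf + A (E0 E F) + 1 / 2 + tau E F / 2) ≠ 0 :=
        m.theta_add_ne_zero_of_re m.isAbelIntegral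
          (m.abel_infty_re m.isAbelIntegral m.tendsto_infty)
      have := m.tendsto_modelMatrix m.tendsto_infty tendsto_gam_cocompact one_ne_zero
        ⟨m.infty_half, hd⟩
      rw [modelMatrix_infty m.infty_half m.infty_sub m.infty_add] at this
      refine (tendsto_matrix_two.1 this i j).congr' ?_
      have h0 : ∀ᶠ k : ℂ in cocompact ℂ, k ≠ E0 E F :=
        (isCompact_singleton (x := E0 E F)).compl_mem_cocompact
      filter_upwards [h0] with k hk
      rw [explicitSolution_of_ne hk]

/-- Along each region `A` converges at an endpoint to a value where the theta denominators are
nonzero, since the endpoints are not real. Only `gam ± 1 / gam` can blow up. -/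
lemma quarterRootEndpoints : QuarterRootEndpoints E F (explicitSolution E F A ainf s) := by
  intro p hp i j
  replace hp : p ∈ endpoints E F := hp
  have hA := m.isAbelIntegral
  have hpc : p ∈ contour E F := endpoints_subset_contour hp
  have him : p.im ≠ 0 := by
    rcases hp with rfl | rfl | rfl | rfl <;> simp [m.imE.ne', m.imF.ne']
  refine isBigO_endpoint m.toAdmissible hA.1 hp fun C hC hpC v hv => ?_
  have hmono := nhdsWithin_mono p hC
  obtain ⟨g1, g2⟩ := m.gam_isBigO hp
  have hp1 := ((g1.add g2).const_mul_left (1 / 2)).mono hmono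
  have hm1 := ((g1.sub g2).const_mul_left (1 / 2)).mono hmono
  have hd := m.theta_ne_zero_of_im_ne_zero hA him hC hpC hv
  have hc := fun z => (m.differentiable_theta z).continuousAt.tendsto
  have d1 := (hc _).comp (((hv.sub_const (A (E0 E F))).sub_const (1 / 2)).sub_const (tau E F / 2))
  have d2 := (hc _).comp (((hv.add_const (A (E0 E F))).add_const (1 / 2)).add_const (tau E F / 2))
  have n1 := ((hv.sub_const (A (E0 E F))).sub_const (tau E F / 2))
  have n2 := ((hv.add_const (A (E0 E F))).add_const (tau E F / 2))
  have key : (fun k => explicitMatrix E F s ainf (A (E0 E F)) (A k) k i j) =O[𝓝[C] p]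
      (fun k => ‖k - p‖ ^ (-(1 / 4) : ℝ) * 1) := by
    fin_cases i <;> fin_cases j
    · exact (hp1.mul ((((hc _).comp (n1.sub_const s)).div d1 hd.1).mul_const _ |>.isBigO_one ℝ)
        ).congr_left fun k => (mul_assoc _ _ _).symm
    · exact (hm1.mul ((((hc _).comp (n2.add_const s)).div d2 hd.2).mul_const _ |>.isBigO_one ℝ)
        ).congr_left fun k => (mul_assoc _ _ _).symm
    · exact (hm1.mul ((((hc _).comp (n2.sub_const s)).div d2 hd.2).mul_const _ |>.isBigO_one ℝ)
        ).congr_left fun k => (mul_assoc _ _ _).symm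
    · exact (hp1.mul ((((hc _).comp (n1.add_const s)).div d1 hd.1).mul_const _ |>.isBigO_one ℝ)
        ).congr_left fun k => (mul_assoc _ _ _).symm
  simp only [mul_one] at key
  refine key.congr' ?_ .rfl
  have : p ≠ E0 E F := fun he => E0_notMem_contour m.toAdmissible (he ▸ hpc)
  filter_upwards [nhdsWithin_le_nhds (isOpen_ne.mem_nhds this)] with k hk
  rw [explicitSolution_of_ne hk]

end Model

end SolitonGas

namespace SolitonGas

/-! ### Uniqueness -/

variable {E F k z φ : ℂ} {S T : ℂ → Matrix (Fin 2) (Fin 2) ℂ}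

/-- Liouville's theorem for functions without jump across the contour. -/
lemma Admissible.eq_of_no_jump (h : Admissible E F) {f : ℂ → ℂ} {L : ℂ}
    (hf : DifferentiableOn ℂ f (contour E F)ᶜ)
    (h1 : ∀ z ∈ openSegment ℝ E F, ∃ l, Tendsto f (𝓝[leftSide (F - E) z] z) (𝓝 l) ∧
      Tendsto f (𝓝[rightSide (F - E) z] z) (𝓝 l))
    (hF : ∀ z ∈ openSegment ℝ F (conj F), ∃ l, Tendsto f (𝓝[leftSide (conj F - F) z] z) (𝓝 l) ∧
      Tendsto f (𝓝[rightSide (conj F - F) z] z) (𝓝 l))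
    (h2 : ∀ z ∈ openSegment ℝ (conj F) (conj E),
      ∃ l, Tendsto f (𝓝[leftSide (conj E - conj F) z] z) (𝓝 l) ∧
        Tendsto f (𝓝[rightSide (conj E - conj F) z] z) (𝓝 l))
    (hend : ∀ p ∈ endpoints E F, Tendsto (fun k => (k - p) * f k) (𝓝[(contour E F)ᶜ] p) (𝓝 0))
    (hinf : Tendsto f (cocompact ℂ) (𝓝 L)) (hk : k ∉ contour E F) : f k = L := by
  suffices hs : ∃ g : ℂ → ℂ, DifferentiableOn ℂ g Set.univ ∧
      ∀ k ∈ Set.univ \ contour E F, k ∉ endpoints E F → g k = f k by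
    obtain ⟨g, hg, hgf⟩ := hs
    have hgf' : ∀ k ∉ contour E F, g k = f k := fun k hk =>
      hgf k ⟨trivial, hk⟩ fun hq => hk (endpoints_subset_contour hq)
    rw [← hgf' k hk]
    refine (differentiableOn_univ.1 hg).apply_eq_of_tendsto_cocompact k (hinf.congr' ?_)
    filter_upwards [eventually_notMem_contour] with w hw
    exact (hgf' w hw).symm
  refine exists_differentiableOn_extension isOpen_univ isClosed_contour
    (hf.mono fun k hk => hk.2) (finite_endpoints (E := E) (F := F)) ?_ fun p hp _ => hend p hp
  rintro z ⟨-, hzK⟩ hzQ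
  rcases mem_contour_cases hzK hzQ with hz | hz | hz
  · exact ⟨_, h.sub_ne_zero, h.eventually_mem_contour_Sigma1 hz, h1 z hz⟩
  · exact ⟨_, _root_.sub_ne_zero.2 h.F_ne_conjF.symm, h.eventually_mem_contour_SigmaF hz, hF z hz⟩
  · exact ⟨_, _root_.sub_ne_zero.2 h.conjE_ne_conjF, h.eventually_mem_contour_Sigma2 hz, h2 z hz⟩

/-- The factors `J` and `adjugate J` meet in the middle and multiply to `det J = 1`. The adjugate
replaces the inverse, so invertibility of `S` need not be known beforehand. -/
lemma HasJump.mul_adjugate {a b : ℂ} {J : Matrix (Fin 2) (Fin 2) ℂ} (hT : HasJump T a b J)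
    (hS : HasJump S a b J) (hJ : J.det = 1) (i j : Fin 2) (hz : z ∈ openSegment ℝ a b) :
    ∃ l, Tendsto (fun k => (T k * (S k).adjugate) i j) (𝓝[leftSide (b - a) z] z) (𝓝 l) ∧
      Tendsto (fun k => (T k * (S k).adjugate) i j) (𝓝[rightSide (b - a) z] z) (𝓝 l) := by
  obtain ⟨Tp, Tm, hTp, hTm, rfl⟩ := hT z hz
  obtain ⟨Sp, Sm, hSp, hSm, rfl⟩ := hS z hz
  have key : ∀ {l : Filter ℂ} {M N : Matrix (Fin 2) (Fin 2) ℂ}, Tendsto T l (𝓝 M) →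
      Tendsto S l (𝓝 N) → Tendsto (fun k => (T k * (S k).adjugate) i j) l
        (𝓝 ((M * N.adjugate) i j)) := by
    intro l M N hM hN
    have hadj : Continuous fun N : Matrix (Fin 2) (Fin 2) ℂ => N.adjugate :=
      continuous_id.matrix_adjugate
    have hmul : Continuous fun P : Matrix (Fin 2) (Fin 2) ℂ × Matrix (Fin 2) (Fin 2) ℂ =>
        P.1 * P.2 := continuous_fst.matrix_mul continuous_snd
    exact tendsto_matrix_two.1 ((hmul.tendsto (M, N.adjugate)).comp
      (hM.prodMk_nhds ((hadj.tendsto N).comp hN))) i j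
  refine ⟨_, ?_, key hTm hSm⟩
  have h1 := key hTp hSp
  have h2 : Tm * J * (Sm * J).adjugate = Tm * Sm.adjugate := by
    rw [Matrix.adjugate_mul_distrib, Matrix.mul_assoc, ← Matrix.mul_assoc J, Matrix.mul_adjugate, hJ,
      one_smul, Matrix.one_mul]
  rwa [h2] at h1

lemma IsModelSolution.tendsto_one (hS : IsModelSolution E F φ S) :
    Tendsto S (cocompact ℂ) (𝓝 1) := by
  refine tendsto_matrix_two.2 fun i j => ?_
  have := (hS.normalization i j).trans_tendsto tendsto_inv_cocompact
  simpa using this.add_const ((1 : Matrix (Fin 2) (Fin 2) ℂ) i j)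

lemma exists_mul_adjugate_apply (i j : Fin 2) :
    ∃ a b c d a' b' c' d' : Fin 2, ∃ u v : ℂ, ∀ M N : Matrix (Fin 2) (Fin 2) ℂ,
      (M * N.adjugate) i j = u * (M a b * N c d) + v * (M a' b' * N c' d') := by
  fin_cases j
  · refine ⟨i, 0, 1, 1, i, 1, 1, 0, 1, -1, fun M N => ?_⟩
    simp [Matrix.mul_apply, Fin.sum_univ_two, Matrix.adjugate_fin_two]
  · refine ⟨i, 0, 0, 1, i, 1, 0, 0, -1, 1, fun M N => ?_⟩
    simp [Matrix.mul_apply, Fin.sum_univ_two, Matrix.adjugate_fin_two]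

/-- Two quarter-root bounds multiply to a square-root bound, too weak a singularity to survive at an
isolated point; without jumps the entries are entire with a limit at infinity. -/
lemma IsModelSolution.mul_adjugate_eq_one (h : Admissible E F) (hT : IsModelSolution E F φ T)
    (hS : IsModelSolution E F φ S) (hT4 : QuarterRootEndpoints E F T)
    (hS4 : QuarterRootEndpoints E F S) (hk : k ∉ contour E F) :
    T k * (S k).adjugate = 1 := by
  ext i j
  obtain ⟨a, b, c, d, a', b', c', d', u, v, huv⟩ := exists_mul_adjugate_apply i j
  have hJ : (!![0, Complex.I; Complex.I, 0] : Matrix (Fin 2) (Fin 2) ℂ).det = 1 := by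
    simp [Matrix.det_fin_two]
  refine h.eq_of_no_jump (f := fun k => (T k * (S k).adjugate) i j) ?_
    (fun z hz => hT.jump_Sigma1.mul_adjugate hS.jump_Sigma1 hJ i j hz)
    (fun z hz => hT.jump_SigmaF.mul_adjugate hS.jump_SigmaF ?_ i j hz)
    (fun z hz => hT.jump_Sigma2.mul_adjugate hS.jump_Sigma2 hJ i j hz) ?_ ?_ hk
  · simp only [huv]
    exact (((hT.analytic _ _).mul (hS.analytic _ _)).const_mul u).add
      (((hT.analytic _ _).mul (hS.analytic _ _)).const_mul v)
  · rw [Matrix.det_fin_two_of, ← Complex.exp_add]; simp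
  · intro p hp
    simp only [huv]
    have hO := (((hT4 p hp a b).mul (hS4 p hp c d)).const_mul_left u).add
      (((hT4 p hp a' b').mul (hS4 p hp c' d')).const_mul_left v)
    have hid : (fun k : ℂ => k - p) =O[𝓝[(contour E F)ᶜ] p] fun k => ‖k - p‖ :=
      (Asymptotics.isBigO_refl _ _).norm_right
    refine (hid.mul hO).trans_tendsto ?_
    have h1 : Tendsto (fun k : ℂ => ‖k - p‖ ^ (1 / 2 : ℝ)) (𝓝[(contour E F)ᶜ] p) (𝓝 0) := by
      have : Continuous fun k : ℂ => ‖k - p‖ ^ (1 / 2 : ℝ) :=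
        (continuous_id.sub continuous_const).norm.rpow_const fun _ => Or.inr (by norm_num)
      have := (this.tendsto p).mono_left (nhdsWithin_le_nhds (s := (contour E F)ᶜ))
      simpa using this
    refine h1.congr' ?_
    filter_upwards [self_mem_nhdsWithin] with k hk
    have hkp : 0 < ‖k - p‖ := norm_pos_iff.2
      (_root_.sub_ne_zero.2 fun he => hk (he ▸ endpoints_subset_contour hp))
    rw [← Real.rpow_add hkp]
    nth_rw 2 [← Real.rpow_one ‖k - p‖]
    rw [← Real.rpow_add hkp]
    norm_num
  · have hadj : Continuous fun N : Matrix (Fin 2) (Fin 2) ℂ => N.adjugate :=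
      continuous_id.matrix_adjugate
    have h2 := (hadj.tendsto 1).comp hS.tendsto_one
    rw [Matrix.adjugate_one] at h2
    have hmul : Continuous fun P : Matrix (Fin 2) (Fin 2) ℂ × Matrix (Fin 2) (Fin 2) ℂ =>
        P.1 * P.2 := continuous_fst.matrix_mul continuous_snd
    have h3 := (hmul.tendsto (1, 1)).comp (hT.tendsto_one.prodMk_nhds h2)
    rw [Matrix.mul_one] at h3
    exact tendsto_matrix_two.1 h3 i j

/-- The solution with at most quarter-root singularities is unique. -/
theorem IsModelSolution.unique (h : Admissible E F) (hT : IsModelSolution E F φ T)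
    (hS : IsModelSolution E F φ S) (hT4 : QuarterRootEndpoints E F T)
    (hS4 : QuarterRootEndpoints E F S) (hk : k ∉ contour E F) : T k = S k := by
  have h1 := IsModelSolution.mul_adjugate_eq_one h hT hS hT4 hS4 hk
  -- Taking both solutions equal shows that the adjugate of `S` is its inverse.
  have h2 := IsModelSolution.mul_adjugate_eq_one h hS hS hS4 hS4 hk
  exact left_inv_eq_right_inv h1 (mul_eq_one_comm.1 h2)

end SolitonGas

/-! ### Assembly of the theorem -/

theorem mainTheorem3 (E F : ℂ) (hE : 0 < E.im) (hF : 0 < F.im) (hEF : E.re < F.re)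
    (r ℓ : ℂ → ℂ)
    (hr : AnalyticOnNhd ℂ r (SolitonGas.Sigma1 E F))
    (hr0 : ∀ z ∈ SolitonGas.Sigma1 E F, r z ≠ 0)
    (hl : ContinuousOn ℓ (SolitonGas.Sigma1 E F))
    (hlr : ∀ z ∈ SolitonGas.Sigma1 E F, Complex.exp (ℓ z) = 2 * r z)
    (x : ℝ) (φ s t : ℂ)
    (hφ : φ = x * SolitonGas.Omega E F + SolitonGas.Delta E F ℓ)
    (hs : s = φ / (2 * Real.pi))
    (ht : t = SolitonGas.tau E F) :
    0 < t.im ∧ SolitonGas.E0 E F ∉ SolitonGas.contour E F ∧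
    (∃ A : ℂ → ℂ, SolitonGas.IsAbelIntegral E F A) ∧
    ∀ A : ℂ → ℂ, SolitonGas.IsAbelIntegral E F A →
      ∃ ainf : ℂ, Tendsto A (cocompact ℂ) (𝓝 ainf) ∧
        -- no denominator of the explicit formula vanishes
        SolitonGas.theta E F (ainf - A (SolitonGas.E0 E F) - t / 2 - s) ≠ 0 ∧
        SolitonGas.theta E F (ainf - A (SolitonGas.E0 E F) - t / 2 + s) ≠ 0 ∧
        (∀ k ∉ SolitonGas.contour E F, SolitonGas.gam E F k ≠ 0 ∧
          SolitonGas.theta E F (A k + A (SolitonGas.E0 E F) + 1 / 2 + t / 2) ≠ 0 ∧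
          (k ≠ SolitonGas.E0 E F →
            SolitonGas.theta E F (A k - A (SolitonGas.E0 E F) - 1 / 2 - t / 2) ≠ 0)) ∧
        -- the formula, with its removable singularity filled in, solves the problem
        ∃ S : ℂ → Matrix (Fin 2) (Fin 2) ℂ,
          SolitonGas.IsModelSolution E F φ S ∧
          SolitonGas.QuarterRootEndpoints E F S ∧
          (∀ k ∉ SolitonGas.contour E F, k ≠ SolitonGas.E0 E F →
            S k = SolitonGas.explicitMatrix E F s ainf (A (SolitonGas.E0 E F)) (A k) k) ∧
          -- and it is the only solution with such endpoint behaviour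
          (∀ T : ℂ → Matrix (Fin 2) (Fin 2) ℂ,
            SolitonGas.IsModelSolution E F φ T → SolitonGas.QuarterRootEndpoints E F T →
            ∀ k ∉ SolitonGas.contour E F, T k = S k) := by
  have h : SolitonGas.Admissible E F := ⟨hE, hF, hEF⟩
  -- Reality of the phase makes `s` real, which is what the criterion for the normalizing
  -- denominators needs, for `s` as well as for `-s`.
  have hφc : conj φ = φ := by
    rw [hφ, map_add, map_mul, SolitonGas.conj_Omega, SolitonGas.conj_Delta, Complex.conj_ofReal]
  obtain ⟨ψ, hψ⟩ := Complex.conj_eq_iff_real.1 hφc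
  have hsr : s = ((ψ / (2 * Real.pi) : ℝ) : ℂ) := by
    rw [hs, hψ]; push_cast; rfl
  subst ht
  refine ⟨h.tau_im_pos, SolitonGas.E0_notMem_contour h, h.exists_isAbelIntegral, fun A hA => ?_⟩
  obtain ⟨ainf, hainf⟩ := SolitonGas.exists_tendsto_cocompact hA.1
  have hreal := h.isRealValue_infty hA hainf
  have m : SolitonGas.Model E F A ainf s :=
    { toAdmissible := h
      isAbelIntegral := hA
      tendsto_infty := hainf
      infty_half := h.theta_sub_half_ne_zero_of_isRealValue hreal
      infty_sub := by
        rw [hsr]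
        exact h.theta_sub_ne_zero_of_isRealValue hreal _
      infty_add := by
        rw [hsr, ← sub_neg_eq_add, ← Complex.ofReal_neg]
        exact h.theta_sub_ne_zero_of_isRealValue hreal _ }
  refine ⟨ainf, hainf, m.infty_sub, m.infty_add, fun k hk => ⟨SolitonGas.gam_ne_zero hk,
    h.theta_add_ne_zero hA hk, h.theta_sub_ne_zero hA hk⟩,
    SolitonGas.explicitSolution E F A ainf s, m.isModelSolution hs, m.quarterRootEndpoints,
    fun k _ hk0 => SolitonGas.explicitSolution_of_ne hk0, fun T hT hT4 k hk =>
      SolitonGas.IsModelSolution.unique h hT (m.isModelSolution hs) hT4 m.quarterRootEndpoints hk⟩
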